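/- **Setting.** For $k\in L^2(\mathbb R^3\times\mathbb R^3)$ write $k$ also for the operator on $L^2(\mathbb R^3)$ with integral kernel $k(x,y)$, $\bar k$ for the operator with kernel $\overline{k(x,y)}$, and $\|k\|_2$ for the $L^2(\mathbb R^3\times\mathbb R^3)$ norm; products of kernels are operator products. Let $\mathcal F=\bigoplus_{n\ge0}L^2_s(\mathbb R^{3n})$ be the bosonic Fock space with creation and annihilation operators $a^*(f),a(f)$ and number operator $\mathcal N$. Put $A(f,g)=a(f)+a^*(\bar g)$ and $Jf=\bar f$. Let $$B(k)=\tfrac12\int dx\,dy\,\big(k(x,y)a_x^*a_y^*-\overline{k(x,y)}\,a_xa_y\big)$$ on the vectors with finitely many particles, and let $T(k)=\exp(B(k))$, i.e. the value at $1$ of the strongly continuous group of operators on $\mathcal F$ generated by the closure of $B(k)$. Put $$\mathrm{ch}(k)=\sum_{n\ge0}\frac{(k\bar k)^n}{(2n)!},\quad \mathrm{sh}(k)=\sum_{n\ge0}\frac{(k\bar k)^nk}{(2n+1)!},\quad p(k)=\mathrm{ch}(k)-1,\quad r(k)=\mathrm{sh}(k)-k.$$ A bounded linear $\Theta$ on $L^2(\mathbb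 R^3)\oplus L^2(\mathbb R^3)$ is called a Bogoliubov transformation if it commutes with $\begin{pmatrix}0&J\\J&0\end{pmatrix}$ and $\Theta^*S\Theta=S$, $S=\begin{pmatrix}1&0\\0&-1\end{pmatrix}$. The weak gradients of a kernel in its first and second variable are $\nabla_1,\nabla_2$, and $\|\nabla_iK\|_2=\infty$ if $\nabla_iK\notin L^2$ (with $0\cdot\infty=0$). **Lemma.** Let $k\in L^2(\mathbb R^3\times\mathbb R^3)$ with $k(x,y)=k(y,x)$. (i) The closure of $B(k)$ generates a unique strongly continuous one-parameter group, $T(k)$ is unitary, and $T(k)^*=T(k)^{-1}=T(-k)$. (ii) The series for $\mathrm{ch}(k)$, $\mathrm{sh}(k)$ converge absolutely in operator norm, $$\Theta_k=\begin{pmatrix}\mathrm{ch}(k)&\mathrm{sh}(k)\\ \mathrm{sh}(\bar k)&\mathrm{ch}(\bar k)\end{pmatrix}$$ is a Bogoliubov transformation, $T(k)$ maps $D(\mathcal N^{1/2})$ into itself, and for all $f,g\in L^2(\mathbb R^3)$ $$T(k)^*A(f,g)T(k)=A(\Theta_k(f,g))\quad\text{on } D(\mathcal N^{1/2}).$$ (iii)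 $p(k),r(k),\mathrm{sh}(k)$ are Hilbert–Schmidt operators; each has a unique kernel in $L^2(\mathbb R^3\times\mathbb R^3)$, whose $L^2$ norm is the Hilbert–Schmidt norm, and $\|p(k)\|_2,\ \|r(k)\|_2,\ \|\mathrm{sh}(k)\|_2\le e^{\|k\|_2}$. (iv) If $\nabla_1k\in L^2(\mathbb R^3\times\mathbb R^3)$, then $\nabla_2k$, $\nabla_1(k\bar k)$, $\nabla_2(\bar kk)\in L^2(\mathbb R^3\times\mathbb R^3)$; $\nabla_1k$ and $\nabla_2k$ are the integral kernels of $\nabla k$ and (on $C_c^\infty(\mathbb R^3)$) of $-k\nabla$; and $$\|\nabla_1p(k)\|_2,\ \|\nabla_1r(k)\|_2\le e^{\|k\|_2}\|\nabla_1(k\bar k)\|_2,\qquad \|\nabla_2p(k)\|_2,\ \|\nabla_2r(k)\|_2\le e^{\|k\|_2}\|\nabla_2(\bar kk)\|_2.$$ (v) There is a universal constant $C>0$ such that, whenever $t\mapsto k_t\in L^2(\mathbb R^3\times\mathbb R^3)$ is a family of symmetric kernels that is differentiable in $L^2(\mathbb R^3\times\mathbb R^3)$ at $t$ with derivative $\dot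 k$, the kernels of $p(k_t)$ and $r(k_t)$ are differentiable at $t$ in the same sense, and, with $k=k_t$, $$\|\dot p(k)\|_2,\ \|\dot r(k)\|_2\le\|\dot k\|_2e^{\|k\|_2},$$ and for $i=1,2$ $$\|\nabla_i\dot p(k)\|_2,\ \|\nabla_i\dot r(k)\|_2\le Ce^{\|k\|_2}\Big(\|\dot k\|_2\|\nabla_i(k\bar k)\|_2+\|\nabla_i(\dot k\bar k)\|_2+\|\nabla_i(k\overline{\dot k})\|_2\Big).$$ -/

import Mathlib

open MeasureTheory
open scoped ENNReal InnerProductSpace ContDiff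

noncomputable section

namespace Bogoliubov

/-! ## One-particle space, kernels and their operators -/

/-- Physical space `ℝ³`. -/
abbrev E3 : Type := EuclideanSpace ℝ (Fin 3)

/-- The one-particle space `L²(ℝ³)`. -/
abbrev L2 : Type := Lp ℂ 2 (volume : Measure E3)

/-- The space of kernels `L²(ℝ³ × ℝ³)`. On this space and on `L2`, `star` is the pointwise complex
conjugation `k ↦ k̄`, and the norm is `‖·‖₂`. -/
abbrev Kernel : Type := Lp ℂ 2 (volume : Measure (E3 × E3))

/-- `k(x,y) = k(y,x)` for almost all `x, y`. -/
def IsSymm (k : Kernel) : Prop :=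
  ∀ᵐ q : E3 × E3, k (q.2, q.1) = k q

theorem ae_integrable_slice {X Y : Type*} [MeasureSpace X] [MeasureSpace Y]
    [SFinite (volume : Measure X)] [SFinite (volume : Measure Y)]
    {h : Y → ℂ} (hh : MemLp h 2 (volume : Measure Y)) {g : Y × X → ℂ}
    (hg : MemLp g 2 (volume : Measure (Y × X))) :
    ∀ᵐ x : X, MemLp (fun y => g (y, x)) 2 (volume : Measure Y) ∧
      Integrable (fun y => h y * g (y, x)) (volume : Measure Y) := by
  have h1 : Integrable (fun q => ‖g q‖ ^ 2) ((volume : Measure Y).prod (volume : Measure X)) :=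
    (memLp_two_iff_integrable_sq_norm hg.1).1 hg
  have hs : AEStronglyMeasurable (fun q : X × Y => g q.swap)
      ((volume : Measure X).prod (volume : Measure Y)) := by
    have := hg.1
    exact AEStronglyMeasurable.prod_swap this
  filter_upwards [h1.prod_left_ae, hs.prodMk_left] with x hx hm
  have : MemLp (fun y => g (y, x)) 2 (volume : Measure Y) :=
    (memLp_two_iff_integrable_sq_norm hm).2 hx
  exact ⟨this, hh.integrable_mul this⟩

theorem norm_sq_eq {X : Type*} [MeasurableSpace X] {μ : Measure X} (f : Lp ℂ 2 μ) :
    ‖f‖ ^ 2 = ∫ x, ‖f x‖ ^ 2 ∂μ := by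
  have h := @L2.inner_def X ℂ ℂ _ _ _ _ _ f f
  rw [inner_self_eq_norm_sq_to_K] at h
  have h2 : (((‖f‖ ^ 2 : ℝ)) : ℂ) = ((∫ x, ‖f x‖ ^ 2 ∂μ : ℝ) : ℂ) := by
    rw [← integral_complex_ofReal]
    push_cast
    rw [← Complex.coe_algebraMap] at *
    simpa [inner_self_eq_norm_sq_to_K] using h
  exact_mod_cast h2

theorem norm_integral_mul_sq_le {X : Type*} [MeasurableSpace X] {μ : Measure X} {u v : X → ℂ}
    (hu : MemLp u 2 μ) (hv : MemLp v 2 μ) :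
    ‖∫ x, u x * v x ∂μ‖ ^ 2 ≤ (∫ x, ‖u x‖ ^ 2 ∂μ) * ∫ x, ‖v x‖ ^ 2 ∂μ := by
  have hU : MemLp (fun x => star (u x)) 2 μ := hu.star
  have h1 : inner ℂ hU.toLp hv.toLp = ∫ x, u x * v x ∂μ := by
    rw [L2.inner_def]
    refine integral_congr_ae ?_
    filter_upwards [hU.coeFn_toLp, hv.coeFn_toLp] with x h1 h2
    rw [h1, h2]
    simp [mul_comm]
  have h2 : ‖hU.toLp‖ ^ 2 = ∫ x, ‖u x‖ ^ 2 ∂μ := by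
    rw [norm_sq_eq]
    refine integral_congr_ae ?_
    filter_upwards [hU.coeFn_toLp] with x h1
    rw [h1, norm_star]
  have h3 : ‖hv.toLp‖ ^ 2 = ∫ x, ‖v x‖ ^ 2 ∂μ := by
    rw [norm_sq_eq]
    refine integral_congr_ae ?_
    filter_upwards [hv.coeFn_toLp] with x h1
    rw [h1]
  rw [← h1, ← h2, ← h3, ← mul_pow]
  exact pow_le_pow_left₀ (norm_nonneg _) (norm_inner_le_norm _ _) 2

/-- The function `x ↦ ∫ K(x,y) f(y) dy`. -/
def kernelFun (K : Kernel) (f : L2) (x : E3) : ℂ := ∫ y, K (x, y) * f y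

theorem kernel_slice (K : Kernel) (f : L2) :
    ∀ᵐ x : E3, MemLp (fun y => K (x, y)) 2 (volume : Measure E3) ∧
      Integrable (fun y => K (x, y) * f y) := by
  have hs : MemLp (fun q : E3 × E3 => K q.swap) 2 (volume : Measure (E3 × E3)) :=
    (Lp.memLp K).comp_measurePreserving Measure.measurePreserving_swap
  filter_upwards [ae_integrable_slice (Lp.memLp f) hs] with x hx
  refine ⟨hx.1, ?_⟩
  simpa [mul_comm] using hx.2

theorem kernelFun_bound (K : Kernel) (f : L2) :
    ∀ᵐ x : E3, ‖kernelFun K f x‖ ^ 2 ≤ (∫ y, ‖K (x, y)‖ ^ 2) * ‖f‖ ^ 2 := by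
  filter_upwards [kernel_slice K f] with x hx
  rw [norm_sq_eq f]
  exact norm_integral_mul_sq_le hx.1 (Lp.memLp f)

theorem kernel_integrable_sq (K : Kernel) :
    Integrable (fun q => ‖K q‖ ^ 2) ((volume : Measure E3).prod (volume : Measure E3)) :=
  (memLp_two_iff_integrable_sq_norm (Lp.memLp K).1).1 (Lp.memLp K)

theorem kernelFun_memLp (K : Kernel) (f : L2) :
    MemLp (kernelFun K f) 2 (volume : Measure E3) := by
  have hm : AEStronglyMeasurable (kernelFun K f) (volume : Measure E3) := by
    have h1 : AEStronglyMeasurable (fun q : E3 × E3 => K q * f q.2)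
        ((volume : Measure E3).prod (volume : Measure E3)) :=
      (Lp.memLp K).1.mul ((Lp.memLp f).1.comp_quasiMeasurePreserving
        Measure.quasiMeasurePreserving_snd)
    exact h1.integral_prod_right'
  rw [memLp_two_iff_integrable_sq_norm hm]
  refine Integrable.mono' ((kernel_integrable_sq K).integral_prod_left.mul_const (‖f‖ ^ 2))
    (hm.norm.pow 2) ?_
  filter_upwards [kernelFun_bound K f] with x hx
  simpa using hx

/-- The (Hilbert–Schmidt) operator on `L²(ℝ³)` with kernel `K`, `(K f)(x) = ∫ K(x,y) f(y) dy`. -/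
def kop (K : Kernel) : L2 →L[ℂ] L2 :=
  LinearMap.mkContinuous
    { toFun := fun f => (kernelFun_memLp K f).toLp
      map_add' := by
        intro f g
        rw [← MemLp.toLp_add]
        refine MemLp.toLp_congr _ _ ?_
        filter_upwards [kernel_slice K f, kernel_slice K g] with x hf hg
        simp only [kernelFun, Pi.add_apply]
        rw [← integral_add hf.2 hg.2]
        refine integral_congr_ae ?_
        filter_upwards [Lp.coeFn_add f g] with y hy
        rw [hy, Pi.add_apply, mul_add]
      map_smul' := by
        intro c f
        rw [RingHom.id_apply, ← MemLp.toLp_const_smul]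
        refine MemLp.toLp_congr _ _ (Filter.Eventually.of_forall fun x => ?_)
        simp only [kernelFun, Pi.smul_apply]
        rw [← integral_smul]
        refine integral_congr_ae ?_
        filter_upwards [Lp.coeFn_smul c f] with y hy
        rw [hy, Pi.smul_apply, smul_eq_mul, smul_eq_mul]
        ring }
    ‖K‖ (by
      intro f
      refine abs_le_of_sq_le_sq' ?_ (by positivity) |>.2
      have h1 : ‖(kernelFun_memLp K f).toLp‖ ^ 2 = ∫ x, ‖kernelFun K f x‖ ^ 2 := by
        rw [norm_sq_eq]
        refine integral_congr_ae ?_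
        filter_upwards [(kernelFun_memLp K f).coeFn_toLp] with x hx
        rw [hx]
      have h2 : ‖K‖ ^ 2 = ∫ x : E3, ∫ y : E3, ‖K (x, y)‖ ^ 2 := by
        rw [norm_sq_eq]
        exact integral_prod _ (kernel_integrable_sq K)
      show ‖(kernelFun_memLp K f).toLp‖ ^ 2 ≤ _
      rw [h1, mul_pow, h2, ← integral_mul_const]
      refine integral_mono_ae
        ((memLp_two_iff_integrable_sq_norm (kernelFun_memLp K f).1).1 (kernelFun_memLp K f))
        ((kernel_integrable_sq K).integral_prod_left.mul_const (‖f‖ ^ 2)) ?_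
      exact kernelFun_bound K f)

/-- `ch(k) = ∑ (k k̄)ⁿ / (2n)!`, a series of bounded operators. -/
def ch (k : Kernel) : L2 →L[ℂ] L2 :=
  ∑' n : ℕ, ((Nat.factorial (2 * n) : ℂ)⁻¹) • (kop k * kop (star k)) ^ n

/-- `sh(k) = ∑ (k k̄)ⁿ k / (2n+1)!`, a series of bounded operators. -/
def sh (k : Kernel) : L2 →L[ℂ] L2 :=
  ∑' n : ℕ, ((Nat.factorial (2 * n + 1) : ℂ)⁻¹) • ((kop k * kop (star k)) ^ n * kop k)

/-- `p(k) = ch(k) - 1`. -/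
def pOp (k : Kernel) : L2 →L[ℂ] L2 := ch k - 1

/-- `r(k) = sh(k) - k`. -/
def rOp (k : Kernel) : L2 →L[ℂ] L2 := sh k - kop k

open Classical in
/-- The `L²(ℝ³ × ℝ³)` kernel of an operator on `L²(ℝ³)` (zero if there is none). -/
def kernelOf (A : L2 →L[ℂ] L2) : Kernel :=
  if h : ∃ K : Kernel, kop K = A then h.choose else 0

/-- `A` is a Hilbert–Schmidt operator whose one and only `L²` kernel is `kernelOf A`, and the
Hilbert–Schmidt norm of `A` (computed in any orthonormal basis) is the `L²` norm of that kernel. -/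
def IsHilbertSchmidt (A : L2 →L[ℂ] L2) : Prop :=
  (∀ K : Kernel, kop K = A ↔ K = kernelOf A) ∧
    ∀ (ι : Type) (e : HilbertBasis ι ℂ L2),
      HasSum (fun i => ‖A (e i)‖ ^ 2) (‖kernelOf A‖ ^ 2)

/-- The product `K₁ K₂` of two kernels in the sense of operators. -/
def kerComp (K₁ K₂ : Kernel) : E3 × E3 → ℂ :=
  fun q => ∫ z, K₁ (q.1, z) * K₂ (z, q.2)

/-! ## Bogoliubov transformations of `L² ⊕ L²` -/

/-- `L²(ℝ³) ⊕ L²(ℝ³)` with its Hilbert space structure. -/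
abbrev L2Sum : Type := WithLp 2 (L2 × L2)

/-- The antilinear map `(f, g) ↦ (ḡ, f̄)`. -/
def swapConj (u : L2Sum) : L2Sum := WithLp.toLp 2 (star u.snd, star u.fst)

/-- The operator on `L² ⊕ L²` with matrix `(U₁₁, U₁₂; U₂₁, U₂₂)`. -/
def blockOp (U₁₁ U₁₂ U₂₁ U₂₂ : L2 →L[ℂ] L2) : L2Sum →L[ℂ] L2Sum :=
  ((WithLp.prodContinuousLinearEquiv 2 ℂ L2 L2).symm : L2 × L2 →L[ℂ] L2Sum) ∘L
    ((U₁₁.coprod U₁₂).prod (U₂₁.coprod U₂₂)) ∘L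
    (WithLp.prodContinuousLinearEquiv 2 ℂ L2 L2 : L2Sum →L[ℂ] L2 × L2)

/-- `S = (1, 0; 0, -1)`. -/
def sOp : L2Sum →L[ℂ] L2Sum := blockOp 1 0 0 (-1)

/-- `Θ` commutes with `(0, J; J, 0)` and `S = Θ* S Θ`. -/
def IsBogoliubov (Θ : L2Sum →L[ℂ] L2Sum) : Prop :=
  (∀ u, Θ (swapConj u) = swapConj (Θ u)) ∧ sOp = star Θ * sOp * Θ

/-- `Θ_k = (ch(k), sh(k); sh(k̄), ch(k̄))`. -/
def theta (k : Kernel) : L2Sum →L[ℂ] L2Sum :=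
  blockOp (ch k) (sh k) (sh (star k)) (ch (star k))

/-! ## Fock space -/

theorem measurePreserving_perm {n : ℕ} (σ : Equiv.Perm (Fin n)) :
    MeasurePreserving (fun x : Fin n → E3 => x ∘ σ) volume volume := by
  have h := volume_measurePreserving_piCongrLeft (fun _ : Fin n => E3) σ.symm
  convert! h using 1
  ext x i
  simp [MeasurableEquiv.coe_piCongrLeft, Equiv.piCongrLeft_apply]

/-- The `n`-particle sector `L²_s(ℝ³ⁿ)`: the `ψ` with `ψ(x_σ1, …, x_σn) = ψ(x_1, …, x_n)`. -/
def sector (n : ℕ) : Submodule ℂ (Lp ℂ 2 (volume : Measure (Fin n → E3))) :=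
  ⨅ σ : Equiv.Perm (Fin n), LinearMap.eqLocus
    (Lp.compMeasurePreservingₗ ℂ (fun x : Fin n → E3 => x ∘ σ) (measurePreserving_perm σ))
    LinearMap.id

instance (n : ℕ) : CompleteSpace (sector n) := by
  have : IsClosed (sector n : Set (Lp ℂ 2 (volume : Measure (Fin n → E3)))) := by
    rw [sector, Submodule.coe_iInf]
    refine isClosed_iInter fun σ => ?_
    exact isClosed_eq (Lp.isometry_compMeasurePreserving (measurePreserving_perm σ)).continuous
      continuous_id
  exact this.completeSpace_coe

/-- The bosonic Fock space `⨁ₙ L²_s(ℝ³ⁿ)` (Hilbert direct sum). -/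
abbrev Fock : Type := lp (fun n : ℕ => sector n) 2

/-- The wave function `ψ⁽ⁿ⁾` of the `n`-particle component of `ψ`. -/
def comp (ψ : Fock) (n : ℕ) : (Fin n → E3) → ℂ :=
  ((ψ n : sector n) : Lp ℂ 2 (volume : Measure (Fin n → E3)))

theorem comp_memLp (ψ : Fock) (n : ℕ) : MemLp (comp ψ n) 2 volume := Lp.memLp _

theorem comp_add (ψ φ : Fock) (n : ℕ) :
    comp (ψ + φ) n =ᵐ[volume] fun x => comp ψ n x + comp φ n x := Lp.coeFn_add _ _

theorem comp_smul (c : ℂ) (ψ : Fock) (n : ℕ) :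
    comp (c • ψ) n =ᵐ[volume] fun x => c * comp ψ n x := Lp.coeFn_smul _ _

theorem comp_ext {ψ φ : Fock} (h : ∀ n, comp ψ n =ᵐ[volume] comp φ n) : ψ = φ := by
  ext n : 2
  exact Subtype.ext (Lp.ext (h n))

/-- A formula `Φ` producing, from `ψ` in Fock space, a candidate for the wave function of every
component of the image of `ψ`. It is required to be linear up to null sets. -/
structure SectorFormula where
  toFun : Fock → (n : ℕ) → (Fin n → E3) → ℂ
  add' : ∀ ψ φ n, toFun (ψ + φ) n =ᵐ[volume] fun x => toFun ψ n x + toFun φ n x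
  smul' : ∀ (c : ℂ) ψ n, toFun (c • ψ) n =ᵐ[volume] fun x => c * toFun ψ n x

/-- `φ` is the image of `ψ` under the formula `Φ`. -/
def SectorFormula.Maps (Φ : SectorFormula) (ψ φ : Fock) : Prop :=
  ∀ n, comp φ n =ᵐ[volume] Φ.toFun ψ n

theorem SectorFormula.Maps.unique {Φ : SectorFormula} {ψ φ₁ φ₂ : Fock} (h₁ : Φ.Maps ψ φ₁)
    (h₂ : Φ.Maps ψ φ₂) : φ₁ = φ₂ :=
  comp_ext fun n => (h₁ n).trans (h₂ n).symm

theorem SectorFormula.Maps.add {Φ : SectorFormula} {ψ₁ ψ₂ φ₁ φ₂ : Fock} (h₁ : Φ.Maps ψ₁ φ₁)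
    (h₂ : Φ.Maps ψ₂ φ₂) : Φ.Maps (ψ₁ + ψ₂) (φ₁ + φ₂) := fun n => by
  filter_upwards [comp_add φ₁ φ₂ n, Φ.add' ψ₁ ψ₂ n, h₁ n, h₂ n] with x a b c d
  rw [a, b, c, d]

theorem SectorFormula.Maps.smul {Φ : SectorFormula} (c : ℂ) {ψ φ : Fock} (h : Φ.Maps ψ φ) :
    Φ.Maps (c • ψ) (c • φ) := fun n => by
  filter_upwards [comp_smul c φ n, Φ.smul' c ψ n, h n] with x a b d
  rw [a, b, d]

theorem SectorFormula.maps_zero (Φ : SectorFormula) : Φ.Maps 0 0 := fun n => by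
  have h₁ := comp_smul (0 : ℂ) (0 : Fock) n
  have h₂ := Φ.smul' (0 : ℂ) (0 : Fock) n
  rw [zero_smul ℂ (0 : Fock)] at h₁ h₂
  filter_upwards [h₁, h₂] with x a b
  rw [a, b, zero_mul, zero_mul]

/-- The vectors of `D` for which the functions produced by the formula `Φ` are the components of
a vector of Fock space. -/
def SectorFormula.dom (Φ : SectorFormula) (D : Submodule ℂ Fock) : Submodule ℂ Fock where
  carrier := {ψ | ψ ∈ D ∧ ∃ φ : Fock, Φ.Maps ψ φ}
  add_mem' := by
    rintro ψ₁ ψ₂ ⟨h₁, φ₁, e₁⟩ ⟨h₂, φ₂, e₂⟩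
    exact ⟨D.add_mem h₁ h₂, φ₁ + φ₂, e₁.add e₂⟩
  zero_mem' := ⟨D.zero_mem, 0, Φ.maps_zero⟩
  smul_mem' := by
    rintro c ψ ⟨h, φ, e⟩
    exact ⟨D.smul_mem c h, c • φ, e.smul c⟩

/-- The (in general unbounded) operator on Fock space given by the formula `Φ` on `D`: it sends
`ψ` to the vector with the components produced by the formula. -/
def SectorFormula.operator (Φ : SectorFormula) (D : Submodule ℂ Fock) : Fock →ₗ.[ℂ] Fock where
  domain := Φ.dom D
  toFun :=
    { toFun := fun ψ => ψ.2.2.choose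
      map_add' := fun ψ₁ ψ₂ => SectorFormula.Maps.unique (ψ₁ + ψ₂).2.2.choose_spec
        (ψ₁.2.2.choose_spec.add ψ₂.2.2.choose_spec)
      map_smul' := fun c ψ => SectorFormula.Maps.unique (c • ψ).2.2.choose_spec
        (ψ.2.2.choose_spec.smul c) }

/-! ### Creation and annihilation operators -/

theorem quasiMeasurePreserving_removeNth {n : ℕ} (i : Fin (n + 1)) :
    Measure.QuasiMeasurePreserving (fun x : Fin (n + 1) → E3 => i.removeNth x)
      volume volume := by
  have h := (volume_preserving_piFinSuccAbove (fun _ : Fin (n + 1) => E3) i)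
  exact Measure.quasiMeasurePreserving_snd.comp h.quasiMeasurePreserving

theorem measurePreserving_cons (n : ℕ) :
    MeasurePreserving (fun q : E3 × (Fin n → E3) => (Fin.cons q.1 q.2 : Fin (n + 1) → E3))
      volume volume := by
  have h := (volume_preserving_piFinSuccAbove (fun _ : Fin (n + 1) => E3) 0).symm
  convert! h using 1
  ext q
  simp [MeasurableEquiv.piFinSuccAbove_symm_apply]

theorem measurePreserving_cons_cons (n : ℕ) :
    MeasurePreserving (fun q : (E3 × E3) × (Fin n → E3) =>
      (Fin.cons q.1.2 (Fin.cons q.1.1 q.2 : Fin (n + 1) → E3) : Fin (n + 2) → E3))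
      volume volume := by
  have h1 : MeasurePreserving (Prod.map (Prod.swap : E3 × E3 → E3 × E3)
      (id : (Fin n → E3) → (Fin n → E3))) volume volume :=
    Measure.measurePreserving_swap.prod (MeasurePreserving.id _)
  have h2 : MeasurePreserving (MeasurableEquiv.prodAssoc :
      (E3 × E3) × (Fin n → E3) ≃ᵐ E3 × E3 × (Fin n → E3)) volume volume :=
    volume_preserving_prodAssoc
  have h3 : MeasurePreserving (Prod.map (id : E3 → E3)
      (fun q : E3 × (Fin n → E3) => (Fin.cons q.1 q.2 : Fin (n + 1) → E3))) volume volume :=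
    (MeasurePreserving.id _).prod (measurePreserving_cons n)
  exact (measurePreserving_cons (n + 1)).comp (h3.comp (h2.comp h1))

/-- Contracting `m - n` variables of an `m`-particle wave function with an `L²` function is
linear, up to null sets. -/
theorem contract_add {Y : Type*} [MeasureSpace Y] [SFinite (volume : Measure Y)] {m n : ℕ}
    (h : Lp ℂ 2 (volume : Measure Y)) (e : Y × (Fin n → E3) → (Fin m → E3))
    (he : MeasurePreserving e volume volume) (ψ φ : Fock) :
    (fun x => ∫ y, star (h y) * comp (ψ + φ) m (e (y, x))) =ᵐ[volume]
      fun x => (∫ y, star (h y) * comp ψ m (e (y, x))) +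
        ∫ y, star (h y) * comp φ m (e (y, x)) := by
  have hs : MemLp (fun y => star (h y)) 2 (volume : Measure Y) := (Lp.memLp h).star
  have h0 : ∀ᵐ q : (Fin n → E3) × Y, comp (ψ + φ) m (e q.swap) =
      comp ψ m (e q.swap) + comp φ m (e q.swap) :=
    (he.comp Measure.measurePreserving_swap).quasiMeasurePreserving.ae (comp_add ψ φ m)
  filter_upwards [Measure.ae_ae_of_ae_prod h0,
    ae_integrable_slice hs ((comp_memLp ψ m).comp_measurePreserving he),
    ae_integrable_slice hs ((comp_memLp φ m).comp_measurePreserving he)] with x a b c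
  have hi := integral_add b.2 c.2
  simp only [Function.comp] at hi
  rw [← hi]
  refine integral_congr_ae ?_
  filter_upwards [a] with y hy
  simp only [Prod.swap_prod_mk] at hy
  rw [hy, mul_add]

theorem contract_smul {Y : Type*} [MeasureSpace Y] [SFinite (volume : Measure Y)] {m n : ℕ}
    (h : Lp ℂ 2 (volume : Measure Y)) (e : Y × (Fin n → E3) → (Fin m → E3))
    (he : MeasurePreserving e volume volume) (c : ℂ) (ψ : Fock) :
    (fun x => ∫ y, star (h y) * comp (c • ψ) m (e (y, x))) =ᵐ[volume]
      fun x => c * ∫ y, star (h y) * comp ψ m (e (y, x)) := by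
  have h0 : ∀ᵐ q : (Fin n → E3) × Y, comp (c • ψ) m (e q.swap) = c * comp ψ m (e q.swap) :=
    (he.comp Measure.measurePreserving_swap).quasiMeasurePreserving.ae (comp_smul c ψ m)
  filter_upwards [Measure.ae_ae_of_ae_prod h0] with x a
  rw [← integral_const_mul]
  refine integral_congr_ae ?_
  filter_upwards [a] with y hy
  simp only [Prod.swap_prod_mk] at hy
  rw [hy]
  ring

/-- `(a(f) ψ)⁽ⁿ⁾(x₁,…,xₙ) = √(n+1) ∫ conj f(x) ψ⁽ⁿ⁺¹⁾(x, x₁,…,xₙ) dx`. -/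
def annihilationFormula (f : L2) : SectorFormula where
  toFun ψ n x := (Real.sqrt (n + 1) : ℂ) *
    ∫ y : E3, star (f y) * comp ψ (n + 1) (Fin.cons y x)
  add' ψ φ n := by
    filter_upwards [contract_add f _ (measurePreserving_cons n) ψ φ] with x hx
    rw [hx, mul_add]
  smul' c ψ n := by
    filter_upwards [contract_smul f _ (measurePreserving_cons n) c ψ] with x hx
    rw [hx]
    ring

/-- `(a*(f) ψ)⁽ⁿ⁾(x₁,…,xₙ) = n^{-1/2} ∑ⱼ f(xⱼ) ψ⁽ⁿ⁻¹⁾(x₁,…,x̂ⱼ,…,xₙ)`, which is `0` for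
`n = 0`. -/
def creationFormula (f : L2) : SectorFormula where
  toFun ψ n := match n with
    | 0 => fun _ => 0
    | m + 1 => fun x => (Real.sqrt (m + 1) : ℂ)⁻¹ *
        ∑ j : Fin (m + 1), f (x j) * comp ψ m (j.removeNth x)
  add' ψ φ n := by
    match n with
    | 0 => exact Filter.Eventually.of_forall fun x => by simp
    | m + 1 =>
      have h := ae_all_iff.2 fun j : Fin (m + 1) =>
        (quasiMeasurePreserving_removeNth j).ae (comp_add ψ φ m)
      filter_upwards [h] with x hx
      simp only [hx, mul_add, Finset.sum_add_distrib]
  smul' c ψ n := by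
    match n with
    | 0 => exact Filter.Eventually.of_forall fun x => by simp
    | m + 1 =>
      have h := ae_all_iff.2 fun j : Fin (m + 1) =>
        (quasiMeasurePreserving_removeNth j).ae (comp_smul c ψ m)
      filter_upwards [h] with x hx
      simp only [hx, Finset.mul_sum]
      refine Finset.sum_congr rfl fun j _ => by ring

/-- The annihilation operator `a(f)`, on its maximal domain. -/
def annihilation (f : L2) : Fock →ₗ.[ℂ] Fock := (annihilationFormula f).operator ⊤

/-- The creation operator `a*(f)`, on its maximal domain. -/
def creation (f : L2) : Fock →ₗ.[ℂ] Fock := (creationFormula f).operator ⊤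

/-- `A(f,g) = a(f) + a*(ḡ)`. -/
def fieldA (u : L2Sum) : Fock →ₗ.[ℂ] Fock := annihilation u.fst + creation (star u.snd)

/-- The domain of the square root of the number of particles operator `𝒩`, where
`(𝒩 ψ)⁽ⁿ⁾ = n ψ⁽ⁿ⁾`. -/
def sqrtNumberDomain : Set Fock := {ψ | Summable fun n : ℕ => (n : ℝ) * ‖ψ n‖ ^ 2}

/-! ### The operator `T(k)` -/

/-- The vectors with finitely many nonzero components. -/
def finiteVectors : Submodule ℂ Fock where
  carrier := {ψ | ∃ M : ℕ, ∀ n, M ≤ n → ψ n = 0}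
  add_mem' := by
    rintro ψ φ ⟨M, hM⟩ ⟨L, hL⟩
    refine ⟨max M L, fun n hn => ?_⟩
    have h1 := hM n (le_trans (le_max_left _ _) hn)
    have h2 := hL n (le_trans (le_max_right _ _) hn)
    simp [h1, h2]
  zero_mem' := ⟨0, fun n _ => by simp⟩
  smul_mem' := by
    rintro c ψ ⟨M, hM⟩
    exact ⟨M, fun n hn => by simp [hM n hn]⟩

/-- `(∫∫ conj k(x,y) a_x a_y ψ)⁽ⁿ⁾(x₁,…,xₙ)
  = √(n+1) √(n+2) ∫∫ conj k(x,y) ψ⁽ⁿ⁺²⁾(y, x, x₁,…,xₙ) dx dy`. -/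
def pairAnnihilationFormula (k : Kernel) : SectorFormula where
  toFun ψ n x := ((Real.sqrt (n + 1) : ℂ) * (Real.sqrt (n + 2) : ℂ)) *
    ∫ q : E3 × E3, star (k q) *
      comp ψ (n + 2) (Fin.cons q.2 (Fin.cons q.1 x : Fin (n + 1) → E3))
  add' ψ φ n := by
    filter_upwards [contract_add k _ (measurePreserving_cons_cons n) ψ φ] with x hx
    rw [hx, mul_add]
  smul' c ψ n := by
    filter_upwards [contract_smul k _ (measurePreserving_cons_cons n) c ψ] with x hx
    rw [hx]
    ring

/-- `(∫∫ k(x,y) a*_x a*_y ψ)⁽ⁿ⁾(x₁,…,xₙ)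
  = (n(n-1))^{-1/2} ∑ k(xᵢ,xⱼ) ψ⁽ⁿ⁻²⁾(x₁,…,x̂ᵢ,…,x̂ⱼ,…,xₙ)`, the sum being over all ordered pairs
of different indices; it is `0` for `n = 0, 1`. The index different from `i` is written here as
`i.succAbove j`. -/
def pairCreationFormula (k : Kernel) : SectorFormula where
  toFun ψ n := match n with
    | 0 => fun _ => 0
    | 1 => fun _ => 0
    | m + 2 => fun x => ((Real.sqrt (m + 1) : ℂ) * (Real.sqrt (m + 2) : ℂ))⁻¹ *
        ∑ i : Fin (m + 2), ∑ j : Fin (m + 1),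
          k (x i, x (i.succAbove j)) * comp ψ m (j.removeNth (i.removeNth x))
  add' ψ φ n := by
    match n with
    | 0 => exact Filter.Eventually.of_forall fun x => by simp
    | 1 => exact Filter.Eventually.of_forall fun x => by simp
    | m + 2 =>
      have h := ae_all_iff.2 fun i : Fin (m + 2) => ae_all_iff.2 fun j : Fin (m + 1) =>
        ((quasiMeasurePreserving_removeNth j).comp (quasiMeasurePreserving_removeNth i)).ae
          (comp_add ψ φ m)
      filter_upwards [h] with x hx
      simp only [Function.comp] at hx
      simp only [hx, mul_add, Finset.sum_add_distrib]
  smul' c ψ n := by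
    match n with
    | 0 => exact Filter.Eventually.of_forall fun x => by simp
    | 1 => exact Filter.Eventually.of_forall fun x => by simp
    | m + 2 =>
      have h := ae_all_iff.2 fun i : Fin (m + 2) => ae_all_iff.2 fun j : Fin (m + 1) =>
        ((quasiMeasurePreserving_removeNth j).comp (quasiMeasurePreserving_removeNth i)).ae
          (comp_smul c ψ m)
      filter_upwards [h] with x hx
      simp only [Function.comp] at hx
      simp only [hx, Finset.mul_sum]
      refine Finset.sum_congr rfl fun i _ => Finset.sum_congr rfl fun j _ => by ring

/-- `B(k) = ½ ∫∫ (k(x,y) a*_x a*_y - conj k(x,y) a_x a_y) dx dy` on the vectors with finitely many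
nonzero components. -/
def quadB (k : Kernel) : Fock →ₗ.[ℂ] Fock :=
  (1 / 2 : ℂ) • ((pairCreationFormula k).operator finiteVectors -
    (pairAnnihilationFormula k).operator finiteVectors)

/-- `U` is a strongly continuous one-parameter group of bounded operators whose generator is the
closure of `B`, that is `U s = exp(s B)`. -/
structure IsGroupGeneratedBy (U : ℝ → Fock →L[ℂ] Fock) (B : Fock →ₗ.[ℂ] Fock) : Prop where
  map_zero : U 0 = 1
  map_add : ∀ s t, U (s + t) = U s * U t
  continuous : ∀ ψ, Continuous fun s => U s ψ
  generator : {q : Fock × Fock | HasDerivAt (fun s : ℝ => U s q.1) q.2 0} =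
    closure (B.graph : Set (Fock × Fock))

open Classical in
/-- `exp(B)`, for an operator `B` whose closure generates a strongly continuous group (and zero
for other `B`). -/
def expOp (B : Fock →ₗ.[ℂ] Fock) : Fock →L[ℂ] Fock :=
  if h : ∃ U, IsGroupGeneratedBy U B then h.choose 1 else 0

/-- `T(k) = exp(½ ∫∫ (k(x,y) a*_x a*_y - conj k(x,y) a_x a_y) dx dy)`. -/
def T (k : Kernel) : Fock →L[ℂ] Fock := expOp (quadB k)

/-! ## Weak gradients -/

/-- The `j`-th unit vector of `ℝ³`. -/
def unitVec (j : Fin 3) : E3 := EuclideanSpace.single j 1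

/-- `G = ∇₁ K` in the weak sense: `∂_{x_j} K(x,y) = G(x,y)_j`. -/
def IsWeakGrad₁ (K : E3 × E3 → ℂ) (G : E3 × E3 → EuclideanSpace ℂ (Fin 3)) : Prop :=
  ∀ φ : E3 × E3 → ℂ, ContDiff ℝ ∞ φ → HasCompactSupport φ → ∀ j : Fin 3,
    ∫ q, K q * fderiv ℝ φ q (unitVec j, 0) = -∫ q, G q j * φ q

/-- `G = ∇₂ K` in the weak sense: `∂_{y_j} K(x,y) = G(x,y)_j`. -/
def IsWeakGrad₂ (K : E3 × E3 → ℂ) (G : E3 × E3 → EuclideanSpace ℂ (Fin 3)) : Prop :=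
  ∀ φ : E3 × E3 → ℂ, ContDiff ℝ ∞ φ → HasCompactSupport φ → ∀ j : Fin 3,
    ∫ q, K q * fderiv ℝ φ q (0, unitVec j) = -∫ q, G q j * φ q

/-- `‖∇₁ K‖₂`, to be read as `∞` if the locally integrable function `K` has no weak gradient
`∇₁ K` in `L²`. -/
def gradNorm₁ (K : E3 × E3 → ℂ) : ℝ≥0∞ :=
  ⨅ (G : E3 × E3 → EuclideanSpace ℂ (Fin 3))
    (_ : LocallyIntegrable K ∧ MemLp G 2 ∧ IsWeakGrad₁ K G), eLpNorm G 2

/-- `‖∇₂ K‖₂`, to be read as `∞` if the locally integrable function `K` has no weak gradient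
`∇₂ K` in `L²`. -/
def gradNorm₂ (K : E3 × E3 → ℂ) : ℝ≥0∞ :=
  ⨅ (G : E3 × E3 → EuclideanSpace ℂ (Fin 3))
    (_ : LocallyIntegrable K ∧ MemLp G 2 ∧ IsWeakGrad₂ K G), eLpNorm G 2

/-- `g = ∂_j u` on `ℝ³` in the weak sense. -/
def IsWeakPartial (j : Fin 3) (u g : E3 → ℂ) : Prop :=
  ∀ φ : E3 → ℂ, ContDiff ℝ ∞ φ → HasCompactSupport φ →
    ∫ x, u x * fderiv ℝ φ x (unitVec j) = -∫ x, g x * φ x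

end Bogoliubov

end

open Bogoliubov

/-!
# Bogoliubov transformations generated by a symmetric kernel

*One-particle part.* `Θ_k` is the exponential of the self-adjoint operator `(0, k; k̄, 0)`, whose
even and odd powers are collected by `ch` and `sh` (`theta_eq_exp`). It commutes with `(0, J; J, 0)`
since its exponent does, and it preserves `S` since its exponent anticommutes with `S`. The kernels
of `p(k)` and `r(k)` are the kernel `k k̄` multiplied on the right by convergent power series in
bounded operators (`pKer`, `rKer`), which are dominated term by term by the exponential series of
`‖k‖₂`. Multiplying a kernel on the right by a bounded operator does not touch its first variable,
so this representation bounds the gradients as well. To make this precise, a weak derivative in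
`L²` is identified with the `L²` derivative of the translates (`isWeakDeriv_iff_hasDerivAt`);
translations commute with everything in sight. The second variable is reduced to the first by
transposition, using the symmetry of `k`. The universal constant in the bounds of the derivatives
is `1`.

*The group.* `B(k)` is a sum of steps `b n - (b n)*` of a ladder: `b n` maps the `n`-particle to the
`n + 2`-particle sector and `‖b n‖ ≤ ‖k‖ (n + 1)`. For such a `LadderSystem` the truncations `B M` to
the steps below `M` are bounded and skew-adjoint, and generate unitary groups. Since the norms of
the steps grow linearly, all moments of the particle number are propagated by these groups uniformly
in `M` (`moment_le`), so that orbits of finite vectors decay faster than any power of the level. By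
Duhamel's formula the truncated groups then converge strongly, to a unitary group `expB`. Its
generator extends the closure of `B(k)`, and equals it because the range of `1 - B(k)` is dense
(`genGraph_expB`); a group with this generator is unique (`eq_expB`).

*The field operators.* If `v` solves `v' = (0, k; k̄, 0) v`, then by the canonical commutation
relations `e^{sB} A(v s) e^{-sB}` is constant in `s`. For the truncated operators this holds up to a
defect that lives on the levels near `M` and vanishes in the limit on finite vectors
(`tendsto_conj_A`); the moment bounds extend the identity to the domain of the square root of the
number operator (`expB_ann_add_cre`). The commutation relations are verified on the `n`-particle
wave functions, first for kernels `g ⊗ h`, for which pair creation is a product of two creation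
operators (`adjoint_cL_bL_succ`), and the operators of the statement, given by formulas for wave
functions, are recognized as those of the ladder system (`graph_quadB`, `fieldA_mem_graph`).
-/

open MeasureTheory
open scoped ENNReal InnerProductSpace ContDiff

noncomputable section

namespace Bogoliubov

/-! ### Square-integrable functions: conjugation, tensor products, contractions -/

section Lp

variable {X Y : Type*} [MeasureSpace X] [MeasureSpace Y]

theorem star_add_Lp (f g : Lp ℂ 2 (volume : Measure X)) : star (f + g) = star f + star g := by
  refine Lp.ext ?_
  filter_upwards [Lp.coeFn_star (f + g), Lp.coeFn_add f g, Lp.coeFn_add (star f) (star g),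
    Lp.coeFn_star f, Lp.coeFn_star g] with x h1 h2 h3 h4 h5
  rw [h1, h3, Pi.star_apply, h2, Pi.add_apply, Pi.add_apply, h4, h5, Pi.star_apply,
    Pi.star_apply, star_add]

theorem star_smul_Lp (c : ℂ) (f : Lp ℂ 2 (volume : Measure X)) :
    star (c • f) = star c • star f := by
  refine Lp.ext ?_
  filter_upwards [Lp.coeFn_star (c • f), Lp.coeFn_smul c f, Lp.coeFn_smul (star c) (star f),
    Lp.coeFn_star f] with x h1 h2 h3 h4
  rw [h1, h3, Pi.star_apply, h2, Pi.smul_apply, Pi.smul_apply, h4, Pi.star_apply, smul_eq_mul, smul_eq_mul,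
    star_mul']

theorem inner_eq_integral (f g : Lp ℂ 2 (volume : Measure X)) :
    ⟪f, g⟫_ℂ = ∫ x, star (f x) * g x := by
  rw [L2.inner_def]
  refine integral_congr_ae (Filter.Eventually.of_forall fun x => ?_)
  simp [mul_comm]

theorem norm_star_Lp (f : Lp ℂ 2 (volume : Measure X)) : ‖star f‖ = ‖f‖ := by
  have : ‖star f‖ ^ 2 = ‖f‖ ^ 2 := by
    rw [norm_sq_eq, norm_sq_eq]
    refine integral_congr_ae ?_
    filter_upwards [Lp.coeFn_star f] with x h
    rw [h, Pi.star_apply, norm_star]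
  exact (sq_eq_sq₀ (norm_nonneg _) (norm_nonneg _)).1 this

theorem inner_star_star (f g : Lp ℂ 2 (volume : Measure X)) :
    ⟪star f, star g⟫_ℂ = star ⟪f, g⟫_ℂ := by
  rw [inner_eq_integral, inner_eq_integral]
  change _ = (starRingEnd ℂ) _
  rw [← integral_conj]
  refine integral_congr_ae ?_
  filter_upwards [Lp.coeFn_star f, Lp.coeFn_star g] with x h1 h2
  simp [h1, h2]

/-- Pointwise complex conjugation on `L²`, as a continuous antilinear map. -/
def conjCLM : Lp ℂ 2 (volume : Measure X) →L⋆[ℂ] Lp ℂ 2 (volume : Measure X) :=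
  LinearMap.mkContinuous
    { toFun := star
      map_add' := star_add_Lp
      map_smul' := star_smul_Lp } 1 fun f => by simp [norm_star_Lp]

/-- Change of variables by a measure preserving map, as a linear isometry of `L²` spaces. -/
abbrev pull (e : X → Y) (he : MeasurePreserving e volume volume) :
    Lp ℂ 2 (volume : Measure Y) →ₗᵢ[ℂ] Lp ℂ 2 (volume : Measure X) :=
  Lp.compMeasurePreservingₗᵢ ℂ e he

theorem coeFn_pull (e : X → Y) (he : MeasurePreserving e volume volume)
    (f : Lp ℂ 2 (volume : Measure Y)) : pull e he f =ᵐ[volume] fun x => f (e x) :=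
  Lp.coeFn_compMeasurePreserving f he


theorem memLp_tens (h : Lp ℂ 2 (volume : Measure Y)) (ψ : Lp ℂ 2 (volume : Measure X)) :
    MemLp (fun q : Y × X => h q.1 * ψ q.2) 2 volume := by
  have hm : AEStronglyMeasurable (fun q : Y × X => h q.1 * ψ q.2) volume :=
    ((Lp.memLp h).1.comp_quasiMeasurePreserving Measure.quasiMeasurePreserving_fst).mul
      ((Lp.memLp ψ).1.comp_quasiMeasurePreserving Measure.quasiMeasurePreserving_snd)
  rw [memLp_two_iff_integrable_sq_norm hm]
  simp only [norm_mul, mul_pow]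
  exact ((memLp_two_iff_integrable_sq_norm (Lp.memLp h).1).1 (Lp.memLp h)).mul_prod
    ((memLp_two_iff_integrable_sq_norm (Lp.memLp ψ).1).1 (Lp.memLp ψ))

variable [SFinite (volume : Measure X)] [SFinite (volume : Measure Y)]

theorem norm_toLp_tens (h : Lp ℂ 2 (volume : Measure Y)) (ψ : Lp ℂ 2 (volume : Measure X)) :
    ‖(memLp_tens h ψ).toLp‖ = ‖h‖ * ‖ψ‖ := by
  have : ‖(memLp_tens h ψ).toLp‖ ^ 2 = (‖h‖ * ‖ψ‖) ^ 2 := by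
    rw [mul_pow, norm_sq_eq, norm_sq_eq h, norm_sq_eq ψ]
    have := integral_prod_mul (μ := (volume : Measure Y)) (ν := (volume : Measure X))
      (fun y => ‖h y‖ ^ 2) (fun x => ‖ψ x‖ ^ 2)
    rw [← this]
    refine integral_congr_ae ?_
    filter_upwards [(memLp_tens h ψ).coeFn_toLp] with x hx
    rw [hx, norm_mul, mul_pow]
  exact (sq_eq_sq₀ (norm_nonneg _) (by positivity)).1 this

/-- The tensor product `(h ⊗ ψ)(y, x) = h(y) ψ(x)` of two `L²` functions. -/
def tens : Lp ℂ 2 (volume : Measure Y) →L[ℂ] Lp ℂ 2 (volume : Measure X) →L[ℂ]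
    Lp ℂ 2 (volume : Measure (Y × X)) :=
  LinearMap.mkContinuous₂ (LinearMap.mk₂ ℂ (fun h ψ => (memLp_tens h ψ).toLp)
    (fun f g ψ => by
      rw [← MemLp.toLp_add]
      refine MemLp.toLp_congr _ _ ?_
      filter_upwards [Measure.quasiMeasurePreserving_fst.ae (Lp.coeFn_add f g)] with q hq
      rw [Pi.add_apply, hq, Pi.add_apply, add_mul])
    (fun c f ψ => by
      rw [← MemLp.toLp_const_smul]
      refine MemLp.toLp_congr _ _ ?_
      filter_upwards [Measure.quasiMeasurePreserving_fst.ae (Lp.coeFn_smul c f)] with q hq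
      simp [hq, mul_assoc])
    (fun f ψ φ => by
      rw [← MemLp.toLp_add]
      refine MemLp.toLp_congr _ _ ?_
      filter_upwards [Measure.quasiMeasurePreserving_snd.ae (Lp.coeFn_add ψ φ)] with q hq
      rw [Pi.add_apply, hq, Pi.add_apply, mul_add])
    (fun c f ψ => by
      rw [← MemLp.toLp_const_smul]
      refine MemLp.toLp_congr _ _ ?_
      filter_upwards [Measure.quasiMeasurePreserving_snd.ae (Lp.coeFn_smul c ψ)] with q hq
      simp [hq]
      ring)) 1 fun h ψ => by
    rw [one_mul]; exact (norm_toLp_tens h ψ).le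

theorem coeFn_tens (h : Lp ℂ 2 (volume : Measure Y)) (ψ : Lp ℂ 2 (volume : Measure X)) :
    tens h ψ =ᵐ[volume] fun q => h q.1 * ψ q.2 :=
  (memLp_tens h ψ).coeFn_toLp

theorem norm_tens (h : Lp ℂ 2 (volume : Measure Y)) (ψ : Lp ℂ 2 (volume : Measure X)) :
    ‖tens h ψ‖ = ‖h‖ * ‖ψ‖ := norm_toLp_tens h ψ

theorem inner_tens_tens (h h' : Lp ℂ 2 (volume : Measure Y))
    (ψ ψ' : Lp ℂ 2 (volume : Measure X)) :
    ⟪tens h ψ, tens h' ψ'⟫_ℂ = ⟪h, h'⟫_ℂ * ⟪ψ, ψ'⟫_ℂ := by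
  rw [inner_eq_integral, inner_eq_integral h, inner_eq_integral ψ]
  have := integral_prod_mul (μ := (volume : Measure Y)) (ν := (volume : Measure X))
      (fun y => star (h y) * h' y) (fun x => star (ψ x) * ψ' x)
  rw [← this]
  refine integral_congr_ae ?_
  filter_upwards [coeFn_tens h ψ, coeFn_tens h' ψ'] with q h1 h2
  rw [h1, h2, star_mul]
  ring

theorem contract_memLp (h : Lp ℂ 2 (volume : Measure Y)) (φ : Lp ℂ 2 (volume : Measure (Y × X))) :
    MemLp (fun x => ∫ y, star (h y) * φ (y, x)) 2 (volume : Measure X) := by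
  have hs : MemLp (fun y => star (h y)) 2 (volume : Measure Y) := (Lp.memLp h).star
  have hm : AEStronglyMeasurable (fun x => ∫ y, star (h y) * φ (y, x)) (volume : Measure X) := by
    have h1 : AEStronglyMeasurable (fun q : Y × X => star (h q.1) * φ q)
        ((volume : Measure Y).prod (volume : Measure X)) :=
      (hs.1.comp_quasiMeasurePreserving Measure.quasiMeasurePreserving_fst).mul (Lp.memLp φ).1
    exact h1.prod_swap.integral_prod_right'
  have hi : Integrable (fun q => ‖φ q‖ ^ 2) ((volume : Measure Y).prod (volume : Measure X)) :=
    (memLp_two_iff_integrable_sq_norm (Lp.memLp φ).1).1 (Lp.memLp φ)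
  rw [memLp_two_iff_integrable_sq_norm hm]
  refine Integrable.mono' (hi.integral_prod_right.const_mul (‖h‖ ^ 2)) (hm.norm.pow 2) ?_
  filter_upwards [ae_integrable_slice hs (Lp.memLp φ)] with x hx
  have := norm_integral_mul_sq_le hs hx.1
  simp only [norm_star, ← norm_sq_eq] at this
  simpa using this

/-- Contraction with `h` is the adjoint of the tensor product with `h`. -/
theorem coeFn_adjoint_tens (h : Lp ℂ 2 (volume : Measure Y))
    (φ : Lp ℂ 2 (volume : Measure (Y × X))) :
    ContinuousLinearMap.adjoint (tens h) φ =ᵐ[volume] fun x => ∫ y, star (h y) * φ (y, x) := by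
  suffices hs : ContinuousLinearMap.adjoint (tens h) φ = (contract_memLp h φ).toLp by
    rw [hs]; exact (contract_memLp h φ).coeFn_toLp
  refine ext_inner_left ℂ fun ψ => ?_
  rw [ContinuousLinearMap.adjoint_inner_right, inner_eq_integral, inner_eq_integral]
  have h1 : ∫ q, star (tens h ψ q) * φ q = ∫ q : Y × X, star (h q.1 * ψ q.2) * φ q := by
    refine integral_congr_ae ?_
    filter_upwards [coeFn_tens h ψ] with q hq
    rw [hq]
  have h2 : Integrable (fun q : Y × X => star (h q.1 * ψ q.2) * φ q)
      ((volume : Measure Y).prod (volume : Measure X)) :=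
    (memLp_tens h ψ).star.integrable_mul (Lp.memLp φ)
  refine h1.trans ((integral_prod_symm _ h2).trans ?_)
  refine integral_congr_ae ?_
  filter_upwards [(contract_memLp h φ).coeFn_toLp] with x hx
  rw [hx, ← integral_const_mul]
  refine integral_congr_ae (Filter.Eventually.of_forall fun y => ?_)
  simp only [star_mul]
  ring

end Lp

/-! ### Hilbert–Schmidt kernels -/

theorem coeFn_kop (K : Kernel) (f : L2) : kop K f =ᵐ[volume] fun x => ∫ y, K (x, y) * f y :=
  (kernelFun_memLp K f).coeFn_toLp

theorem norm_kop_le (K : Kernel) : ‖kop K‖ ≤ ‖K‖ :=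
  LinearMap.mkContinuous_norm_le _ (norm_nonneg _) _

theorem inner_tens_kernel (f g : L2) (K : Kernel) :
    ⟪tens f g, K⟫_ℂ = ⟪f, kop K (star g)⟫_ℂ := by
  have h2 : Integrable (fun q : E3 × E3 => star (f q.1 * g q.2) * K q)
      ((volume : Measure E3).prod (volume : Measure E3)) :=
    (memLp_tens f g).star.integrable_mul (Lp.memLp K)
  have h1 : ⟪tens f g, K⟫_ℂ = ∫ q : E3 × E3, star (f q.1 * g q.2) * K q := by
    rw [inner_eq_integral]
    refine integral_congr_ae ?_
    filter_upwards [coeFn_tens f g] with q hq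
    rw [hq]
  rw [h1, inner_eq_integral]
  refine (integral_prod _ h2).trans (integral_congr_ae ?_)
  filter_upwards [coeFn_kop K (star g)] with x hx
  rw [hx, ← integral_const_mul]
  refine integral_congr_ae ?_
  filter_upwards [Lp.coeFn_star g] with y hy
  simp only [hy, star_mul, Pi.star_apply]
  ring

theorem kop_add (K L : Kernel) : kop (K + L) = kop K + kop L := by
  ext1 f
  refine ext_inner_left ℂ fun g => ?_
  have h : ∀ K : Kernel, ⟪g, kop K f⟫_ℂ = ⟪tens g (star f), K⟫_ℂ := fun K => by
    rw [inner_tens_kernel, star_star]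
  rw [add_apply, inner_add_right, h, h, h, inner_add_right]

theorem kop_smul (c : ℂ) (K : Kernel) : kop (c • K) = c • kop K := by
  ext1 f
  refine ext_inner_left ℂ fun g => ?_
  have h : ∀ K : Kernel, ⟪g, kop K f⟫_ℂ = ⟪tens g (star f), K⟫_ℂ := fun K => by
    rw [inner_tens_kernel, star_star]
  rw [smul_apply, inner_smul_right, h, h, inner_smul_right]

/-- `K ↦ kop K` as a continuous linear map. -/
def kopL : Kernel →L[ℂ] (L2 →L[ℂ] L2) :=
  LinearMap.mkContinuous { toFun := kop, map_add' := kop_add, map_smul' := kop_smul } 1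
    fun K => by simpa using norm_kop_le K

@[simp] theorem kopL_apply (K : Kernel) : kopL K = kop K := rfl

theorem kop_zero : kop 0 = 0 := kopL.map_zero

theorem kop_tens (f g h : L2) : kop (tens f g) h = ⟪star g, h⟫_ℂ • f := by
  refine ext_inner_left ℂ fun u => ?_
  have : ⟪u, kop (tens f g) h⟫_ℂ = ⟪tens u (star h), tens f g⟫_ℂ := by
    rw [inner_tens_kernel, star_star]
  rw [this, inner_tens_tens, inner_smul_right, ← star_star g, inner_star_star, star_star]
  change _ * (starRingEnd ℂ) _ = _
  rw [inner_conj_symm, mul_comm]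

/-- An orthonormal family in a separable Hilbert space is countable. -/
theorem countable_of_orthonormal {ι E : Type*} [NormedAddCommGroup E] [InnerProductSpace ℂ E]
    [SecondCountableTopology E] {e : ι → E} (he : Orthonormal ℂ e) : Countable ι := by
  have hd : ∀ i j, i ≠ j → 1 < dist (e i) (e j) := by
    intro i j hij
    have h : ‖e i - e j‖ ^ 2 = 2 := by
      rw [@norm_sub_sq ℂ, he.1 i, he.1 j, he.2 hij]
      norm_num
    rw [dist_eq_norm]
    nlinarith [norm_nonneg (e i - e j)]
  have : (Set.univ : Set ι).Countable := by
    refine Set.PairwiseDisjoint.countable_of_isOpen (s := fun i => Metric.ball (e i) (1 / 2)) ?_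
      (fun i _ => Metric.isOpen_ball) fun i _ => ⟨e i, Metric.mem_ball_self (by norm_num)⟩
    intro i _ j _ hij
    refine Metric.ball_disjoint_ball ?_
    have := hd i j hij
    linarith
  exact Set.countable_univ_iff.1 this

/-- Parseval's identity, applied to the slices `K(x, ·)`: the Hilbert–Schmidt norm of the operator
with kernel `K` is the `L²` norm of `K`. -/
theorem hasSum_norm_kop_sq {ι : Type*} (e : HilbertBasis ι ℂ L2) (K : Kernel) :
    HasSum (fun i => ‖kop K (e i)‖ ^ 2) (‖K‖ ^ 2) := by
  have : Fact ((2 : ℝ≥0∞) ≠ ⊤) := ⟨ENNReal.ofNat_ne_top⟩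
  have : Countable ι := countable_of_orthonormal e.orthonormal
  have hpt : ∀ᵐ x : E3, HasSum (fun i => ‖kernelFun K (e i) x‖ ^ 2) (∫ y, ‖K (x, y)‖ ^ 2) := by
    filter_upwards [kernel_slice K 0] with x hx
    have hm := hx.1
    set v : L2 := star hm.toLp with hv
    have hin : ∀ i, ⟪v, e i⟫_ℂ = kernelFun K (e i) x := by
      intro i
      rw [inner_eq_integral]
      refine integral_congr_ae ?_
      filter_upwards [Lp.coeFn_star hm.toLp, hm.coeFn_toLp] with y h1 h2
      rw [hv, h1, Pi.star_apply, star_star, h2]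
    have hn : ‖v‖ ^ 2 = ∫ y, ‖K (x, y)‖ ^ 2 := by
      rw [hv, norm_star_Lp, norm_sq_eq]
      refine integral_congr_ae ?_
      filter_upwards [hm.coeFn_toLp] with y h2
      rw [h2]
    have h3 := e.hasSum_inner_mul_inner v v
    rw [← hn]
    have h4 : ∀ i, ⟪v, e i⟫_ℂ * ⟪e i, v⟫_ℂ = ((‖kernelFun K (e i) x‖ ^ 2 : ℝ) : ℂ) := by
      intro i
      rw [← inner_conj_symm (e i) v, RCLike.mul_conj, hin]
      push_cast
      rfl
    simp only [h4, inner_self_eq_norm_sq_to_K] at h3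
    have h5 : HasSum (fun i => ((‖kernelFun K (e i) x‖ ^ 2 : ℝ) : ℂ)) ((‖v‖ ^ 2 : ℝ) : ℂ) := by
      convert! h3 using 1
      push_cast
      rfl
    exact Complex.hasSum_ofReal.1 h5
  have hnorm : ∀ i, ‖kop K (e i)‖ ^ 2 = ∫ x, ‖kernelFun K (e i) x‖ ^ 2 := by
    intro i
    rw [norm_sq_eq]
    refine integral_congr_ae ?_
    filter_upwards [coeFn_kop K (e i)] with x hx
    rw [hx]; rfl
  have hint : ∀ i, Integrable (fun x => ‖kernelFun K (e i) x‖ ^ 2) := fun i =>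
    (memLp_two_iff_integrable_sq_norm (kernelFun_memLp K (e i)).1).1 (kernelFun_memLp K (e i))
  have hK : ‖K‖ ^ 2 = ∫ x : E3, ∫ y : E3, ‖K (x, y)‖ ^ 2 := by
    rw [norm_sq_eq]
    exact integral_prod _ (kernel_integrable_sq K)
  have hs : Summable fun i => ∫ x, ‖‖kernelFun K (e i) x‖ ^ 2‖ := by
    refine summable_of_sum_le (c := ‖K‖ ^ 2) (fun i => integral_nonneg fun x => norm_nonneg _) ?_
    intro s
    simp only [norm_pow, norm_norm]
    rw [← integral_finsetSum _ fun i _ => hint i, hK]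
    refine integral_mono_ae (integrable_finsetSum _ fun i _ => hint i)
      (kernel_integrable_sq K).integral_prod_left ?_
    filter_upwards [hpt] with x hx
    exact sum_le_hasSum s (fun i _ => by positivity) hx
  have := hasSum_integral_of_summable_integral_norm hint hs
  simp only [hnorm]
  convert! this using 1
  rw [hK]
  refine integral_congr_ae ?_
  filter_upwards [hpt] with x hx
  exact hx.tsum_eq.symm

/-- A Hilbert basis of `L²(ℝ³)`. -/
theorem exists_basis : ∃ (w : Set L2), Nonempty (HilbertBasis w ℂ L2) := by
  obtain ⟨w, b, _⟩ := exists_hilbertBasis ℂ L2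
  exact ⟨w, ⟨b⟩⟩

theorem kop_injective : Function.Injective kop := by
  have h0 : ∀ K : Kernel, kop K = 0 → K = 0 := by
    intro K hK
    obtain ⟨w, ⟨e⟩⟩ := exists_basis
    have h := hasSum_norm_kop_sq e K
    simp only [hK, zero_apply, norm_zero, ne_eq, OfNat.ofNat_ne_zero,
      not_false_eq_true, zero_pow] at h
    have := h.unique hasSum_zero
    simpa using this
  intro K L hKL
  have : kopL (K - L) = 0 := by rw [map_sub, kopL_apply, kopL_apply, hKL, sub_self]
  exact sub_eq_zero.1 (h0 _ this)

/-- Linear combinations of product kernels are dense. -/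
theorem dense_span_tens :
    Dense (Submodule.span ℂ {K : Kernel | ∃ f g : L2, K = tens f g} : Set Kernel) := by
  rw [Submodule.dense_iff_topologicalClosure_eq_top, Submodule.topologicalClosure_eq_top_iff,
    Submodule.eq_bot_iff]
  intro K hK
  refine kop_injective ?_
  rw [kop_zero]
  ext1 f
  refine ext_inner_left ℂ fun g => ?_
  have h := (Submodule.mem_orthogonal _ _).1 hK (tens g (star f))
    (Submodule.subset_span ⟨g, star f, rfl⟩)
  rw [inner_tens_kernel, star_star] at h
  simpa using h

/-- An operator is Hilbert–Schmidt as soon as its Hilbert–Schmidt norm in one basis is finite. -/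
theorem exists_kernel {ι : Type*} (e : HilbertBasis ι ℂ L2) (A : L2 →L[ℂ] L2)
    (hA : Summable fun i => ‖A (e i)‖ ^ 2) : ∃ K : Kernel, kop K = A := by
  let V : ι → (L2 →ₗᵢ[ℂ] Kernel) := fun i =>
    { toLinearMap := ((tens : L2 →L[ℂ] L2 →L[ℂ] Kernel).flip (star (e i))).toLinearMap
      norm_map' := fun f => by
        change ‖tens f (star (e i))‖ = _
        rw [norm_tens, norm_star_Lp, e.orthonormal.1 i, mul_one] }
  have hV : OrthogonalFamily ℂ (fun _ : ι => L2) V := by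
    intro i j hij f g
    change ⟪tens f (star (e i)), tens g (star (e j))⟫_ℂ = 0
    rw [inner_tens_tens, inner_star_star, e.orthonormal.2 hij, star_zero, mul_zero]
  have hs : Summable fun i => tens (A (e i)) (star (e i)) :=
    (hV.summable_iff_norm_sq_summable fun i => A (e i)).2 hA
  -- the kernel is the orthogonal series `∑ i, A eᵢ ⊗ ēᵢ`
  refine ⟨∑' i, tens (A (e i)) (star (e i)), ?_⟩
  refine ContinuousLinearMap.ext_on (s := Set.range e) ?_ ?_
  · rw [Submodule.dense_iff_topologicalClosure_eq_top]
    exact e.dense_span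
  · rintro _ ⟨j, rfl⟩
    have h1 := (hs.hasSum.mapL kopL).mapL (ContinuousLinearMap.apply ℂ L2 (e j))
    refine h1.unique ?_
    have h2 : ∀ i, (ContinuousLinearMap.apply ℂ L2 (e j))
        (kopL (tens (A (e i)) (star (e i)))) = ⟪e i, e j⟫_ℂ • A (e i) := by
      intro i
      change kop _ _ = _
      rw [kop_tens, star_star]
    simp only [h2]
    have := hasSum_single (f := fun i => ⟪e i, e j⟫_ℂ • A (e i)) j fun i hi => by
      rw [e.orthonormal.2 hi, zero_smul]
    simpa [inner_self_eq_norm_sq_to_K, e.orthonormal.1 j] using this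

/-! ### Transposition, adjoints and operator products of kernels -/

/-- The transposed kernel `K(y, x)`. -/
def transp : Kernel →ₗᵢ[ℂ] Kernel := pull Prod.swap Measure.measurePreserving_swap

theorem coeFn_transp (K : Kernel) : transp K =ᵐ[volume] fun q => K (q.2, q.1) :=
  coeFn_pull _ _ K

theorem isSymm_iff (k : Kernel) : IsSymm k ↔ transp k = k := by
  constructor
  · intro h
    refine Lp.ext ?_
    filter_upwards [coeFn_transp k, h] with q h1 h2
    rw [h1, h2]
  · intro h
    filter_upwards [coeFn_transp k] with q h1
    rw [← h1, h]

theorem transp_transp (K : Kernel) : transp (transp K) = K := by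
  refine Lp.ext ?_
  filter_upwards [coeFn_transp (transp K),
    Measure.measurePreserving_swap.quasiMeasurePreserving.ae (coeFn_transp K)] with q h1 h2
  rw [h1]; exact h2

theorem transp_tens (f g : L2) : transp (tens f g) = tens g f := by
  refine Lp.ext ?_
  filter_upwards [coeFn_transp (tens f g), coeFn_tens g f,
    Measure.measurePreserving_swap.quasiMeasurePreserving.ae (coeFn_tens f g)] with q h1 h2 h3
  rw [h1, h2, mul_comm]; exact h3

theorem star_tens (f g : L2) : star (tens f g : Kernel) = tens (star f) (star g) := by
  refine Lp.ext ?_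
  filter_upwards [Lp.coeFn_star (tens f g), coeFn_tens f g, coeFn_tens (star f) (star g),
    Measure.quasiMeasurePreserving_fst.ae (Lp.coeFn_star f),
    Measure.quasiMeasurePreserving_snd.ae (Lp.coeFn_star g)] with q h1 h2 h3 h4 h5
  rw [h1, h3, Pi.star_apply, h2, h4, h5, star_mul', Pi.star_apply, Pi.star_apply]

/-- The operator with kernel `k̄` is the complex conjugate of the operator with kernel `k`. -/
theorem kop_star (K : Kernel) (f : L2) : kop (star K) (star f) = star (kop K f) := by
  refine ext_inner_left ℂ fun u => ?_
  have h1 : ⟪u, kop (star K) (star f)⟫_ℂ = ⟪tens u f, star K⟫_ℂ := by rw [inner_tens_kernel]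
  have h2 : ⟪star u, kop K f⟫_ℂ = ⟪tens (star u) (star f), K⟫_ℂ := by
    rw [inner_tens_kernel, star_star]
  rw [h1, ← star_star u, inner_star_star, h2, ← star_star (tens (star (star u)) f),
    inner_star_star, star_tens, star_star]

/-- The kernel of the adjoint. -/
def adjK (K : Kernel) : Kernel := star (transp K)

theorem norm_adjK (K : Kernel) : ‖adjK K‖ = ‖K‖ := by
  rw [adjK, norm_star_Lp, LinearIsometry.norm_map]

theorem kop_adjK (K : Kernel) : kop (adjK K) = ContinuousLinearMap.adjoint (kop K) := by
  ext1 f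
  refine ext_inner_left ℂ fun g => ?_
  rw [ContinuousLinearMap.adjoint_inner_right, ← inner_conj_symm]
  have h1 : ⟪f, kop K g⟫_ℂ = ⟪tens f (star g), K⟫_ℂ := by rw [inner_tens_kernel, star_star]
  have h2 : ⟪g, kop (adjK K) f⟫_ℂ = ⟪tens g (star f), adjK K⟫_ℂ := by
    rw [inner_tens_kernel, star_star]
  rw [inner_conj_symm, ← inner_conj_symm (kop K g), h1, h2, adjK,
    ← star_star (tens g (star f) : Kernel), inner_star_star, star_tens, star_star, ← transp_tens,
    LinearIsometry.inner_map_map]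
  rfl

theorem exists_kernel_mul (A : L2 →L[ℂ] L2) (K : Kernel) :
    ∃ L : Kernel, kop L = A * kop K ∧ ‖L‖ ≤ ‖A‖ * ‖K‖ := by
  obtain ⟨w, ⟨e⟩⟩ := exists_basis
  have hle : ∀ i, ‖(A * kop K) (e i)‖ ^ 2 ≤ ‖A‖ ^ 2 * ‖kop K (e i)‖ ^ 2 := fun i => by
    rw [← mul_pow]
    exact pow_le_pow_left₀ (norm_nonneg _) (A.le_opNorm _) 2
  have hs := (hasSum_norm_kop_sq e K).mul_left (‖A‖ ^ 2)
  obtain ⟨L, hL⟩ := exists_kernel e (A * kop K)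
    (Summable.of_nonneg_of_le (fun i => by positivity) hle hs.summable)
  refine ⟨L, hL, ?_⟩
  have h1 := hasSum_norm_kop_sq e L
  rw [hL] at h1
  have := hasSum_le hle h1 hs
  rw [← mul_pow] at this
  exact (sq_le_sq₀ (norm_nonneg _) (by positivity)).1 this

theorem exists_mul_kernel (K : Kernel) (A : L2 →L[ℂ] L2) :
    ∃ L : Kernel, kop L = kop K * A ∧ ‖L‖ ≤ ‖K‖ * ‖A‖ := by
  obtain ⟨L, h1, h2⟩ := exists_kernel_mul (star A) (adjK K)
  refine ⟨adjK L, ?_, ?_⟩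
  · rw [kop_adjK, h1, kop_adjK]
    change star (star A * star (kop K)) = _
    rw [star_mul, star_star, star_star]
  · rw [norm_adjK, mul_comm]
    rwa [norm_adjK, ContinuousLinearMap.star_eq_adjoint, LinearIsometryEquiv.norm_map] at h2

/-- The kernel of `kop K * A`, for a kernel `K` and a bounded operator `A`. -/
def mulKernel (K : Kernel) (A : L2 →L[ℂ] L2) : Kernel := (exists_mul_kernel K A).choose

theorem kop_mulKernel (K : Kernel) (A : L2 →L[ℂ] L2) : kop (mulKernel K A) = kop K * A :=
  (exists_mul_kernel K A).choose_spec.1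

/-- `mulKernel` as a bounded bilinear map. -/
def rmul : Kernel →L[ℂ] (L2 →L[ℂ] L2) →L[ℂ] Kernel :=
  LinearMap.mkContinuous₂ (LinearMap.mk₂ ℂ mulKernel
    (fun K L A => kop_injective (by simp only [kop_add, kop_mulKernel, add_mul]))
    (fun c K A => kop_injective (by simp only [kop_smul, kop_mulKernel, smul_mul_assoc]))
    (fun K A B => kop_injective (by simp only [kop_add, kop_mulKernel, mul_add]))
    (fun c K A => kop_injective (by simp only [kop_smul, kop_mulKernel, mul_smul_comm]))) 1
    fun K A => by
      rw [one_mul]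
      exact (exists_mul_kernel K A).choose_spec.2

@[simp] theorem kop_rmul (K : Kernel) (A : L2 →L[ℂ] L2) : kop (rmul K A) = kop K * A :=
  kop_mulKernel K A

theorem norm_rmul_le (K : Kernel) (A : L2 →L[ℂ] L2) : ‖rmul K A‖ ≤ ‖K‖ * ‖A‖ :=
  (exists_mul_kernel K A).choose_spec.2

theorem ae_memLp_slice_left (K : Kernel) :
    ∀ᵐ x : E3, MemLp (fun y => K (x, y)) 2 (volume : Measure E3) := by
  filter_upwards [kernel_slice K 0] with x hx using hx.1

theorem ae_memLp_slice_right (K : Kernel) :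
    ∀ᵐ y : E3, MemLp (fun x => K (x, y)) 2 (volume : Measure E3) := by
  filter_upwards [ae_integrable_slice (Lp.memLp (0 : L2)) (Lp.memLp K)] with x hx using hx.1

theorem kerComp_memLp (K L : Kernel) : MemLp (kerComp K L) 2 volume := by
  have hm : AEStronglyMeasurable (kerComp K L) volume := by
    have h1 : AEStronglyMeasurable (fun q : (E3 × E3) × E3 => K (q.1.1, q.2) * L (q.2, q.1.2))
        ((volume : Measure (E3 × E3)).prod (volume : Measure E3)) := by
      refine AEStronglyMeasurable.mul ?_ ?_
      · exact (Lp.memLp K).1.comp_quasiMeasurePreserving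
          (f := fun q : (E3 × E3) × E3 => (q.1.1, q.2))
          (Measure.quasiMeasurePreserving_fst.comp
            ((volume_preserving_prodAssoc.symm _).comp (((MeasurePreserving.id _).prod
              Measure.measurePreserving_swap).comp
                volume_preserving_prodAssoc)).quasiMeasurePreserving)
      · exact (Lp.memLp L).1.comp_quasiMeasurePreserving
          (f := fun q : (E3 × E3) × E3 => (q.2, q.1.2))
          (Measure.measurePreserving_swap.quasiMeasurePreserving.comp
            (Measure.quasiMeasurePreserving_snd.comp
              volume_preserving_prodAssoc.quasiMeasurePreserving))
    exact h1.integral_prod_right'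
  rw [memLp_two_iff_integrable_sq_norm hm]
  have h1 : Integrable (fun x : E3 => ∫ y : E3, ‖K (x, y)‖ ^ 2) :=
    (kernel_integrable_sq K).integral_prod_left
  have h2 : Integrable (fun y : E3 => ∫ x : E3, ‖L (x, y)‖ ^ 2) :=
    (kernel_integrable_sq L).integral_prod_right
  refine Integrable.mono' (h1.mul_prod h2) (hm.norm.pow 2) ?_
  filter_upwards [Measure.quasiMeasurePreserving_fst.ae (ae_memLp_slice_left K),
    Measure.quasiMeasurePreserving_snd.ae (ae_memLp_slice_right L)] with q hq1 hq2
  have := norm_integral_mul_sq_le hq1 hq2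
  simpa [kerComp] using this

/-- The product of kernels is the kernel of the product of the operators. -/
theorem kop_kerComp (K L : Kernel) : kop (kerComp_memLp K L).toLp = kop K * kop L := by
  ext1 f
  refine Lp.ext ?_
  have hC := Measure.ae_ae_of_ae_prod (kerComp_memLp K L).coeFn_toLp
  filter_upwards [coeFn_kop (kerComp_memLp K L).toLp f, coeFn_kop K (kop L f), hC,
    ae_memLp_slice_left K] with x h1 h2 h3 h4
  rw [h1, mul_apply_eq_comp, h2]
  have e1 : ∫ y, ((kerComp_memLp K L).toLp : Kernel) (x, y) * f y =
      ∫ y, ∫ z, K (x, z) * L (z, y) * f y := by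
    refine integral_congr_ae ?_
    filter_upwards [h3] with y hy
    rw [hy, kerComp, ← integral_mul_const]
  have e2 : ∫ z, K (x, z) * kop L f z = ∫ z, ∫ y, K (x, z) * L (z, y) * f y := by
    refine integral_congr_ae ?_
    filter_upwards [coeFn_kop L f] with z hz
    rw [hz, ← integral_const_mul]
    simp only [mul_assoc]
  rw [e1, e2]
  refine integral_integral_swap ?_
  have hi : Integrable (fun q : E3 × E3 => ((h4.toLp : L2) q.1 * f q.2) * L q)
      ((volume : Measure E3).prod (volume : Measure E3)) :=
    (memLp_tens h4.toLp f).integrable_mul (Lp.memLp L)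
  refine Integrable.swap (f := fun q : E3 × E3 => K (x, q.1) * L (q.1, q.2) * f q.2) ?_
  refine hi.congr ?_
  filter_upwards [Measure.quasiMeasurePreserving_fst.ae h4.coeFn_toLp] with q hq
  rw [hq]
  ring

theorem kerComp_ae (K L : Kernel) : kerComp K L =ᵐ[volume] rmul K (kop L) := by
  have : rmul K (kop L) = (kerComp_memLp K L).toLp :=
    kop_injective (by rw [kop_rmul, kop_kerComp])
  rw [this]
  exact (kerComp_memLp K L).coeFn_toLp.symm

/-! ### Power series of bounded operators -/

theorem summable_pow_div_factorial_comp (x : ℝ) {φ : ℕ → ℕ} (hφ : Function.Injective φ) :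
    Summable fun n => x ^ φ n / (φ n).factorial :=
  (Real.summable_pow_div_factorial x).comp_injective hφ

theorem tsum_pow_div_factorial_comp_le {x : ℝ} (hx : 0 ≤ x) {φ : ℕ → ℕ}
    (hφ : Function.Injective φ) : ∑' n, x ^ φ n / (φ n).factorial ≤ Real.exp x := by
  have h := (Real.summable_pow_div_factorial x)
  have h2 : ∑' n, x ^ n / n.factorial = Real.exp x := by
    rw [Real.exp_eq_exp_ℝ, NormedSpace.exp_eq_tsum_div]
  rw [← h2]
  exact tsum_comp_le_tsum_of_inj h (fun n => by positivity) hφ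

section PowerSeries

variable {A : Type*} [NormedRing A]

theorem norm_pow_le_of_norm_one_le (h1 : ‖(1 : A)‖ ≤ 1) (X : A) (n : ℕ) : ‖X ^ n‖ ≤ ‖X‖ ^ n := by
  rcases Nat.eq_zero_or_pos n with rfl | h
  · simpa using h1
  · exact norm_pow_le' X h

variable [NormedAlgebra ℂ A] [CompleteSpace A]

/-- A power series with coefficients bounded by `1 / n!` is differentiable, and the norm of its
derivative is bounded by the derivative of the series of the norms. -/
theorem exists_hasFDerivAt_tsum_pow (h1 : ‖(1 : A)‖ ≤ 1) (c : ℕ → ℂ)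
    (hc : ∀ n, ‖c n‖ ≤ ((n.factorial : ℝ))⁻¹) (X : A) :
    ∃ D : A →L[ℂ] A, HasFDerivAt (fun Y : A => ∑' n, c n • Y ^ n) D X ∧
      ∀ (s b : ℝ), ‖X‖ ≤ s → HasSum (fun n : ℕ => ‖c n‖ * (n * s ^ (n - 1))) b →
        ∀ H, ‖D H‖ ≤ b * ‖H‖ := by
  have hpow := norm_pow_le_of_norm_one_le h1
  let P : ℕ → A → (A →L[ℂ] A) := fun n x =>
    ∑ i ∈ Finset.range n,
      MulOpposite.op (x ^ i) • x ^ (n.pred - i) • ContinuousLinearMap.id ℂ A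
  have hP : ∀ n x s, ‖x‖ ≤ s → ‖P n x‖ ≤ n * s ^ (n - 1) := by
    intro n x s hs
    have hs0 : 0 ≤ s := (norm_nonneg x).trans hs
    refine ContinuousLinearMap.opNorm_le_bound _ (by positivity) fun H => ?_
    simp only [P, FunLike.coe_sum, Finset.sum_apply]
    refine (norm_sum_le _ _).trans ?_
    have : ∀ i ∈ Finset.range n,
        ‖(MulOpposite.op (x ^ i) • x ^ (n.pred - i) • ContinuousLinearMap.id ℂ A) H‖ ≤ s ^ (n - 1) * ‖H‖ := by
      intro i hi
      have hi' : n - 1 = (n.pred - i) + i := by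
        have := Finset.mem_range.1 hi
        simp only [Nat.pred_eq_sub_one]; omega
      change ‖(x ^ (n.pred - i) * H) * x ^ i‖ ≤ _
      rw [mul_assoc]
      calc _ ≤ ‖x ^ (n.pred - i)‖ * (‖H‖ * ‖x ^ i‖) :=
            (norm_mul_le _ _).trans (by gcongr; exact norm_mul_le _ _)
        _ ≤ s ^ (n.pred - i) * (‖H‖ * s ^ i) := by
            gcongr
            · exact (hpow _ _).trans (by gcongr)
            · exact (hpow _ _).trans (by gcongr)
        _ = _ := by rw [hi', pow_add]; ring
    refine (Finset.sum_le_sum this).trans ?_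
    simp [mul_assoc]
  set R := ‖X‖ + 1
  have hR : 0 < R := by positivity
  have hu : Summable fun n : ℕ => ((n.factorial : ℝ))⁻¹ * (n * R ^ (n - 1)) := by
    rw [← summable_nat_add_iff 1]
    refine (Real.summable_pow_div_factorial R).congr fun n => ?_
    rw [Nat.factorial_succ, Nat.add_sub_cancel]
    push_cast
    field_simp
  have hD := hasFDerivAt_tsum_of_isPreconnected (𝕜 := ℂ) (f := fun n (Y : A) => c n • Y ^ n)
    (f' := fun n Y => c n • P n Y) (x₀ := 0) (x := X) hu (Metric.isOpen_ball (x := 0) (ε := R))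
    (convex_ball (0 : A) R).isPreconnected
    (fun n x _ => (hasFDerivAt_pow' n).const_smul (c n))
    (fun n x hx => by
      rw [norm_smul]
      have : ‖x‖ ≤ R := (mem_ball_zero_iff.1 hx).le
      gcongr
      · exact hc n
      · exact hP n x R this) (Metric.mem_ball_self hR) (by
      refine summable_of_ne_finset_zero (s := {0}) fun n hn => ?_
      rw [zero_pow (by simpa using hn), smul_zero]) (by simp [R])
  refine ⟨_, hD, fun s b hs hb H => ?_⟩
  have : ‖∑' n, c n • P n X‖ ≤ b := tsum_of_norm_bounded hb fun n => by
    rw [norm_smul]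
    gcongr
    exact hP n X s hs
  exact (ContinuousLinearMap.le_opNorm _ _).trans (by gcongr)

end PowerSeries

/-- The algebra of bounded operators on `L²(ℝ³)`. -/
abbrev Op : Type := L2 →L[ℂ] L2

/-- `k k̄` as a kernel. -/
def kk (k : Kernel) : Kernel := rmul k (kop (star k))

theorem kop_kk (k : Kernel) : kop (kk k) = kop k * kop (star k) := kop_rmul _ _

theorem norm_kop_star_le (k : Kernel) : ‖kop (star k)‖ ≤ ‖k‖ := by
  simpa [norm_star_Lp] using norm_kop_le (star k)

theorem norm_kk_le (k : Kernel) : ‖kk k‖ ≤ ‖k‖ ^ 2 := by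
  rw [sq]
  exact (norm_rmul_le _ _).trans (by gcongr; exact norm_kop_star_le k)

/-- `∑ Xⁿ / (2n+j)!`. -/
def facSeries (j : ℕ) (X : Op) : Op := ∑' n : ℕ, ((Nat.factorial (2 * n + j) : ℂ)⁻¹) • X ^ n

theorem norm_one_op_le : ‖(1 : Op)‖ ≤ 1 := ContinuousLinearMap.norm_id_le

theorem injective_two_mul_add (j : ℕ) : Function.Injective fun n : ℕ => 2 * n + j :=
  fun a b h => by simp only at h; omega

theorem norm_facSeries_term_le (j : ℕ) {X : Op} {s : ℝ} (hX : ‖X‖ ≤ s ^ 2) (n : ℕ) :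
    ‖((Nat.factorial (2 * n + j) : ℂ)⁻¹) • X ^ n‖ ≤ s ^ (2 * n) / (2 * n + j).factorial := by
  rw [norm_smul, norm_inv, Complex.norm_natCast, div_eq_inv_mul, pow_mul]
  gcongr
  exact (norm_pow_le_of_norm_one_le norm_one_op_le X n).trans (by gcongr)

theorem summable_pow_div_factorial_add (j : ℕ) (s : ℝ) :
    Summable fun n : ℕ => |s| ^ (2 * n) / (2 * n + j).factorial := by
  refine Summable.of_nonneg_of_le (fun n => by positivity) (fun n => ?_)
    (summable_pow_div_factorial_comp |s| (φ := fun n => 2 * n) fun a b h => by simpa using h)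
  gcongr
  omega

theorem summable_norm_facSeries (j : ℕ) (X : Op) :
    Summable fun n : ℕ => ‖((Nat.factorial (2 * n + j) : ℂ)⁻¹) • X ^ n‖ := by
  refine Summable.of_nonneg_of_le (fun n => norm_nonneg _)
    (fun n => norm_facSeries_term_le j (s := |√‖X‖|) ?_ n) (summable_pow_div_factorial_add j _)
  rw [sq_abs, Real.sq_sqrt (norm_nonneg _)]

theorem hasSum_facSeries (j : ℕ) (X : Op) :
    HasSum (fun n : ℕ => ((Nat.factorial (2 * n + j) : ℂ)⁻¹) • X ^ n) (facSeries j X) :=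
  (summable_norm_facSeries j X).of_norm.hasSum

/-- Scalar majorant: if `s^i ∑ s^{2n} / (2n+j)!` has all its terms among those of `exp s`
up to smaller factors, it is at most `exp s`. -/
theorem pow_mul_norm_facSeries_le (j i : ℕ) (hij : i ≤ j) {X : Op} {s : ℝ} (hs : 0 ≤ s)
    (hX : ‖X‖ ≤ s ^ 2) : s ^ i * ‖facSeries j X‖ ≤ Real.exp s := by
  have h1 : ‖facSeries j X‖ ≤ ∑' n : ℕ, s ^ (2 * n) / (2 * n + j).factorial :=
    tsum_of_norm_bounded (by
      have := summable_pow_div_factorial_add j s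
      rw [abs_of_nonneg hs] at this
      exact this.hasSum) (norm_facSeries_term_le j hX)
  have hsum := summable_pow_div_factorial_comp s (injective_two_mul_add i)
  have hsum' := summable_pow_div_factorial_add j s
  rw [abs_of_nonneg hs] at hsum'
  calc s ^ i * ‖facSeries j X‖ ≤ s ^ i * ∑' n : ℕ, s ^ (2 * n) / (2 * n + j).factorial := by gcongr
    _ = ∑' n : ℕ, s ^ i * (s ^ (2 * n) / (2 * n + j).factorial) := tsum_mul_left.symm
    _ ≤ ∑' n : ℕ, s ^ (2 * n + i) / (2 * n + i).factorial := by
        refine Summable.tsum_le_tsum (fun n => ?_) (hsum'.mul_left _) hsum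
        rw [pow_add, mul_comm (s ^ (2 * n)), mul_div_assoc]
        gcongr
    _ ≤ _ := tsum_pow_div_factorial_comp_le hs (injective_two_mul_add i)

theorem ch_eq (k : Kernel) : ch k = facSeries 0 (kop (kk k)) := by
  rw [kop_kk]; rfl

theorem sh_eq (k : Kernel) : sh k = facSeries 1 (kop (kk k)) * kop k := by
  have := (hasSum_facSeries 1 (kop (kk k))).mul_right (kop k)
  rw [← this.tsum_eq, sh, kop_kk]
  simp only [smul_mul_assoc]

theorem facSeries_eq (j : ℕ) (X : Op) :
    facSeries j X = ((Nat.factorial j : ℂ)⁻¹) • (1 : Op) + X * facSeries (j + 2) X := by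
  have h := (hasSum_facSeries (j + 2) X).mul_left X
  have h2 := (hasSum_nat_add_iff' 1).2 (hasSum_facSeries j X)
  rw [Finset.sum_range_one] at h2
  have h3 : (fun n => X * ((Nat.factorial (2 * n + (j + 2)) : ℂ)⁻¹) • X ^ n) =
      fun n => ((Nat.factorial (2 * (n + 1) + j) : ℂ)⁻¹) • X ^ (n + 1) := by
    funext n
    rw [mul_smul_comm, pow_succ', show 2 * n + (j + 2) = 2 * (n + 1) + j by ring]
  rw [h3] at h
  have := h2.unique h
  rw [mul_zero, zero_add, pow_zero] at this
  rw [← this]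
  abel

/-- The kernel of `p(k)`. -/
def pKer (k : Kernel) : Kernel := rmul (kk k) (facSeries 2 (kop (kk k)))

/-- The kernel of `r(k)`. -/
def rKer (k : Kernel) : Kernel := rmul (kk k) (facSeries 3 (kop (kk k)) * kop k)

theorem kop_pKer (k : Kernel) : kop (pKer k) = pOp k := by
  rw [pKer, kop_rmul, pOp, ch_eq, facSeries_eq 0]
  simp

theorem kop_rKer (k : Kernel) : kop (rKer k) = rOp k := by
  rw [rKer, kop_rmul, rOp, sh_eq, facSeries_eq 1]
  simp [add_mul, mul_assoc]

theorem kop_shKer (k : Kernel) : kop (rKer k + k) = sh k := by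
  rw [kop_add, kop_rKer, rOp, sub_add_cancel]

theorem kernelOf_eq {K : Kernel} {A : Op} (h : kop K = A) : kernelOf A = K := by
  have hex : ∃ K : Kernel, kop K = A := ⟨K, h⟩
  refine kop_injective ?_
  rw [kernelOf, dif_pos hex, hex.choose_spec, h]

theorem isHilbertSchmidt_of_kop {K : Kernel} {A : Op} (h : kop K = A) : IsHilbertSchmidt A := by
  rw [IsHilbertSchmidt, kernelOf_eq h]
  refine ⟨fun L => ⟨fun hL => kop_injective (hL.trans h.symm), fun hL => hL ▸ h⟩, fun ι e => ?_⟩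
  rw [← h]
  exact hasSum_norm_kop_sq e K

theorem norm_kop_kk_le (k : Kernel) : ‖kop (kk k)‖ ≤ ‖k‖ ^ 2 := (norm_kop_le _).trans (norm_kk_le k)

theorem norm_facSeries_two_le (k : Kernel) : ‖facSeries 2 (kop (kk k))‖ ≤ Real.exp ‖k‖ := by
  simpa using pow_mul_norm_facSeries_le 2 0 (by norm_num) (norm_nonneg k) (norm_kop_kk_le k)

theorem norm_facSeries_three_mul_le (k : Kernel) :
    ‖facSeries 3 (kop (kk k)) * kop k‖ ≤ Real.exp ‖k‖ := by
  have := pow_mul_norm_facSeries_le 3 1 (by norm_num) (norm_nonneg k) (norm_kop_kk_le k)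
  refine (norm_mul_le _ _).trans (le_trans ?_ this)
  rw [pow_one, mul_comm]
  gcongr
  exact norm_kop_le k

theorem norm_pKer_le (k : Kernel) : ‖pKer k‖ ≤ Real.exp ‖k‖ := by
  have := pow_mul_norm_facSeries_le 2 2 le_rfl (norm_nonneg k) (norm_kop_kk_le k)
  refine (norm_rmul_le _ _).trans (le_trans ?_ this)
  gcongr
  exact norm_kk_le k

theorem norm_rKer_le (k : Kernel) : ‖rKer k‖ ≤ Real.exp ‖k‖ := by
  have := pow_mul_norm_facSeries_le 3 3 le_rfl (norm_nonneg k) (norm_kop_kk_le k)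
  refine (norm_rmul_le _ _).trans (le_trans ?_ this)
  rw [show ‖k‖ ^ 3 * ‖facSeries 3 (kop (kk k))‖ =
    ‖k‖ ^ 2 * (‖facSeries 3 (kop (kk k))‖ * ‖k‖) by ring]
  gcongr
  · exact norm_kk_le k
  · exact (norm_mul_le _ _).trans (by gcongr; exact norm_kop_le k)

theorem norm_shKer_le (k : Kernel) : ‖rKer k + k‖ ≤ Real.exp ‖k‖ := by
  have h1 : ‖facSeries 3 (kop (kk k))‖ ≤ ∑' n : ℕ, ‖k‖ ^ (2 * n) / (2 * n + 3).factorial :=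
    tsum_of_norm_bounded (by
      have := summable_pow_div_factorial_add 3 ‖k‖
      rw [abs_of_nonneg (norm_nonneg k)] at this
      exact this.hasSum) (norm_facSeries_term_le 3 (norm_kop_kk_le k))
  have h2 : ‖rKer k‖ ≤ ∑' n : ℕ, ‖k‖ ^ (2 * (n + 1) + 1) / (2 * (n + 1) + 1).factorial := by
    calc ‖rKer k‖ ≤ ‖k‖ ^ 2 * (‖facSeries 3 (kop (kk k))‖ * ‖k‖) := by
          refine (norm_rmul_le _ _).trans ?_
          gcongr
          · exact norm_kk_le k
          · exact (norm_mul_le _ _).trans (by gcongr; exact norm_kop_le k)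
      _ ≤ ‖k‖ ^ 2 * ((∑' n : ℕ, ‖k‖ ^ (2 * n) / (2 * n + 3).factorial) * ‖k‖) := by gcongr
      _ = _ := by
          rw [← tsum_mul_right, ← tsum_mul_left]
          refine tsum_congr fun n => ?_
          rw [show 2 * (n + 1) + 1 = 2 * n + 3 by ring, pow_add]
          ring
  have h3 := (summable_pow_div_factorial_comp ‖k‖ (injective_two_mul_add 1)).tsum_eq_zero_add
  have h4 := tsum_pow_div_factorial_comp_le (norm_nonneg k) (injective_two_mul_add 1)
  simp only [mul_zero, zero_add, pow_one, Nat.factorial_one, Nat.cast_one, div_one] at h3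
  have := norm_add_le (rKer k) k
  linarith

/-! ### Differentiability of `p(k)` and `r(k)` -/

/-- `facSeries j` is differentiable; the bound of the derivative at `X`, where `‖X‖ ≤ s²`, is the
derivative of the scalar series. -/
theorem exists_hasFDerivAt_facSeries (j : ℕ) (X : Op) {s : ℝ} (hX : ‖X‖ ≤ s ^ 2) :
    ∃ (D : Op →L[ℂ] Op) (b : ℝ), HasFDerivAt (facSeries j) D X ∧
      HasSum (fun n : ℕ => n * (s ^ 2) ^ (n - 1) / (2 * n + j).factorial) b ∧
        ∀ H, ‖D H‖ ≤ b * ‖H‖ := by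
  obtain ⟨D, hD, hb⟩ := exists_hasFDerivAt_tsum_pow norm_one_op_le
    (fun n => ((Nat.factorial (2 * n + j) : ℂ)⁻¹)) (fun n => by
      rw [norm_inv, Complex.norm_natCast]
      gcongr
      omega) X
  have hs : Summable fun n : ℕ => n * (s ^ 2) ^ (n - 1) / ((2 * n + j).factorial : ℝ) := by
    rw [← summable_nat_add_iff 1]
    refine Summable.of_nonneg_of_le (fun n => by positivity) (fun n => ?_)
      (Real.summable_pow_div_factorial (s ^ 2))
    rw [Nat.add_sub_cancel, mul_comm, mul_div_assoc, div_eq_mul_inv ((s ^ 2) ^ n)]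
    gcongr
    have h1 : (n + 1) * n.factorial ≤ (2 * (n + 1) + j).factorial := by
      rw [← Nat.factorial_succ]
      exact Nat.factorial_le (by omega)
    rw [div_le_iff₀ (by positivity), inv_mul_eq_div, le_div_iff₀ (by positivity)]
    exact_mod_cast h1
  refine ⟨D, _, hD, hs.hasSum, hb (s ^ 2) _ hX ?_⟩
  convert! hs.hasSum using 2 with n
  rw [norm_inv, Complex.norm_natCast, inv_mul_eq_div]

theorem hasSum_facSeries_majorant {j : ℕ} {X : Op} {s : ℝ} (hs : 0 ≤ s) (hX : ‖X‖ ≤ s ^ 2) :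
    ∃ a : ℝ, HasSum (fun n : ℕ => s ^ (2 * n) / (2 * n + j).factorial) a ∧ ‖facSeries j X‖ ≤ a := by
  have := summable_pow_div_factorial_add j s
  rw [abs_of_nonneg hs] at this
  exact ⟨_, this.hasSum, tsum_of_norm_bounded this.hasSum (norm_facSeries_term_le j hX)⟩

theorem pow_two_mul_pred (s : ℝ) (n : ℕ) : s ^ 2 * (n * (s ^ 2) ^ (n - 1)) = n * s ^ (2 * n) := by
  rcases n with _ | n
  · simp
  · rw [Nat.add_sub_cancel, pow_mul, pow_succ (s ^ 2)]; ring

theorem hasSum_le_exp {s : ℝ} (hs : 0 ≤ s) {φ : ℕ → ℕ} (hφ : Function.Injective φ) {f : ℕ → ℝ}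
    {a : ℝ} (hf : HasSum f a) (hle : ∀ n, f n ≤ s ^ φ n / (φ n).factorial) : a ≤ Real.exp s :=
  (hasSum_le hle hf (summable_pow_div_factorial_comp s hφ).hasSum).trans
    (tsum_pow_div_factorial_comp_le hs hφ)

section Derivative

variable {k : ℝ → Kernel} {t : ℝ} {k' : Kernel}

/-- The derivative of `k k̄`. -/
def kkDeriv (k k' : Kernel) : Kernel := rmul k' (kop (star k)) + rmul k (kop (star k'))

theorem norm_kkDeriv_le (k k' : Kernel) : ‖kkDeriv k k'‖ ≤ 2 * ‖k‖ * ‖k'‖ := by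
  have h1 : ‖rmul k' (kop (star k))‖ ≤ ‖k'‖ * ‖k‖ :=
    (norm_rmul_le _ _).trans (by gcongr; exact norm_kop_star_le k)
  have h2 : ‖rmul k (kop (star k'))‖ ≤ ‖k‖ * ‖k'‖ :=
    (norm_rmul_le _ _).trans (by gcongr; exact norm_kop_star_le k')
  have := norm_add_le (rmul k' (kop (star k))) (rmul k (kop (star k')))
  rw [kkDeriv]
  linarith

/-- `rmul`, with real scalars. -/
def rmulR : Kernel →L[ℝ] Op →L[ℝ] Kernel :=
  (ContinuousLinearMap.restrictScalarsL ℂ Op Kernel ℝ ℝ).comp (rmul.restrictScalars ℝ)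

theorem hasDerivAt_rmul {K : ℝ → Kernel} {A : ℝ → Op} {K' : Kernel} {A' : Op}
    (hK : HasDerivAt K K' t) (hA : HasDerivAt A A' t) :
    HasDerivAt (fun s => rmul (K s) (A s)) (rmul K' (A t) + rmul (K t) A') t := by
  have := rmulR.hasDerivAt_of_bilinear (fun _ => hK) (fun _ => hA)
  rw [add_comm] at this
  exact this

theorem hasDerivAt_kop (hk : HasDerivAt k k' t) : HasDerivAt (fun s => kop (k s)) (kop k') t :=
  ((kopL.restrictScalars ℝ).hasFDerivAt.comp_hasDerivAt t hk)

theorem hasDerivAt_star {X : Type*} [MeasureSpace X] {k : ℝ → Lp ℂ 2 (volume : Measure X)}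
    {k' : Lp ℂ 2 (volume : Measure X)} {t : ℝ} (hk : HasDerivAt k k' t) :
    HasDerivAt (fun s => star (k s)) (star k') t := by
  let c : Lp ℂ 2 (volume : Measure X) →L[ℝ] Lp ℂ 2 (volume : Measure X) :=
    { toFun := star
      map_add' := star_add_Lp
      map_smul' := fun c f => by
        have h : ∀ f : Lp ℂ 2 (volume : Measure X), c • f = (c : ℂ) • f := fun f => (Complex.coe_smul c f).symm
        rw [h, star_smul_Lp, RingHom.id_apply, h]
        simp
      cont := conjCLM.continuous }
  exact c.hasFDerivAt.comp_hasDerivAt t hk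

theorem hasDerivAt_kk (hk : HasDerivAt k k' t) :
    HasDerivAt (fun s => kk (k s)) (kkDeriv (k t) k') t :=
  hasDerivAt_rmul hk (hasDerivAt_kop (hasDerivAt_star hk))

theorem exists_hasDerivAt_pKer (hk : HasDerivAt k k' t) :
    ∃ A₁ A₂ : Op,
      HasDerivAt (fun s => pKer (k s)) (rmul (kkDeriv (k t) k') A₁ + rmul (kk (k t)) A₂) t ∧
      ‖A₁‖ ≤ Real.exp ‖k t‖ ∧ ‖A₂‖ ≤ ‖k'‖ * Real.exp ‖k t‖ ∧
      ‖rmul (kkDeriv (k t) k') A₁ + rmul (kk (k t)) A₂‖ ≤ ‖k'‖ * Real.exp ‖k t‖ := by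
  set s := ‖k t‖ with hs
  have hs0 : 0 ≤ s := norm_nonneg _
  have hX := norm_kop_kk_le (k t)
  obtain ⟨D, b, hD, hb, hDb⟩ := exists_hasFDerivAt_facSeries 2 (kop (kk (k t))) hX
  obtain ⟨a, ha, hFa⟩ := hasSum_facSeries_majorant (j := 2) hs0 hX
  have hb0 : 0 ≤ b := hb.nonneg fun n => by positivity
  have ha0 : 0 ≤ a := (norm_nonneg _).trans hFa
  have hY := hasDerivAt_kop (hasDerivAt_kk hk)
  have hF := (hD.restrictScalars ℝ).comp_hasDerivAt t hY
  have hd := hasDerivAt_rmul (hasDerivAt_kk hk) hF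
  have hY' : ‖kop (kkDeriv (k t) k')‖ ≤ 2 * s * ‖k'‖ :=
    (norm_kop_le _).trans (norm_kkDeriv_le _ _)
  have hA2 : ‖D (kop (kkDeriv (k t) k'))‖ ≤ b * (2 * s * ‖k'‖) := (hDb _).trans (by gcongr)
  refine ⟨_, _, hd, norm_facSeries_two_le _, hA2.trans ?_, ?_⟩
  · have : 2 * s * b ≤ Real.exp s := by
      refine hasSum_le_exp hs0 (φ := fun n => 2 * n - 1) (fun a b h => by simp only at h; omega)
        (hb.mul_left (2 * s)) fun n => ?_
      rcases n with _ | n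
      · simp
      · have e : 2 * s * (((n + 1 : ℕ) : ℝ) * (s ^ 2) ^ (n + 1 - 1) / (2 * (n + 1) + 2).factorial) =
            s ^ (2 * n + 1) * ((2 * n + 2 : ℕ) / (2 * (n + 1) + 2).factorial) := by
          rw [Nat.add_sub_cancel, ← pow_mul]
          push_cast
          ring
        rw [e, show 2 * (n + 1) - 1 = 2 * n + 1 by omega, div_eq_mul_inv (s ^ (2 * n + 1))]
        gcongr
        rw [div_le_iff₀ (by positivity), inv_mul_eq_div, le_div_iff₀ (by positivity)]
        have : (2 * n + 2) * (2 * n + 1).factorial ≤ (2 * (n + 1) + 2).factorial := by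
          rw [← Nat.factorial_succ]
          exact Nat.factorial_le (by omega)
        exact_mod_cast this
    calc b * (2 * s * ‖k'‖) = ‖k'‖ * (2 * s * b) := by ring
      _ ≤ _ := by gcongr
  · have hab : 2 * s * a + s ^ 2 * (2 * s * b) ≤ Real.exp s := by
      refine hasSum_le_exp hs0 (injective_two_mul_add 1)
        ((ha.mul_left (2 * s)).add ((hb.mul_left (2 * s)).mul_left (s ^ 2))) fun n => ?_
      have e : s ^ 2 * (2 * s * (n * (s ^ 2) ^ (n - 1) / ((2 * n + 2).factorial : ℝ))) =
          2 * s * (n * s ^ (2 * n)) / (2 * n + 2).factorial := by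
        rw [← pow_two_mul_pred]; ring
      rw [e, Nat.factorial_succ (2 * n + 1)]
      push_cast
      refine le_of_eq ?_
      field_simp
      ring
    calc _ ≤ 2 * s * ‖k'‖ * a + s ^ 2 * (b * (2 * s * ‖k'‖)) := by
          refine (norm_add_le _ _).trans (add_le_add ?_ ?_)
          · exact (norm_rmul_le _ _).trans (mul_le_mul (norm_kkDeriv_le _ _) hFa (norm_nonneg _) (by positivity))
          · exact (norm_rmul_le _ _).trans (mul_le_mul (norm_kk_le _) hA2 (norm_nonneg _) (by positivity))
      _ = ‖k'‖ * (2 * s * a + s ^ 2 * (2 * s * b)) := by ring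
      _ ≤ _ := by gcongr

theorem exists_hasDerivAt_rKer (hk : HasDerivAt k k' t) :
    ∃ A₁ A₂ : Op,
      HasDerivAt (fun s => rKer (k s)) (rmul (kkDeriv (k t) k') A₁ + rmul (kk (k t)) A₂) t ∧
      ‖A₁‖ ≤ Real.exp ‖k t‖ ∧ ‖A₂‖ ≤ ‖k'‖ * Real.exp ‖k t‖ ∧
      ‖rmul (kkDeriv (k t) k') A₁ + rmul (kk (k t)) A₂‖ ≤ ‖k'‖ * Real.exp ‖k t‖ := by
  set s := ‖k t‖ with hs
  have hs0 : 0 ≤ s := norm_nonneg _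
  have hX := norm_kop_kk_le (k t)
  obtain ⟨D, b, hD, hb, hDb⟩ := exists_hasFDerivAt_facSeries 3 (kop (kk (k t))) hX
  obtain ⟨a, ha, hFa⟩ := hasSum_facSeries_majorant (j := 3) hs0 hX
  have hb0 : 0 ≤ b := hb.nonneg fun n => by positivity
  have ha0 : 0 ≤ a := (norm_nonneg _).trans hFa
  have hY := hasDerivAt_kop (hasDerivAt_kk hk)
  have hF := ((hD.restrictScalars ℝ).comp_hasDerivAt t hY).mul (hasDerivAt_kop hk)
  have hd := hasDerivAt_rmul (hasDerivAt_kk hk) hF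
  have hY' : ‖kop (kkDeriv (k t) k')‖ ≤ 2 * s * ‖k'‖ :=
    (norm_kop_le _).trans (norm_kkDeriv_le _ _)
  have hDY : ‖D (kop (kkDeriv (k t) k'))‖ ≤ b * (2 * s * ‖k'‖) := (hDb _).trans (by gcongr)
  have hA2 : ‖D (kop (kkDeriv (k t) k')) * kop (k t) + facSeries 3 (kop (kk (k t))) * kop k'‖ ≤
      b * (2 * s * ‖k'‖) * s + a * ‖k'‖ := by
    refine (norm_add_le _ _).trans (add_le_add ?_ ?_)
    · exact (norm_mul_le _ _).trans (by gcongr; exact norm_kop_le _)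
    · exact (norm_mul_le _ _).trans (by gcongr; exact norm_kop_le _)
  have hA1 : ‖facSeries 3 (kop (kk (k t))) * kop (k t)‖ ≤ a * s :=
    (norm_mul_le _ _).trans (by gcongr; exact norm_kop_le _)
  have e : ∀ n : ℕ, s ^ 2 * (2 * (n * (s ^ 2) ^ (n - 1) / ((2 * n + 3).factorial : ℝ))) =
      2 * (n * s ^ (2 * n)) / (2 * n + 3).factorial := fun n => by
    rw [← pow_two_mul_pred]; ring
  have hsum := ((hb.mul_left 2).mul_left (s ^ 2)).add ha
  refine ⟨_, _, hd, norm_facSeries_three_mul_le _, hA2.trans ?_, ?_⟩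
  · have : s ^ 2 * (2 * b) + a ≤ Real.exp s := by
      refine hasSum_le_exp hs0 (injective_two_mul_add 0) hsum fun n => ?_
      rw [e, ← add_div, add_zero, show 2 * (n * s ^ (2 * n)) + s ^ (2 * n) =
        s ^ (2 * n) * (2 * n + 1 : ℕ) by push_cast; ring, mul_div_assoc, div_eq_mul_inv (s ^ (2 * n))]
      gcongr
      rw [div_le_iff₀ (by positivity), inv_mul_eq_div, le_div_iff₀ (by positivity)]
      have : (2 * n + 1) * (2 * n).factorial ≤ (2 * n + 3).factorial := by
        rw [← Nat.factorial_succ]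
        exact Nat.factorial_le (by omega)
      exact_mod_cast this
    calc b * (2 * s * ‖k'‖) * s + a * ‖k'‖ = ‖k'‖ * (s ^ 2 * (2 * b) + a) := by ring
      _ ≤ _ := by gcongr
  · have hab : s ^ 2 * (2 * a) + s ^ 2 * (s ^ 2 * (2 * b) + a) ≤ Real.exp s := by
      refine hasSum_le_exp hs0 (injective_two_mul_add 2)
        (((ha.mul_left 2).mul_left (s ^ 2)).add (hsum.mul_left (s ^ 2))) fun n => ?_
      rw [e, Nat.factorial_succ (2 * n + 2)]
      push_cast
      refine le_of_eq ?_
      field_simp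
      ring
    calc _ ≤ 2 * s * ‖k'‖ * (a * s) + s ^ 2 * (b * (2 * s * ‖k'‖) * s + a * ‖k'‖) := by
          refine (norm_add_le _ _).trans (add_le_add ?_ ?_)
          · exact (norm_rmul_le _ _).trans (mul_le_mul (norm_kkDeriv_le _ _) hA1 (norm_nonneg _) (by positivity))
          · exact (norm_rmul_le _ _).trans (mul_le_mul (norm_kk_le _) hA2 (norm_nonneg _) (by positivity))
      _ = ‖k'‖ * (s ^ 2 * (2 * a) + s ^ 2 * (s ^ 2 * (2 * b) + a)) := by ring
      _ ≤ _ := by gcongr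

end Derivative

/-! ### `Θ_k` is a Bogoliubov transformation -/

theorem summable_norm_ch (k : Kernel) : Summable fun n : ℕ =>
    ‖((Nat.factorial (2 * n) : ℂ)⁻¹) • (kop k * kop (star k)) ^ n‖ := by
  rw [← kop_kk]
  exact summable_norm_facSeries 0 (kop (kk k))

theorem summable_norm_sh (k : Kernel) : Summable fun n : ℕ =>
    ‖((Nat.factorial (2 * n + 1) : ℂ)⁻¹) • ((kop k * kop (star k)) ^ n * kop k)‖ := by
  rw [← kop_kk]
  refine Summable.of_nonneg_of_le (fun n => norm_nonneg _) (fun n => ?_)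
    ((summable_norm_facSeries 1 (kop (kk k))).mul_right ‖kop k‖)
  rw [← smul_mul_assoc]
  exact norm_mul_le _ _

theorem blockOp_apply (a b c d : Op) (u : L2Sum) :
    blockOp a b c d u = WithLp.toLp 2 (a u.fst + b u.snd, c u.fst + d u.snd) := rfl

theorem blockOp_mul (a b c d a' b' c' d' : Op) :
    blockOp a b c d * blockOp a' b' c' d' =
      blockOp (a * a' + b * c') (a * b' + b * d') (c * a' + d * c') (c * b' + d * d') := by
  ext1 u
  change WithLp.toLp 2 (a (a' u.fst + b' u.snd) + b (c' u.fst + d' u.snd),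
    c (a' u.fst + b' u.snd) + d (c' u.fst + d' u.snd)) = WithLp.toLp 2
      ((a (a' u.fst) + b (c' u.fst)) + (a (b' u.snd) + b (d' u.snd)),
        (c (a' u.fst) + d (c' u.fst)) + (c (b' u.snd) + d (d' u.snd)))
  simp only [map_add]
  congr 2 <;> abel

theorem star_blockOp (a b c d : Op) :
    star (blockOp a b c d) = blockOp (star a) (star c) (star b) (star d) := by
  symm
  refine (ContinuousLinearMap.eq_adjoint_iff _ _).2 fun u v => ?_
  simp only [blockOp_apply, WithLp.prod_inner_apply, inner_add_left, inner_add_right,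
    ContinuousLinearMap.star_eq_adjoint, ContinuousLinearMap.adjoint_inner_left]
  exact add_add_add_comm _ _ _ _

theorem hasSum_blockOp {ι : Type*} {f₁ f₂ f₃ f₄ : ι → Op} {a b c d : Op} (h₁ : HasSum f₁ a)
    (h₂ : HasSum f₂ b) (h₃ : HasSum f₃ c) (h₄ : HasSum f₄ d) :
    HasSum (fun i => blockOp (f₁ i) (f₂ i) (f₃ i) (f₄ i)) (blockOp a b c d) := by
  let e : L2Sum ≃L[ℂ] L2 × L2 := WithLp.prodContinuousLinearEquiv 2 ℂ L2 L2
  let P₁ : L2Sum →L[ℂ] L2 := ContinuousLinearMap.fst ℂ L2 L2 ∘L (e : L2Sum →L[ℂ] L2 × L2)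
  let P₂ : L2Sum →L[ℂ] L2 := ContinuousLinearMap.snd ℂ L2 L2 ∘L (e : L2Sum →L[ℂ] L2 × L2)
  let I₁ : L2 →L[ℂ] L2Sum := (e.symm : L2 × L2 →L[ℂ] L2Sum) ∘L ContinuousLinearMap.inl ℂ L2 L2
  let I₂ : L2 →L[ℂ] L2Sum := (e.symm : L2 × L2 →L[ℂ] L2Sum) ∘L ContinuousLinearMap.inr ℂ L2 L2
  let E : (L2 →L[ℂ] L2Sum) → (L2Sum →L[ℂ] L2) → Op →L[ℂ] (L2Sum →L[ℂ] L2Sum) := fun I P =>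
    (ContinuousLinearMap.compL ℂ L2Sum L2 L2Sum I) ∘L
      ((ContinuousLinearMap.compL ℂ L2Sum L2 L2).flip P)
  have hE : ∀ a b c d : Op, blockOp a b c d = E I₁ P₁ a + E I₁ P₂ b + (E I₂ P₁ c + E I₂ P₂ d) := by
    intro a b c d
    ext1 u
    rw [blockOp_apply]
    change _ = WithLp.toLp 2 (a u.fst, (0 : L2)) + WithLp.toLp 2 (b u.snd, (0 : L2)) +
      (WithLp.toLp 2 ((0 : L2), c u.fst) + WithLp.toLp 2 ((0 : L2), d u.snd))
    rw [← WithLp.toLp_add, ← WithLp.toLp_add, ← WithLp.toLp_add]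
    simp
  simp only [hE]
  exact ((h₁.mapL _).add (h₂.mapL _)).add ((h₃.mapL _).add (h₄.mapL _))

/-- `(0, k; k̄, 0)`, the generator of `s ↦ Θ_{sk}`. -/
def genK (k : Kernel) : L2Sum →L[ℂ] L2Sum := blockOp 0 (kop k) (kop (star k)) 0

theorem genK_sq (k : Kernel) :
    genK k ^ 2 = blockOp (kop (kk k)) 0 0 (kop (kk (star k))) := by
  rw [sq, genK, blockOp_mul, kop_kk, kop_kk, star_star]
  simp

theorem genK_pow_even (k : Kernel) (n : ℕ) :
    genK k ^ (2 * n) = blockOp (kop (kk k) ^ n) 0 0 (kop (kk (star k)) ^ n) := by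
  induction n with
  | zero =>
    ext1 u
    change u = WithLp.toLp 2 (u.fst + 0, 0 + u.snd)
    rw [add_zero, zero_add]
    rfl
  | succ n ih => rw [mul_add, pow_add, ih, mul_one, genK_sq, blockOp_mul]; simp [pow_succ]

theorem genK_pow_odd (k : Kernel) (n : ℕ) :
    genK k ^ (2 * n + 1) =
      blockOp 0 (kop (kk k) ^ n * kop k) (kop (kk (star k)) ^ n * kop (star k)) 0 := by
  rw [pow_succ, genK_pow_even, genK, blockOp_mul]
  simp

/-- `Θ_k` is the exponential of `(0, k; k̄, 0)`: `ch` and `sh` collect the even and the odd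
powers. -/
theorem theta_eq_exp (k : Kernel) : theta k = NormedSpace.exp (genK k) := by
  have hch : ∀ k, HasSum (fun n : ℕ => ((Nat.factorial (2 * n) : ℂ)⁻¹) • kop (kk k) ^ n)
      (ch k) := fun k => by rw [ch_eq]; exact hasSum_facSeries 0 (kop (kk k))
  have hsh : ∀ k, HasSum (fun n : ℕ => ((Nat.factorial (2 * n + 1) : ℂ)⁻¹) •
      (kop (kk k) ^ n * kop k)) (sh k) := fun k => by
    rw [sh_eq]
    have := (hasSum_facSeries 1 (kop (kk k))).mul_right (kop k)
    simpa only [smul_mul_assoc] using this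
  have hsm : ∀ (c : ℂ) (a b d e : Op), c • blockOp a b d e =
      blockOp (c • a) (c • b) (c • d) (c • e) := fun c a b d e => by
    ext1 u
    simp only [smul_apply, blockOp_apply, ← WithLp.toLp_smul, Prod.smul_mk, smul_add]
  have h1 := hasSum_blockOp (hch k) hasSum_zero hasSum_zero (hch (star k))
  have h2 := hasSum_blockOp hasSum_zero (hsh k) (hsh (star k)) hasSum_zero
  have h3 : HasSum (fun n : ℕ => ((n.factorial : ℂ)⁻¹) • genK k ^ n)
      (blockOp (ch k) 0 0 (ch (star k)) + blockOp 0 (sh k) (sh (star k)) 0) := by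
    refine HasSum.even_add_odd ?_ ?_
    · convert! h1 using 2 with n
      rw [genK_pow_even, hsm, smul_zero]
    · convert! h2 using 2 with n
      rw [genK_pow_odd, hsm, smul_zero]
  have h4 := NormedSpace.exp_series_hasSum_exp' (𝕂 := ℂ) (genK k)
  have h5 : theta k = blockOp (ch k) 0 0 (ch (star k)) + blockOp 0 (sh k) (sh (star k)) 0 := by
    ext1 u
    change WithLp.toLp 2 (ch k u.fst + sh k u.snd, sh (star k) u.fst + ch (star k) u.snd) =
      WithLp.toLp 2 (ch k u.fst + 0, 0 + ch (star k) u.snd) +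
        WithLp.toLp 2 (0 + sh k u.snd, sh (star k) u.fst + 0)
    rw [← WithLp.toLp_add, Prod.mk_add_mk, add_zero, zero_add, zero_add, add_zero,
      add_comm (ch (star k) _)]
  rw [h5]
  exact h3.unique h4

theorem swapConj_genK (k : Kernel) (u : L2Sum) : genK k (swapConj u) = swapConj (genK k u) := by
  simp only [genK, swapConj, blockOp_apply]
  have h1 := kop_star k u.snd
  have h2 := kop_star (star k) u.fst
  rw [star_star] at h2
  simp [h1, h2]

theorem continuous_swapConj : Continuous swapConj := by
  unfold swapConj
  refine (WithLp.prod_continuous_toLp 2 L2 L2).comp (Continuous.prodMk ?_ ?_)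
  · exact conjCLM.continuous.comp (WithLp.prodContinuousLinearEquiv 2 ℂ L2 L2).continuous.snd
  · exact conjCLM.continuous.comp (WithLp.prodContinuousLinearEquiv 2 ℂ L2 L2).continuous.fst

theorem swapConj_add (u v : L2Sum) : swapConj (u + v) = swapConj u + swapConj v := by
  simp [swapConj, ← WithLp.toLp_add, star_add_Lp]

theorem swapConj_smul (c : ℂ) (u : L2Sum) : swapConj (c • u) = star c • swapConj u := by
  simp [swapConj, ← WithLp.toLp_smul, star_smul_Lp]

theorem swapConj_zero : swapConj 0 = 0 := by
  simpa using swapConj_smul 0 0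

theorem star_kop_eq {k : Kernel} (hk : IsSymm k) : star (kop k) = kop (star k) := by
  rw [ContinuousLinearMap.star_eq_adjoint, ← kop_adjK, adjK, (isSymm_iff k).1 hk]

theorem star_genK {k : Kernel} (hk : IsSymm k) : star (genK k) = genK k := by
  rw [genK, star_blockOp, star_zero, star_kop_eq hk, ← star_kop_eq hk, star_star]

/-- If `S` anticommutes with a self-adjoint `K`, then `e^K` preserves the form `S`. -/
theorem eq_star_exp_mul_mul_exp {H : Type*} [NormedAddCommGroup H] [InnerProductSpace ℂ H]
    [CompleteSpace H] {K S : H →L[ℂ] H} (hK : star K = K) (hS : S * (-K) = K * S) :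
    S = star (NormedSpace.exp K) * S * NormedSpace.exp K := by
  let _ : NormedAlgebra ℚ (H →L[ℂ] H) := NormedAlgebra.restrictScalars ℚ ℂ _
  rw [NormedSpace.star_exp, hK]
  have h1 := SemiconjBy.exp_right (x := S) (a := -K) (b := K) hS
  have h2 : NormedSpace.exp (-K) * NormedSpace.exp K = 1 := by
    rw [← NormedSpace.exp_add_of_commute (Commute.neg_left (Commute.refl K)), neg_add_cancel,
      NormedSpace.exp_zero]
  rw [← h1.eq, mul_assoc, h2, mul_one]

theorem isBogoliubov_theta {k : Kernel} (hk : IsSymm k) : IsBogoliubov (theta k) := by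
  rw [theta_eq_exp]
  have hsum := NormedSpace.exp_series_hasSum_exp' (𝕂 := ℂ) (genK k)
  constructor
  · intro u
    have hpow : ∀ (n : ℕ) u, (genK k ^ n) (swapConj u) = swapConj ((genK k ^ n) u) := by
      intro n
      induction n with
      | zero => intro u; rfl
      | succ n ih => intro u; rw [pow_succ, mul_apply_eq_comp, mul_apply_eq_comp, swapConj_genK, ih]
    have h1 := hsum.mapL (ContinuousLinearMap.apply ℂ L2Sum (swapConj u))
    have h2 := (hsum.mapL (ContinuousLinearMap.apply ℂ L2Sum u)).map
      ({ toFun := swapConj, map_zero' := swapConj_zero, map_add' := swapConj_add } :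
        L2Sum →+ L2Sum) continuous_swapConj
    refine h1.unique ?_
    convert! h2 using 1
    funext n
    change ((n.factorial : ℂ)⁻¹) • (genK k ^ n) (swapConj u) =
      swapConj (((n.factorial : ℂ)⁻¹) • (genK k ^ n) u)
    rw [swapConj_smul, hpow]
    simp
  · refine eq_star_exp_mul_mul_exp (star_genK hk) ?_
    ext1 u
    change sOp (-genK k u) = genK k (sOp u)
    simp only [sOp, genK, blockOp_apply, ← WithLp.toLp_neg]
    change WithLp.toLp 2 (_ + _, _ + _) = WithLp.toLp 2 (_ + _, _ + _)
    simp

/-! ### Weak derivatives as derivatives of translations -/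

set_option linter.unusedSectionVars false

section Translation

variable {E : Type*} [NormedAddCommGroup E] [NormedSpace ℝ E] [MeasureSpace E]

/-- `g` is the weak derivative of `f` in the direction `v`. -/
def IsWeakDeriv (v : E) (f g : E → ℂ) : Prop :=
  ∀ φ : E → ℂ, ContDiff ℝ ∞ φ → HasCompactSupport φ →
    ∫ q, f q * fderiv ℝ φ q v = -∫ q, g q * φ q

theorem IsWeakDeriv.congr {v : E} {f f' g g' : E → ℂ} (h : IsWeakDeriv v f g)
    (hf : f =ᵐ[volume] f') (hg : g =ᵐ[volume] g') : IsWeakDeriv v f' g' := by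
  intro φ h1 h2
  rw [← integral_congr_ae (hf.mono fun x hx => by simp only [hx] :
      (fun q => f q * fderiv ℝ φ q v) =ᵐ[volume] fun q => f' q * fderiv ℝ φ q v),
    ← integral_congr_ae (hg.mono fun x hx => by simp only [hx] :
      (fun q => g q * φ q) =ᵐ[volume] fun q => g' q * φ q)]
  exact h φ h1 h2

variable [FiniteDimensional ℝ E] [BorelSpace E] [(volume : Measure E).IsAddHaarMeasure]

/-- Translation on `L²`, `(τ_v f)(q) = f(q + v)`. -/
def trans (v : E) : Lp ℂ 2 (volume : Measure E) →ₗᵢ[ℂ] Lp ℂ 2 (volume : Measure E) :=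
  pull (fun q => q + v) (measurePreserving_add_right volume v)

theorem coeFn_trans (v : E) (f : Lp ℂ 2 (volume : Measure E)) :
    trans v f =ᵐ[volume] fun q => f (q + v) := coeFn_pull _ _ f

theorem trans_zero (f : Lp ℂ 2 (volume : Measure E)) : trans 0 f = f := by
  refine Lp.ext ?_
  filter_upwards [coeFn_trans 0 f] with q hq
  rw [hq, add_zero]

theorem continuous_trans (v : E) (f : Lp ℂ 2 (volume : Measure E)) :
    Continuous fun t : ℝ => trans (t • v) f := by
  let g : ℝ → C(E, E) := fun t => ⟨fun q => q + t • v, by fun_prop⟩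
  have hg : Continuous g := ContinuousMap.continuous_of_continuous_uncurry _ (by
    simp only [g, Function.uncurry_def, ContinuousMap.coe_mk]
    fun_prop)
  exact Continuous.compMeasurePreservingLp (f := fun _ => f) continuous_const hg
    (fun t => measurePreserving_add_right volume (t • v)) ENNReal.ofNat_ne_top

theorem locallyIntegrable_Lp (f : Lp ℂ 2 (volume : Measure E)) :
    LocallyIntegrable f (volume : Measure E) := (Lp.memLp f).locallyIntegrable (by norm_num)

/-- The function `t ↦ ∫ f(q) φ(q - t v) dq` is a convolution, hence differentiable. -/
theorem hasDerivAt_integral_mul_sub {f : E → ℂ} (hf : LocallyIntegrable f (volume : Measure E))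
    {φ : E → ℂ} (h1 : ContDiff ℝ ∞ φ) (h2 : HasCompactSupport φ) (v : E) (t : ℝ) :
    HasDerivAt (fun t : ℝ => ∫ q, f q * φ (q - t • v))
      (-∫ q, f q * fderiv ℝ φ (q - t • v) v) t := by
  let g : E → ℂ := fun y => φ (-y)
  have hg : ContDiff ℝ ∞ g := h1.comp contDiff_neg
  have hgc : HasCompactSupport g := h2.comp_homeomorph (Homeomorph.neg E)
  have h := hgc.hasFDerivAt_convolution_right (ContinuousLinearMap.mul ℝ ℂ) hf
    (hg.of_le (by norm_cast)) (t • v)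
  have hl : HasDerivAt (fun t : ℝ => t • v) v t := by
    simpa using (hasDerivAt_id t).smul_const v
  have h3 := h.comp_hasDerivAt t hl
  have hfd : ∀ y, fderiv ℝ g y v = -fderiv ℝ φ (-y) v := by
    intro y
    have hd := (h1.differentiable (by simp)).differentiableAt (x := -y) |>.hasFDerivAt
    have := hd.comp y (hasFDerivAt_id y).neg
    have e : fderiv ℝ g y = _ := this.fderiv
    rw [e]
    simp
  rw [convolution_precompR_apply _ hf (hgc.fderiv ℝ) (hg.continuous_fderiv (by simp))] at h3
  simp only [convolution_def, ContinuousLinearMap.mul_apply', hfd, neg_sub, mul_neg,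
    integral_neg] at h3
  convert! h3 using 1
  funext s
  simp only [Function.comp, convolution_def, ContinuousLinearMap.mul_apply', g, neg_sub]

theorem integral_trans_mul (v : E) (f : Lp ℂ 2 (volume : Measure E)) (φ : E → ℂ) :
    ∫ q, trans v f q * φ q = ∫ q, f q * φ (q - v) := by
  rw [← integral_add_right_eq_self (fun q => f q * φ (q - v)) v]
  refine integral_congr_ae ?_
  filter_upwards [coeFn_trans v f] with q hq
  rw [hq, add_sub_cancel_right]

/-- Integration against a test function, as a continuous linear form on `L²`. -/
theorem exists_pairing {φ : E → ℂ} (h1 : ContDiff ℝ ∞ φ) (h2 : HasCompactSupport φ) :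
    ∃ ℓ : Lp ℂ 2 (volume : Measure E) →L[ℂ] ℂ, ∀ f, ℓ f = ∫ q, f q * φ q := by
  have hm : MemLp φ 2 (volume : Measure E) := h1.continuous.memLp_of_hasCompactSupport h2
  refine ⟨innerSL ℂ (star hm.toLp), fun f => ?_⟩
  rw [innerSL_apply_apply, inner_eq_integral]
  refine integral_congr_ae ?_
  filter_upwards [Lp.coeFn_star hm.toLp, hm.coeFn_toLp] with q h1 h2
  rw [h1, Pi.star_apply, h2, star_star, mul_comm]

theorem eq_zero_of_integral_test {f : Lp ℂ 2 (volume : Measure E)}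
    (h : ∀ φ : E → ℂ, ContDiff ℝ ∞ φ → HasCompactSupport φ → ∫ q, f q * φ q = 0) : f = 0 := by
  refine Lp.ext ?_
  have := ae_eq_zero_of_integral_contDiff_smul_eq_zero (locallyIntegrable_Lp f) fun g h1 h2 => by
    rw [← h (fun q => (g q : ℂ)) (Complex.ofRealCLM.contDiff.comp h1)
      (h2.comp_left Complex.ofReal_zero)]
    refine integral_congr_ae (Filter.Eventually.of_forall fun q => ?_)
    simp [mul_comm]
  filter_upwards [this, Lp.coeFn_zero ℂ 2 (volume : Measure E)] with q h1 h2
  rw [h1, h2]; rfl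

/-- An `L²` function `g` is the weak derivative of the `L²` function `f` in the direction `v` if
and only if the difference quotients of `f` converge to `g` in `L²`. -/
theorem isWeakDeriv_iff_hasDerivAt (v : E) (f g : Lp ℂ 2 (volume : Measure E)) :
    IsWeakDeriv v f g ↔ HasDerivAt (fun t : ℝ => trans (t • v) f) g 0 := by
  constructor
  · intro h
    -- tested against `φ`, this is the fundamental theorem of calculus for
    -- `t ↦ ∫ q, f q * φ (q - t • v)`
    have hint : ∀ t : ℝ, trans (t • v) f = f + ∫ s in (0 : ℝ)..t, trans (s • v) g := by
      intro t
      rw [← sub_eq_zero]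
      refine eq_zero_of_integral_test fun φ h1 h2 => ?_
      obtain ⟨ℓ, hℓ⟩ := exists_pairing h1 h2
      have hc := (continuous_trans v g)
      have hi : ℓ (∫ s in (0 : ℝ)..t, trans (s • v) g) = ∫ s in (0 : ℝ)..t, ℓ (trans (s • v) g) :=
        ((ℓ.restrictScalars ℝ).intervalIntegral_comp_comm (hc.intervalIntegrable 0 t)).symm
      rw [← hℓ, map_sub, map_add, hi]
      have hd : ∀ s : ℝ, HasDerivAt (fun s : ℝ => ℓ (trans (s • v) f))
          (ℓ (trans (s • v) g)) s := by
        intro s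
        simp only [hℓ, integral_trans_mul]
        have hs1 : ContDiff ℝ ∞ fun q => φ (q - s • v) := h1.comp (contDiff_id.sub contDiff_const)
        have hs2 : HasCompactSupport fun q => φ (q - s • v) :=
          h2.comp_homeomorph (Homeomorph.subRight (s • v))
        have h3 := h _ hs1 hs2
        have h4 := hasDerivAt_integral_mul_sub (locallyIntegrable_Lp f) h1 h2 v s
        have h5 : ∀ q, fderiv ℝ (fun q => φ (q - s • v)) q = fderiv ℝ φ (q - s • v) := fun q => by
          simp only [sub_eq_add_neg, fderiv_comp_add_right]
        simp only [h5] at h3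
        rwa [h3, neg_neg] at h4
      have := intervalIntegral.integral_eq_sub_of_hasDerivAt (a := 0) (b := t)
        (fun s _ => hd s) ((ℓ.continuous.comp hc).intervalIntegrable 0 t)
      simp only [zero_smul, trans_zero] at this
      rw [this]
      ring
    have hc := continuous_trans v g
    have h1 := intervalIntegral.integral_hasDerivAt_right (hc.intervalIntegrable 0 0)
      (hc.stronglyMeasurableAtFilter _ _) hc.continuousAt
    have h2 := h1.const_add f
    simp only [zero_smul, trans_zero] at h2
    convert! h2 using 1
    funext t
    exact hint t
  · intro h φ h1 h2
    obtain ⟨ℓ, hℓ⟩ := exists_pairing h1 h2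
    have h3 := (ℓ.restrictScalars ℝ).hasFDerivAt.comp_hasDerivAt (0 : ℝ) h
    have h4 := hasDerivAt_integral_mul_sub (locallyIntegrable_Lp f) h1 h2 v 0
    have h5 : ((ℓ.restrictScalars ℝ) ∘ fun t : ℝ => trans (t • v) f) =
        fun t : ℝ => ∫ q, f q * φ (q - t • v) := by
      funext t
      simp only [Function.comp, ContinuousLinearMap.coe_restrictScalars', hℓ, integral_trans_mul]
    rw [h5] at h3
    have := h3.unique h4
    simp only [ContinuousLinearMap.coe_restrictScalars', hℓ, zero_smul, sub_zero] at this
    rw [this, neg_neg]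

/-- The classical derivative of a test function is its weak derivative. -/
theorem isWeakDeriv_fderiv {f : E → ℂ} (h1 : ContDiff ℝ ∞ f) (h2 : HasCompactSupport f) (v : E) :
    IsWeakDeriv v f fun q => fderiv ℝ f q v := by
  intro φ h3 h4
  have c1 := h1.continuous
  have c3 := h3.continuous
  have d1 : Continuous fun q => fderiv ℝ f q v :=
    (h1.continuous_fderiv (by simp)).clm_apply continuous_const
  have d3 : Continuous fun q => fderiv ℝ φ q v :=
    (h3.continuous_fderiv (by simp)).clm_apply continuous_const
  refine integral_mul_fderiv_eq_neg_fderiv_mul_of_integrable ?_ ?_ ?_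
    (fun x _ => (h1.differentiable (by simp)).differentiableAt)
    (fun x _ => (h3.differentiable (by simp)).differentiableAt)
  · exact (d1.mul c3).integrable_of_hasCompactSupport h4.mul_left
  · exact (c1.mul d3).integrable_of_hasCompactSupport h2.mul_right
  · exact (c1.mul c3).integrable_of_hasCompactSupport h4.mul_left

end Translation

/-! ### Gradient norms of kernels -/

theorem trans_star {E : Type*} [NormedAddCommGroup E] [NormedSpace ℝ E] [MeasureSpace E]
    [FiniteDimensional ℝ E] [BorelSpace E] [(volume : Measure E).IsAddHaarMeasure] (v : E)
    (f : Lp ℂ 2 (volume : Measure E)) : trans v (star f) = star (trans v f) := by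
  refine Lp.ext ?_
  filter_upwards [coeFn_trans v (star f), Lp.coeFn_star (trans v f), coeFn_trans v f,
    (measurePreserving_add_right volume v).quasiMeasurePreserving.ae (Lp.coeFn_star f)]
    with q h1 h2 h3 h4
  rw [h1, h2, Pi.star_apply, h3]; exact h4

instance : (volume : Measure (E3 × E3)).IsAddHaarMeasure :=
  inferInstanceAs ((volume : Measure E3).prod volume).IsAddHaarMeasure

theorem trans_transp (v : E3 × E3) (K : Kernel) : trans v (transp K) = transp (trans v.swap K) := by
  refine Lp.ext ?_
  filter_upwards [coeFn_trans v (transp K), coeFn_transp (trans v.swap K),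
    Measure.measurePreserving_swap.quasiMeasurePreserving.ae (coeFn_trans v.swap K),
    (measurePreserving_add_right volume v).quasiMeasurePreserving.ae (coeFn_transp K)]
    with q h1 h2 h3 h4
  rw [h1, h2, h4]; exact h3.symm

/-- Translating a kernel in its first variable is translating the values of its operator. -/
theorem kop_trans_left (a : E3) (K : Kernel) (f : L2) :
    kop (trans (a, 0) K) f = trans a (kop K f) := by
  refine Lp.ext ?_
  filter_upwards [coeFn_kop (trans (a, 0) K) f, coeFn_trans a (kop K f),
    (measurePreserving_add_right volume a).quasiMeasurePreserving.ae (coeFn_kop K f),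
    Measure.ae_ae_of_ae_prod (coeFn_trans ((a, 0) : E3 × E3) K)] with x h1 h2 h3 h4
  rw [h1, h2, h3]
  refine integral_congr_ae ?_
  filter_upwards [h4] with y hy
  rw [hy, Prod.mk_add_mk, add_zero]

/-- Translating a kernel in its second variable is translating the argument of its operator. -/
theorem kop_trans_right (a : E3) (K : Kernel) (f : L2) :
    kop (trans (0, a) K) f = kop K (trans (-a) f) := by
  refine Lp.ext ?_
  filter_upwards [coeFn_kop (trans (0, a) K) f, coeFn_kop K (trans (-a) f),
    Measure.ae_ae_of_ae_prod (coeFn_trans ((0, a) : E3 × E3) K)] with x h1 h2 h4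
  rw [h1, h2, ← integral_sub_right_eq_self _ a]
  have h5 := (measurePreserving_sub_right volume a).quasiMeasurePreserving.ae h4
  refine integral_congr_ae ?_
  filter_upwards [h5, coeFn_trans (-a) f] with y hy hf
  rw [hy, hf, Prod.mk_add_mk, add_zero, sub_add_cancel, ← sub_eq_add_neg]

theorem trans_rmul (a : E3) (K : Kernel) (A : Op) :
    trans (a, 0) (rmul K A) = rmul (trans (a, 0) K) A := by
  refine kop_injective (ContinuousLinearMap.ext fun f => ?_)
  rw [kop_trans_left, kop_rmul, kop_rmul, mul_apply_eq_comp, mul_apply_eq_comp, kop_trans_left]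

/-- Transposition exchanges the translations of the two variables, hence the weak derivatives. -/
theorem IsWeakDeriv.transp {v : E3 × E3} {K G : Kernel} (h : IsWeakDeriv v K G) :
    IsWeakDeriv v.swap (transp K) (transp G) := by
  rw [isWeakDeriv_iff_hasDerivAt] at h ⊢
  have := (Bogoliubov.transp.toContinuousLinearMap.restrictScalars ℝ).hasFDerivAt.comp_hasDerivAt
    (0 : ℝ) h
  convert! this using 1
  funext t
  rw [trans_transp]
  rfl

theorem IsWeakDeriv.star {v : E3 × E3} {K G : Kernel} (h : IsWeakDeriv v K G) :
    IsWeakDeriv v (star K : Kernel) (star G : Kernel) := by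
  rw [isWeakDeriv_iff_hasDerivAt] at h ⊢
  simp only [trans_star]
  exact hasDerivAt_star h

theorem IsWeakDeriv.rmul {a : E3} {K G : Kernel} (h : IsWeakDeriv (a, 0) K G) (A : Op) :
    IsWeakDeriv (a, 0) (rmul K A) (rmul G A) := by
  rw [isWeakDeriv_iff_hasDerivAt] at h ⊢
  have := ((Bogoliubov.rmul.flip A).restrictScalars ℝ).hasFDerivAt.comp_hasDerivAt (0 : ℝ) h
  convert! this using 1
  funext t
  rw [Prod.smul_mk, smul_zero, trans_rmul]
  simp

theorem IsWeakDeriv.add {v : E3 × E3} {K G L H : Kernel} (h : IsWeakDeriv v K G)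
    (h' : IsWeakDeriv v L H) : IsWeakDeriv v (K + L : Kernel) (G + H : Kernel) := by
  rw [isWeakDeriv_iff_hasDerivAt] at h h' ⊢
  simp only [map_add]
  exact h.add h'

theorem isWeakDeriv_zero (v : E3 × E3) : IsWeakDeriv v (0 : Kernel) (0 : Kernel) := by
  rw [isWeakDeriv_iff_hasDerivAt]
  simp only [map_zero]
  exact hasDerivAt_const _ _

/-- The `L²` norm of the vector of the weak derivatives in the directions `v 0, v 1, v 2`, which is
`∞` if one of these is not in `L²`. -/
def gradN (v : Fin 3 → E3 × E3) (K : Kernel) : ℝ≥0∞ :=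
  ⨅ (G : PiLp 2 fun _ : Fin 3 => Kernel) (_ : ∀ j, IsWeakDeriv (v j) K (G j)),
    ENNReal.ofReal ‖G‖

/-- The coordinate directions of the first variable. -/
def dir₁ (j : Fin 3) : E3 × E3 := (unitVec j, 0)

/-- The coordinate directions of the second variable. -/
def dir₂ (j : Fin 3) : E3 × E3 := (0, unitVec j)

theorem memLp_vector_iff {G : E3 × E3 → EuclideanSpace ℂ (Fin 3)} :
    MemLp G 2 ↔ ∀ j, MemLp (fun q => G q j) 2 := memLp_piLp_iff

theorem eLpNorm_vector (G : PiLp 2 fun _ : Fin 3 => Kernel) :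
    eLpNorm (fun q => (WithLp.toLp 2 fun j => G j q : EuclideanSpace ℂ (Fin 3))) 2 =
      ENNReal.ofReal ‖G‖ := by
  have hm : MemLp (fun q => (WithLp.toLp 2 fun j => G j q : EuclideanSpace ℂ (Fin 3))) 2
      (volume : Measure (E3 × E3)) :=
    memLp_vector_iff.2 fun j => Lp.memLp (G j)
  have h2 : ∫ q, ‖(WithLp.toLp 2 fun j => G j q : EuclideanSpace ℂ (Fin 3))‖ ^ 2 = ‖G‖ ^ 2 := by
    simp only [PiLp.norm_sq_eq_of_L2]
    refine (integral_finsetSum _ fun j _ => kernel_integrable_sq (G j)).trans ?_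
    exact Finset.sum_congr rfl fun j _ => (norm_sq_eq (G j)).symm
  rw [MemLp.eLpNorm_eq_integral_rpow_norm two_ne_zero ENNReal.ofNat_ne_top hm]
  congr 1
  simp only [ENNReal.toReal_ofNat, Real.rpow_two]
  rw [h2, ← Real.rpow_natCast, ← Real.rpow_mul (norm_nonneg _)]
  norm_num

/-- The infimum over vector-valued gradients is the infimum over triples of kernels: the choice of
representatives does not matter. -/
theorem iInf_eLpNorm_eq_gradN {f : E3 × E3 → ℂ} {K : Kernel} (h : f =ᵐ[volume] K)
    (v : Fin 3 → E3 × E3) {P : (E3 × E3 → EuclideanSpace ℂ (Fin 3)) → Prop}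
    (hP : ∀ G, P G ↔ ∀ j, IsWeakDeriv (v j) f fun q => G q j) :
    (⨅ (G : E3 × E3 → EuclideanSpace ℂ (Fin 3))
      (_ : LocallyIntegrable f ∧ MemLp G 2 ∧ P G), eLpNorm G 2) = gradN v K := by
  refine le_antisymm (le_iInf₂ fun G hG => ?_) (le_iInf₂ fun G hG => ?_)
  · refine iInf₂_le_of_le (fun q => WithLp.toLp 2 fun j => G j q)
      ⟨(locallyIntegrable_Lp K).congr h.symm, memLp_vector_iff.2 fun j => Lp.memLp (G j),
        (hP _).2 fun j => (hG j).congr h.symm Filter.EventuallyEq.rfl⟩ (eLpNorm_vector G).le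
  · have hm := memLp_vector_iff.1 hG.2.1
    refine iInf₂_le_of_le (WithLp.toLp 2 fun j => (hm j).toLp)
      (fun j => ((hP G).1 hG.2.2 j).congr h (hm j).coeFn_toLp.symm) ?_
    rw [← eLpNorm_vector]
    refine (eLpNorm_congr_ae ?_).le
    filter_upwards [ae_all_iff.2 fun j => (hm j).coeFn_toLp] with q hq
    ext j
    exact hq j

theorem isWeakGrad₁_iff (f : E3 × E3 → ℂ) (G : E3 × E3 → EuclideanSpace ℂ (Fin 3)) :
    IsWeakGrad₁ f G ↔ ∀ j, IsWeakDeriv (dir₁ j) f fun q => G q j :=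
  ⟨fun h j φ h1 h2 => h φ h1 h2 j, fun h φ h1 h2 j => h j φ h1 h2⟩

theorem isWeakGrad₂_iff (f : E3 × E3 → ℂ) (G : E3 × E3 → EuclideanSpace ℂ (Fin 3)) :
    IsWeakGrad₂ f G ↔ ∀ j, IsWeakDeriv (dir₂ j) f fun q => G q j :=
  ⟨fun h j φ h1 h2 => h φ h1 h2 j, fun h φ h1 h2 j => h j φ h1 h2⟩

theorem gradNorm₁_eq {f : E3 × E3 → ℂ} {K : Kernel} (h : f =ᵐ[volume] K) :
    gradNorm₁ f = gradN dir₁ K := iInf_eLpNorm_eq_gradN h dir₁ (isWeakGrad₁_iff f)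

theorem gradNorm₂_eq {f : E3 × E3 → ℂ} {K : Kernel} (h : f =ᵐ[volume] K) :
    gradNorm₂ f = gradN dir₂ K := iInf_eLpNorm_eq_gradN h dir₂ (isWeakGrad₂_iff f)

theorem norm_toLp_le {G H : PiLp 2 fun _ : Fin 3 => Kernel} {c : ℝ} (hc : 0 ≤ c)
    (h : ∀ j, ‖H j‖ ≤ c * ‖G j‖) : ‖H‖ ≤ c * ‖G‖ := by
  refine abs_le_of_sq_le_sq' ?_ (by positivity) |>.2
  rw [mul_pow, PiLp.norm_sq_eq_of_L2, PiLp.norm_sq_eq_of_L2, Finset.mul_sum]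
  refine Finset.sum_le_sum fun j _ => ?_
  rw [← mul_pow]
  exact pow_le_pow_left₀ (norm_nonneg _) (h j) 2

/-- A bounded map of kernels that maps weak derivatives to weak derivatives bounds the gradient
norm of the image. -/
theorem gradN_le_of_map {v w : Fin 3 → E3 × E3} {K L : Kernel} {F : Kernel → Kernel} {c : ℝ}
    (hc : 0 ≤ c) (hF : ∀ G, ‖F G‖ ≤ c * ‖G‖)
    (h : ∀ j G, IsWeakDeriv (v j) K (G : Kernel) → IsWeakDeriv (w j) L (F G))
    {G : PiLp 2 fun _ : Fin 3 => Kernel} (hG : ∀ j, IsWeakDeriv (v j) K (G j)) :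
    gradN w L ≤ ENNReal.ofReal (c * ‖G‖) :=
  iInf₂_le_of_le (WithLp.toLp 2 fun j => F (G j)) (fun j => h j _ (hG j))
    (ENNReal.ofReal_le_ofReal (norm_toLp_le hc fun j => hF (G j)))

theorem gradN_zero (v : Fin 3 → E3 × E3) : gradN v 0 = 0 := by
  refine le_antisymm (iInf₂_le_of_le 0 (fun j => isWeakDeriv_zero _) ?_) bot_le
  rw [norm_zero, ENNReal.ofReal_zero]

theorem gradN_add_le (v : Fin 3 → E3 × E3) (K L : Kernel) :
    gradN v (K + L) ≤ gradN v K + gradN v L := by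
  conv_rhs => simp only [gradN, ENNReal.iInf_add, ENNReal.add_iInf]
  refine le_iInf₂ fun H hH => le_iInf₂ fun G hG => ?_
  rw [← ENNReal.ofReal_add (norm_nonneg _) (norm_nonneg _)]
  exact iInf₂_le_of_le (G + H) (fun j => (hG j).add (hH j))
    (ENNReal.ofReal_le_ofReal (norm_add_le _ _))

/-- Composition with a bounded operator on the right commutes with translations of the first
variable. -/
theorem gradN_rmul_le (K : Kernel) (A : Op) :
    gradN dir₁ (rmul K A) ≤ ENNReal.ofReal ‖A‖ * gradN dir₁ K := by
  by_cases hA : A = 0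
  -- here the right-hand side vanishes even if `K` has no gradient in `L²`
  · rw [hA, map_zero, gradN_zero]
    exact bot_le
  have h0 : ENNReal.ofReal ‖A‖ ≠ 0 := by
    rw [Ne, ENNReal.ofReal_eq_zero, not_le]
    exact norm_pos_iff.2 hA
  conv_rhs => simp only [gradN, ENNReal.mul_iInf_of_ne h0 ENNReal.ofReal_ne_top]
  refine le_iInf₂ fun G hG => ?_
  rw [← ENNReal.ofReal_mul (norm_nonneg _)]
  refine gradN_le_of_map (norm_nonneg A) (F := fun G => rmul G A) (fun G => ?_)
    (fun j G h => h.rmul A) hG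
  rw [mul_comm]
  exact norm_rmul_le G A

theorem gradN_star (v : Fin 3 → E3 × E3) (K : Kernel) : gradN v (star K) = gradN v K := by
  have h : ∀ K : Kernel, gradN v (star K) ≤ gradN v K := fun K => le_iInf₂ fun G hG => by
    refine (gradN_le_of_map zero_le_one (fun G => ?_) (fun j G h => h.star) hG).trans_eq
      (by rw [one_mul])
    rw [one_mul, norm_star_Lp]
  refine le_antisymm (h K) ?_
  simpa only [star_star] using h (star K)

theorem gradN_dir₂ (K : Kernel) : gradN dir₂ K = gradN dir₁ (transp K) := by
  have h : ∀ (v : Fin 3 → E3 × E3) (K : Kernel),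
      gradN (fun j => (v j).swap) (transp K) ≤ gradN v K := fun v K => le_iInf₂ fun G hG => by
    refine (gradN_le_of_map zero_le_one (fun G => ?_) (fun j G h => h.transp) hG).trans_eq
      (by rw [one_mul])
    rw [one_mul, LinearIsometry.norm_map]
  refine le_antisymm ?_ (h dir₂ K)
  have := h dir₁ (transp K)
  rw [transp_transp] at this
  exact this

/-! ### Symmetry of the kernels of `p`, `r` and their derivatives -/

theorem star_rmul_kop (K L : Kernel) : star (rmul K (kop L)) = rmul (star K) (kop (star L)) := by
  refine kop_injective (ContinuousLinearMap.ext fun f => ?_)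
  rw [← star_star f, kop_star, kop_rmul, kop_rmul, mul_apply_eq_comp, mul_apply_eq_comp, kop_star,
    kop_star]

theorem transp_rmul_kop {K L : Kernel} (hK : IsSymm K) (hL : IsSymm L) :
    transp (rmul K (kop (star L))) = star (rmul L (kop (star K))) := by
  rw [← star_star (transp _)]
  congr 1
  refine kop_injective ?_
  change kop (adjK _) = _
  rw [kop_adjK, ← ContinuousLinearMap.star_eq_adjoint, kop_rmul, kop_rmul, star_mul,
    star_kop_eq hK, ← star_kop_eq hL, star_star]

theorem transp_kk {k : Kernel} (hk : IsSymm k) : transp (kk k) = star (kk k) :=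
  transp_rmul_kop hk hk

theorem theta_apply (k : Kernel) (u : L2Sum) : theta k u =
    WithLp.toLp 2 (ch k u.fst + sh k u.snd, sh (star k) u.fst + ch (star k) u.snd) := rfl

theorem star_theta {k : Kernel} (hk : IsSymm k) : star (theta k) = theta k := by
  have h : ∀ (H : Type) [NormedAddCommGroup H] [InnerProductSpace ℂ H] [CompleteSpace H]
      (K : H →L[ℂ] H), star K = K → star (NormedSpace.exp K) = NormedSpace.exp K := by
    intro H _ _ _ K hK
    let _ : NormedAlgebra ℚ (H →L[ℂ] H) := NormedAlgebra.restrictScalars ℚ ℂ _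
    rw [NormedSpace.star_exp, hK]
  rw [theta_eq_exp]
  exact h _ _ (star_genK hk)

theorem star_ch {k : Kernel} (hk : IsSymm k) : star (ch k) = ch k := by
  have h := star_theta hk
  rw [theta, star_blockOp] at h
  ext1 f
  have := congrArg (fun A : L2Sum →L[ℂ] L2Sum => (A (WithLp.toLp 2 (f, 0))).fst) h
  simpa [blockOp_apply] using this

theorem star_sh {k : Kernel} (hk : IsSymm k) : star (sh k) = sh (star k) := by
  have h := star_theta hk
  rw [theta, star_blockOp] at h
  ext1 f
  have := congrArg (fun A : L2Sum →L[ℂ] L2Sum => (A (WithLp.toLp 2 (f, 0))).snd) h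
  simpa [blockOp_apply] using this

theorem sh_star {k : Kernel} (hk : IsSymm k) (f : L2) : sh (star k) (star f) = star (sh k f) := by
  have := congrArg WithLp.snd ((isBogoliubov_theta hk).1 (WithLp.toLp 2 (0, f)))
  have h0 : star (0 : L2) = 0 := by simpa using star_smul_Lp (0 : ℂ) (0 : L2)
  simpa [theta_apply, swapConj, h0] using this

theorem transp_pKer {k : Kernel} (hk : IsSymm k) : transp (pKer k) = star (pKer k) := by
  rw [← star_star (transp _)]
  congr 1
  refine kop_injective ?_
  change kop (adjK _) = _
  rw [kop_adjK, ← ContinuousLinearMap.star_eq_adjoint, kop_pKer, pOp, star_sub, star_ch hk,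
    star_one]

theorem transp_rKer {k : Kernel} (hk : IsSymm k) : transp (rKer k) = rKer k := by
  have h : transp (rKer k + k) = rKer k + k := by
    rw [← star_star (transp _), ← star_star (rKer k + k)]
    congr 1
    refine kop_injective ?_
    rw [star_star]
    change kop (adjK _) = _
    rw [kop_adjK, ← ContinuousLinearMap.star_eq_adjoint, kop_shKer, star_sh hk]
    ext1 f
    rw [← star_star f, kop_star, kop_shKer, sh_star hk]
  rw [map_add, (isSymm_iff k).1 hk] at h
  exact add_right_cancel h

/-- Symmetry is a closed linear condition, so that it passes to derivatives. -/
theorem IsSymm.of_hasDerivAt {k : ℝ → Kernel} {k' : Kernel} {t : ℝ} (hs : ∀ s, IsSymm (k s))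
    (hk : HasDerivAt k k' t) : IsSymm k' := by
  have h := (transp.toContinuousLinearMap.restrictScalars ℝ).hasFDerivAt.comp_hasDerivAt t hk
  rw [isSymm_iff]
  refine h.unique ?_
  convert! hk using 1
  funext s
  exact (isSymm_iff _).1 (hs s)

/-! ### Gradient bounds -/

theorem gradNorm_kerComp (K L : Kernel) :
    gradNorm₁ (kerComp K L) = gradN dir₁ (rmul K (kop L)) ∧
      gradNorm₂ (kerComp K L) = gradN dir₂ (rmul K (kop L)) :=
  ⟨gradNorm₁_eq (kerComp_ae K L), gradNorm₂_eq (kerComp_ae K L)⟩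

theorem gradNorm₁_coe (K : Kernel) : gradNorm₁ K = gradN dir₁ K :=
  gradNorm₁_eq Filter.EventuallyEq.rfl

theorem gradNorm₂_coe (K : Kernel) : gradNorm₂ K = gradN dir₂ K :=
  gradNorm₂_eq Filter.EventuallyEq.rfl

/-- `∇₁k` is the kernel of `∇k`. -/
theorem isWeakPartial_kop (k : Kernel) {G : E3 × E3 → EuclideanSpace ℂ (Fin 3)} (hG : MemLp G 2)
    (h : IsWeakGrad₁ k G) (f : L2) (j : Fin 3) :
    IsWeakPartial j (kop k f) fun x => ∫ y, G (x, y) j * f y := by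
  have hm := memLp_vector_iff.1 hG j
  have h1 : IsWeakDeriv (dir₁ j) k hm.toLp :=
    ((isWeakGrad₁_iff _ _).1 h j).congr Filter.EventuallyEq.rfl hm.coeFn_toLp.symm
  rw [isWeakDeriv_iff_hasDerivAt] at h1
  have h2 := (((kopL.flip f).restrictScalars ℝ).hasFDerivAt.comp_hasDerivAt (0 : ℝ) h1)
  have h3 : IsWeakDeriv (unitVec j) (kop k f) (kop hm.toLp f) := by
    rw [isWeakDeriv_iff_hasDerivAt]
    convert! h2 using 1
    funext t
    change _ = kop _ f
    rw [← kop_trans_left]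
    change _ = kop (trans (t • unitVec j, t • (0 : E3)) k) f
    rw [smul_zero]
  refine IsWeakDeriv.congr h3 Filter.EventuallyEq.rfl ?_
  filter_upwards [coeFn_kop hm.toLp f, Measure.ae_ae_of_ae_prod hm.coeFn_toLp] with x h4 h5
  rw [h4]
  refine integral_congr_ae ?_
  filter_upwards [h5] with y hy
  rw [hy]

/-- `∇₂k` is the kernel of `-k∇` on test functions. -/
theorem integral_grad₂_mul (k : Kernel) {G : E3 × E3 → EuclideanSpace ℂ (Fin 3)} (hG : MemLp G 2)
    (h : IsWeakGrad₂ k G) {f : E3 → ℂ} (hf : ContDiff ℝ ∞ f) (hc : HasCompactSupport f)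
    (j : Fin 3) :
    ∀ᵐ x : E3, ∫ y, G (x, y) j * f y = -∫ y, k (x, y) * fderiv ℝ f y (unitVec j) := by
  have hm := memLp_vector_iff.1 hG j
  have h1 : IsWeakDeriv (dir₂ j) k hm.toLp :=
    ((isWeakGrad₂_iff _ _).1 h j).congr Filter.EventuallyEq.rfl hm.coeFn_toLp.symm
  have hfm : MemLp f 2 (volume : Measure E3) := hf.continuous.memLp_of_hasCompactSupport hc
  have hd : MemLp (fun y => fderiv ℝ f y (unitVec j)) 2 (volume : Measure E3) :=
    ((hf.continuous_fderiv (by simp)).clm_apply continuous_const).memLp_of_hasCompactSupport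
      (hc.fderiv_apply ℝ _)
  have h2 : IsWeakDeriv (unitVec j) hfm.toLp hd.toLp :=
    (isWeakDeriv_fderiv hf hc _).congr hfm.coeFn_toLp.symm hd.coeFn_toLp.symm
  rw [isWeakDeriv_iff_hasDerivAt] at h1 h2
  have h3 := (((kopL.flip hfm.toLp).restrictScalars ℝ).hasFDerivAt.comp_hasDerivAt (0 : ℝ) h1)
  have h4 : HasDerivAt (fun t : ℝ => trans ((-t) • unitVec j) hfm.toLp) (-hd.toLp) 0 := by
    have h5 : HasDerivAt (fun t : ℝ => -t) (-1) (0 : ℝ) := hasDerivAt_neg 0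
    have h6 : HasDerivAt (fun t : ℝ => trans (t • unitVec j) hfm.toLp) hd.toLp (-(0 : ℝ)) := by
      rwa [neg_zero]
    have := h6.scomp (0 : ℝ) h5
    rwa [neg_one_smul] at this
  have h5 := ((kop k).restrictScalars ℝ).hasFDerivAt.comp_hasDerivAt (0 : ℝ) h4
  have h6 : kop hm.toLp hfm.toLp = -kop k hd.toLp := by
    rw [← map_neg]
    refine h3.unique ?_
    convert! h5 using 1
    funext t
    change kop (trans (t • (0 : E3), t • unitVec j) k) hfm.toLp =
      kop k (trans ((-t) • unitVec j) hfm.toLp)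
    rw [smul_zero, kop_trans_right, neg_smul]
  have h7 : (fun x => ∫ y, hm.toLp _ (x, y) * hfm.toLp _ y) =ᵐ[volume]
      fun x => -∫ y, k (x, y) * hd.toLp _ y := by
    refine (coeFn_kop hm.toLp hfm.toLp).symm.trans ?_
    rw [h6]
    filter_upwards [Lp.coeFn_neg (kop k hd.toLp), coeFn_kop k hd.toLp] with x h8 h9
    rw [h8, Pi.neg_apply, h9]
  filter_upwards [h7, Measure.ae_ae_of_ae_prod hm.coeFn_toLp] with x h8 h9
  have e1 : ∫ y, hm.toLp _ (x, y) * hfm.toLp _ y = ∫ y, G (x, y) j * f y := by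
    refine integral_congr_ae ?_
    filter_upwards [h9, hfm.coeFn_toLp] with y a b
    rw [a, b]
  have e2 : ∫ y, k (x, y) * hd.toLp _ y = ∫ y, k (x, y) * fderiv ℝ f y (unitVec j) := by
    refine integral_congr_ae ?_
    filter_upwards [hd.coeFn_toLp] with y a
    rw [a]
  rw [← e1, ← e2]
  exact h8

theorem gradN_dir₂_kk {k : Kernel} (hk : IsSymm k) : gradN dir₂ (kk k) = gradN dir₁ (kk k) := by
  rw [gradN_dir₂, transp_kk hk, gradN_star]

/-- The bounds on the gradients of the kernels of `p(k)` and `r(k)`. -/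
theorem gradient_bounds {k : Kernel} (hk : IsSymm k) (h : gradNorm₁ k < ⊤) :
    gradNorm₂ k < ⊤ ∧ gradNorm₁ (kerComp k (star k)) < ⊤ ∧ gradNorm₂ (kerComp (star k) k) < ⊤ ∧
      gradNorm₁ (kernelOf (pOp k)) ≤
        ENNReal.ofReal (Real.exp ‖k‖) * gradNorm₁ (kerComp k (star k)) ∧
      gradNorm₁ (kernelOf (rOp k)) ≤
        ENNReal.ofReal (Real.exp ‖k‖) * gradNorm₁ (kerComp k (star k)) ∧
      gradNorm₂ (kernelOf (pOp k)) ≤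
        ENNReal.ofReal (Real.exp ‖k‖) * gradNorm₂ (kerComp (star k) k) ∧
      gradNorm₂ (kernelOf (rOp k)) ≤
        ENNReal.ofReal (Real.exp ‖k‖) * gradNorm₂ (kerComp (star k) k) := by
  have h2 : rmul (star k) (kop k) = star (kk k) := by
    rw [kk, star_rmul_kop, star_star]
  rw [(gradNorm_kerComp k (star k)).1, (gradNorm_kerComp (star k) k).2, h2, gradN_star,
    ← kk, gradN_dir₂_kk hk, kernelOf_eq (kop_pKer k), kernelOf_eq (kop_rKer k),
    gradNorm₁_coe, gradNorm₁_coe, gradNorm₂_coe, gradNorm₂_coe, gradNorm₂_coe, gradN_dir₂ k,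
    gradN_dir₂ (pKer k), gradN_dir₂ (rKer k), (isSymm_iff k).1 hk, transp_pKer hk, transp_rKer hk,
    gradN_star]
  rw [gradNorm₁_coe] at h
  have hX : gradN dir₁ (kk k) < ⊤ :=
    (gradN_rmul_le _ _).trans_lt (ENNReal.mul_lt_top ENNReal.ofReal_lt_top h)
  have hp : gradN dir₁ (pKer k) ≤ ENNReal.ofReal (Real.exp ‖k‖) * gradN dir₁ (kk k) :=
    (gradN_rmul_le _ _).trans (by gcongr; exact norm_facSeries_two_le k)
  have hr : gradN dir₁ (rKer k) ≤ ENNReal.ofReal (Real.exp ‖k‖) * gradN dir₁ (kk k) :=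
    (gradN_rmul_le _ _).trans (by gcongr; exact norm_facSeries_three_mul_le k)
  exact ⟨h, hX, hX, hp, hr, hp, hr⟩

theorem gradN_deriv_le (k k' : Kernel) {A₁ A₂ : Op} {e : ℝ} (h1 : ‖A₁‖ ≤ e)
    (h2 : ‖A₂‖ ≤ ‖k'‖ * e) :
    gradN dir₁ (rmul (kkDeriv k k') A₁ + rmul (kk k) A₂) ≤ ENNReal.ofReal e *
      (ENNReal.ofReal ‖k'‖ * gradN dir₁ (kk k) + gradN dir₁ (rmul k' (kop (star k))) +
        gradN dir₁ (rmul k (kop (star k')))) := by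
  calc _ ≤ ENNReal.ofReal ‖A₁‖ * (gradN dir₁ (rmul k' (kop (star k))) +
          gradN dir₁ (rmul k (kop (star k')))) + ENNReal.ofReal ‖A₂‖ * gradN dir₁ (kk k) :=
        (gradN_add_le _ _ _).trans (add_le_add ((gradN_rmul_le _ _).trans
          (by gcongr; exact gradN_add_le _ _ _)) (gradN_rmul_le _ _))
    _ ≤ ENNReal.ofReal e * (gradN dir₁ (rmul k' (kop (star k))) +
          gradN dir₁ (rmul k (kop (star k')))) +
          ENNReal.ofReal (‖k'‖ * e) * gradN dir₁ (kk k) := by gcongr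
    _ = _ := by
        rw [ENNReal.ofReal_mul (norm_nonneg _)]
        ring

/-- The bounds on the gradients of the derivatives of the kernels of `p(k_t)` and `r(k_t)`. -/
theorem gradient_deriv_bounds {k : ℝ → Kernel} (hs : ∀ s, IsSymm (k s)) {t : ℝ} {k' : Kernel}
    (hk : HasDerivAt k k' t) :
    ∃ p' r' : Kernel,
      HasDerivAt (fun s => kernelOf (pOp (k s))) p' t ∧
      HasDerivAt (fun s => kernelOf (rOp (k s))) r' t ∧
      ‖p'‖ ≤ ‖k'‖ * Real.exp ‖k t‖ ∧
      ‖r'‖ ≤ ‖k'‖ * Real.exp ‖k t‖ ∧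
      (∀ D ∈ [p', r'],
        gradNorm₁ D ≤ ENNReal.ofReal (1 * Real.exp ‖k t‖) *
          (ENNReal.ofReal ‖k'‖ * gradNorm₁ (kerComp (k t) (star (k t))) +
            gradNorm₁ (kerComp k' (star (k t))) +
            gradNorm₁ (kerComp (k t) (star k'))) ∧
        gradNorm₂ D ≤ ENNReal.ofReal (1 * Real.exp ‖k t‖) *
          (ENNReal.ofReal ‖k'‖ * gradNorm₂ (kerComp (k t) (star (k t))) +
            gradNorm₂ (kerComp k' (star (k t))) +
            gradNorm₂ (kerComp (k t) (star k')))) := by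
  obtain ⟨A₁, A₂, hp, hp1, hp2, hp3⟩ := exists_hasDerivAt_pKer hk
  obtain ⟨B₁, B₂, hr, hr1, hr2, hr3⟩ := exists_hasDerivAt_rKer hk
  have hs' : IsSymm k' := .of_hasDerivAt hs hk
  have ep : (fun s => kernelOf (pOp (k s))) = fun s => pKer (k s) :=
    funext fun s => kernelOf_eq (kop_pKer _)
  have er : (fun s => kernelOf (rOp (k s))) = fun s => rKer (k s) :=
    funext fun s => kernelOf_eq (kop_rKer _)
  rw [ep, er]
  refine ⟨_, _, hp, hr, hp3, hr3, ?_⟩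
  set p' := rmul (kkDeriv (k t) k') A₁ + rmul (kk (k t)) A₂
  set r' := rmul (kkDeriv (k t) k') B₁ + rmul (kk (k t)) B₂
  have h₁ : ∀ D ∈ [p', r'], gradN dir₁ D ≤ ENNReal.ofReal (Real.exp ‖k t‖) *
      (ENNReal.ofReal ‖k'‖ * gradN dir₁ (kk (k t)) + gradN dir₁ (rmul k' (kop (star (k t)))) +
        gradN dir₁ (rmul (k t) (kop (star k')))) := by
    intro D hD
    simp only [List.mem_cons, List.not_mem_nil, or_false] at hD
    rcases hD with rfl | rfl
    · exact gradN_deriv_le _ _ hp1 hp2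
    · exact gradN_deriv_le _ _ hr1 hr2
  have tp : transp p' = star p' := by
    have h := (transp.toContinuousLinearMap.restrictScalars ℝ).hasFDerivAt.comp_hasDerivAt t hp
    refine h.unique ?_
    convert! hasDerivAt_star hp using 1
    funext s
    exact transp_pKer (hs s)
  have tr : transp r' = r' := by
    have h := (transp.toContinuousLinearMap.restrictScalars ℝ).hasFDerivAt.comp_hasDerivAt t hr
    refine h.unique ?_
    convert! hr using 1
    funext s
    exact transp_rKer (hs s)
  have h₂ : ∀ D ∈ [p', r'], gradN dir₂ D = gradN dir₁ D := by
    intro D hD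
    simp only [List.mem_cons, List.not_mem_nil, or_false] at hD
    rcases hD with rfl | rfl
    · rw [gradN_dir₂, tp, gradN_star]
    · rw [gradN_dir₂, tr]
  intro D hD
  rw [one_mul, gradNorm₁_coe, gradNorm₂_coe, (gradNorm_kerComp _ _).1, (gradNorm_kerComp _ _).1,
    (gradNorm_kerComp _ _).1, (gradNorm_kerComp _ _).2, (gradNorm_kerComp _ _).2,
    (gradNorm_kerComp _ _).2, h₂ D hD, ← kk, gradN_dir₂_kk (hs t), gradN_dir₂, gradN_dir₂,
    transp_rmul_kop hs' (hs t), transp_rmul_kop (hs t) hs', gradN_star, gradN_star]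
  refine ⟨h₁ D hD, ?_⟩
  have := h₁ D hD
  rwa [add_right_comm] at this

/-! ### Pair creation on a graded Hilbert space -/

/-- If `|f'| ≤ C f` then `f` grows at most exponentially, in both directions. -/
theorem le_exp_mul_of_abs_deriv_le {f f' : ℝ → ℝ} {C : ℝ} (hf : ∀ s, HasDerivAt f (f' s) s)
    (h : ∀ s, |f' s| ≤ C * f s) (s : ℝ) : f s ≤ Real.exp (C * |s|) * f 0 := by
  have key : ∀ {f f' : ℝ → ℝ}, (∀ s, HasDerivAt f (f' s) s) → (∀ s, |f' s| ≤ C * f s) →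
      ∀ s, 0 ≤ s → f s ≤ Real.exp (C * s) * f 0 := by
    intro f f' hf h s hs
    have hd : ∀ s, HasDerivAt (fun s => Real.exp (-(C * s)) * f s)
        (Real.exp (-(C * s)) * (f' s - C * f s)) s := by
      intro s
      have h1 : HasDerivAt (fun s => Real.exp (-(C * s))) (Real.exp (-(C * s)) * (-(C * 1))) s :=
        ((hasDerivAt_id s).const_mul C).neg.exp
      convert! h1.mul (hf s) using 1
      ring
    have ha : Antitone fun s => Real.exp (-(C * s)) * f s :=
      antitone_of_deriv_nonpos (fun s => (hd s).differentiableAt) fun s => by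
        rw [(hd s).deriv]
        exact mul_nonpos_of_nonneg_of_nonpos (Real.exp_pos _).le
          (by linarith [le_abs_self (f' s), h s])
    have := ha hs
    simp only [mul_zero, neg_zero, Real.exp_zero, one_mul] at this
    calc f s = Real.exp (C * s) * (Real.exp (-(C * s)) * f s) := by
          rw [← mul_assoc, ← Real.exp_add]; simp
      _ ≤ _ := by gcongr
  rcases le_total 0 s with hs | hs
  · rw [abs_of_nonneg hs]
    exact key hf h s hs
  · rw [abs_of_nonpos hs]
    have hd : ∀ s, HasDerivAt (fun s => f (-s)) (-f' (-s)) s := fun s => by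
      have := (hf (-s)).scomp s (hasDerivAt_neg s)
      simpa using! this
    have := key hd (fun s => by rw [abs_neg]; exact h (-s)) (-s) (by linarith)
    simpa using this

theorem hasDerivAt_norm_sq {H : Type*} [NormedAddCommGroup H] [InnerProductSpace ℂ H]
    {f : ℝ → H} {f' : H} {s : ℝ} (hf : HasDerivAt f f' s) :
    HasDerivAt (fun s => ‖f s‖ ^ 2) (2 * (⟪f s, f'⟫_ℂ).re) s := by
  let _ : InnerProductSpace ℝ H := InnerProductSpace.complexToReal
  exact HasDerivAt.norm_sq hf

/-- A Hilbert space graded by the orthogonal projections `Q n` onto its levels, with bounded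
operators `b n` from level `n` to level `n + 2` whose norms grow at most linearly. -/
structure LadderSystem (H : Type*) [NormedAddCommGroup H] [InnerProductSpace ℂ H]
    [CompleteSpace H] where
  /-- the projection onto level `n` -/
  Q : ℕ → H →L[ℂ] H
  /-- the operator from level `n` to level `n + 2` -/
  b : ℕ → H →L[ℂ] H
  /-- the growth rate of `‖b n‖` -/
  κ : ℝ
  κ_nonneg : 0 ≤ κ
  star_Q : ∀ n, star (Q n) = Q n
  Q_mul_Q : ∀ n m, Q n * Q m = if n = m then Q m else 0
  hasSum_Q : ∀ ψ, HasSum (fun n => Q n ψ) ψ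
  Q_mul_b : ∀ n, Q (n + 2) * b n = b n
  b_mul_Q : ∀ n, b n * Q n = b n
  norm_b_le : ∀ n, ‖b n‖ ≤ κ * (n + 1)

namespace LadderSystem

open Filter Topology Finset

variable {H : Type*} [NormedAddCommGroup H] [InnerProductSpace ℂ H] [CompleteSpace H]
  (D : LadderSystem H)

theorem Q_Q (n m : ℕ) (ψ : H) : D.Q n (D.Q m ψ) = if n = m then D.Q m ψ else 0 := by
  rw [← mul_apply_eq_comp, D.Q_mul_Q]
  split_ifs <;> rfl

theorem inner_Q (n : ℕ) (φ ψ : H) : ⟪D.Q n φ, ψ⟫_ℂ = ⟪φ, D.Q n ψ⟫_ℂ := by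
  conv_rhs => rw [← D.star_Q n, ContinuousLinearMap.star_eq_adjoint]
  rw [ContinuousLinearMap.adjoint_inner_right]

theorem inner_Q_self (n : ℕ) (ψ : H) : ⟪D.Q n ψ, ψ⟫_ℂ = (‖D.Q n ψ‖ ^ 2 : ℝ) := by
  have : D.Q n (D.Q n ψ) = D.Q n ψ := by rw [Q_Q, if_pos rfl]
  rw [← this, inner_Q, this]
  exact_mod_cast inner_self_eq_norm_sq_to_K (𝕜 := ℂ) (D.Q n ψ)

theorem hasSum_norm_sq (ψ : H) : HasSum (fun n => ‖D.Q n ψ‖ ^ 2) (‖ψ‖ ^ 2) := by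
  have h := (D.hasSum_Q ψ).mapL (innerSL ℂ ψ)
  have h2 := h.mapL Complex.reCLM
  simp only [innerSL_apply_apply, Complex.reCLM_apply] at h2
  convert! h2 using 1
  · funext n
    rw [← inner_Q, inner_Q_self, Complex.ofReal_re]
  · have := inner_self_eq_norm_sq_to_K (𝕜 := ℂ) ψ
    rw [this]
    norm_cast

theorem b_Q (n : ℕ) (ψ : H) : D.b n (D.Q n ψ) = D.b n ψ := by
  rw [← mul_apply_eq_comp, D.b_mul_Q]

theorem Q_b (n : ℕ) (ψ : H) : D.Q (n + 2) (D.b n ψ) = D.b n ψ := by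
  rw [← mul_apply_eq_comp, D.Q_mul_b]

theorem starb_Q (n : ℕ) (ψ : H) : star (D.b n) (D.Q (n + 2) ψ) = star (D.b n) ψ := by
  rw [← mul_apply_eq_comp]
  conv_lhs => rw [← D.star_Q, ← star_mul, D.Q_mul_b]

theorem Q_starb (n : ℕ) (ψ : H) : D.Q n (star (D.b n) ψ) = star (D.b n) ψ := by
  rw [← mul_apply_eq_comp]
  conv_lhs => rw [← D.star_Q, ← star_mul, D.b_mul_Q]

theorem norm_b_apply_le (n : ℕ) (ψ : H) : ‖D.b n ψ‖ ≤ D.κ * (n + 1) * ‖D.Q n ψ‖ := by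
  rw [← b_Q]
  exact (D.b n).le_of_opNorm_le (D.norm_b_le n) _

theorem norm_starb_apply_le (n : ℕ) (ψ : H) :
    ‖star (D.b n) ψ‖ ≤ D.κ * (n + 1) * ‖D.Q (n + 2) ψ‖ := by
  rw [← starb_Q]
  refine ContinuousLinearMap.le_of_opNorm_le _ ?_ _
  rw [ContinuousLinearMap.star_eq_adjoint, LinearIsometryEquiv.norm_map]
  exact D.norm_b_le n

/-- The skew-adjoint bounded operator `∑_{n < M} (b n - (b n)*)`. -/
def B (M : ℕ) : H →L[ℂ] H := ∑ n ∈ range M, (D.b n - star (D.b n))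

theorem B_apply (M : ℕ) (ψ : H) : D.B M ψ = ∑ n ∈ range M, (D.b n ψ - star (D.b n) ψ) := by
  rw [B, _root_.sum_apply]
  rfl

theorem star_B (M : ℕ) : star (D.B M) = -D.B M := by
  rw [B, star_sum, ← Finset.sum_neg_distrib]
  refine Finset.sum_congr rfl fun n _ => ?_
  rw [star_sub, star_star, neg_sub]

/-- The unitary group generated by `B M`. -/
def U (M : ℕ) (s : ℝ) : H →L[ℂ] H := NormedSpace.exp (s • D.B M)

theorem U_zero (M : ℕ) : D.U M 0 = 1 := by rw [U, zero_smul, NormedSpace.exp_zero]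

theorem U_add (M : ℕ) (s t : ℝ) : D.U M (s + t) = D.U M s * D.U M t := by
  let _ : NormedAlgebra ℚ (H →L[ℂ] H) := NormedAlgebra.restrictScalars ℚ ℂ _
  rw [U, add_smul, NormedSpace.exp_add_of_commute]
  · rfl
  · exact ((Commute.refl _).smul_left _).smul_right _

theorem star_U (M : ℕ) (s : ℝ) : star (D.U M s) = D.U M (-s) := by
  let _ : NormedAlgebra ℚ (H →L[ℂ] H) := NormedAlgebra.restrictScalars ℚ ℂ _
  rw [U, NormedSpace.star_exp, U]
  congr 1
  rw [star_smul, star_B, neg_smul, smul_neg]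
  rfl

theorem U_neg_U (M : ℕ) (s : ℝ) (ψ : H) : D.U M (-s) (D.U M s ψ) = ψ := by
  rw [← mul_apply_eq_comp, ← U_add, neg_add_cancel, U_zero, one_apply_eq_self]

theorem inner_U (M : ℕ) (s : ℝ) (φ ψ : H) : ⟪D.U M s φ, ψ⟫_ℂ = ⟪φ, D.U M (-s) ψ⟫_ℂ := by
  rw [← star_U, ContinuousLinearMap.star_eq_adjoint, ContinuousLinearMap.adjoint_inner_right]

theorem norm_U (M : ℕ) (s : ℝ) (ψ : H) : ‖D.U M s ψ‖ = ‖ψ‖ := by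
  rw [← sq_eq_sq₀ (norm_nonneg _) (norm_nonneg _)]
  have h : ⟪D.U M s ψ, D.U M s ψ⟫_ℂ = ⟪ψ, ψ⟫_ℂ := by rw [inner_U, U_neg_U]
  rw [inner_self_eq_norm_sq_to_K, inner_self_eq_norm_sq_to_K] at h
  exact_mod_cast h

theorem hasDerivAt_U_op (M : ℕ) (s : ℝ) : HasDerivAt (D.U M) (D.U M s * D.B M) s :=
  hasDerivAt_exp_smul_const (𝕂 := ℝ) (D.B M) s

theorem commute_U_B (M : ℕ) (s : ℝ) : D.U M s * D.B M = D.B M * D.U M s := by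
  let _ : NormedAlgebra ℚ (H →L[ℂ] H) := NormedAlgebra.restrictScalars ℚ ℂ _
  exact (((Commute.refl (D.B M)).smul_left s).exp_left).eq

theorem hasDerivAt_U (M : ℕ) (s : ℝ) (ψ : H) :
    HasDerivAt (fun s => D.U M s ψ) (D.B M (D.U M s ψ)) s := by
  have h := ((ContinuousLinearMap.apply ℂ H ψ).restrictScalars ℝ).hasFDerivAt.comp_hasDerivAt s
    (D.hasDerivAt_U_op M s)
  rw [commute_U_B] at h
  exact h

/-! ### Propagation of moments -/

/-- One step of the ladder only moves norm between the levels `m` and `m + 2`. -/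
theorem inner_Q_step (n m : ℕ) (φ : H) :
    (⟪D.Q n φ, D.b m φ - star (D.b m) φ⟫_ℂ).re =
      (if n = m + 2 then (⟪φ, D.b m φ⟫_ℂ).re else 0) -
        (if n = m then (⟪φ, D.b m φ⟫_ℂ).re else 0) := by
  rw [inner_sub_right, Complex.sub_re]
  congr 1
  · rw [inner_Q, ← Q_b, Q_Q]
    split_ifs <;> simp
  · rw [inner_Q, ← Q_starb, Q_Q]
    split_ifs
    · rw [Q_starb, ContinuousLinearMap.star_eq_adjoint,
        ContinuousLinearMap.adjoint_inner_right]
      exact inner_re_symm (𝕜 := ℂ) _ _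
    · simp

theorem abs_re_inner_b_le (m : ℕ) (φ : H) :
    |(⟪φ, D.b m φ⟫_ℂ).re| ≤ D.κ * (m + 1) * ((‖D.Q (m + 2) φ‖ ^ 2 + ‖D.Q m φ‖ ^ 2) / 2) := by
  have h1 : ⟪φ, D.b m φ⟫_ℂ = ⟪D.Q (m + 2) φ, D.b m φ⟫_ℂ := by rw [inner_Q, Q_b]
  have h2 : ‖⟪D.Q (m + 2) φ, D.b m φ⟫_ℂ‖ ≤ ‖D.Q (m + 2) φ‖ * (D.κ * (m + 1) * ‖D.Q m φ‖) :=
    (norm_inner_le_norm _ _).trans (by gcongr; exact D.norm_b_apply_le m φ)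
  rw [h1]
  refine (Complex.abs_re_le_norm _).trans (h2.trans ?_)
  have h3 : 0 ≤ D.κ * (m + 1) := mul_nonneg D.κ_nonneg (by positivity)
  have h4 : ‖D.Q (m + 2) φ‖ * ‖D.Q m φ‖ ≤ (‖D.Q (m + 2) φ‖ ^ 2 + ‖D.Q m φ‖ ^ 2) / 2 := by
    nlinarith [sq_nonneg (‖D.Q (m + 2) φ‖ - ‖D.Q m φ‖)]
  calc _ = D.κ * (m + 1) * (‖D.Q (m + 2) φ‖ * ‖D.Q m φ‖) := by ring
    _ ≤ _ := by gcongr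

/-- The truncated moment `∑_{n < L} w n ‖Q n φ‖²` of `φ = e^{s B_M} ψ` obeys a differential
inequality as soon as `B M` does not reach beyond level `L`. -/
theorem sum_moment_le {w : ℕ → ℝ} (hw : ∀ n, 0 ≤ w n) (hm : ∀ n, w n ≤ w (n + 2)) {c : ℝ}
    (hc0 : 0 ≤ c) (hc : ∀ n : ℕ, (w (n + 2) - w n) * (n + 1) ≤ c * w n) {M L : ℕ}
    (hL : M + 2 ≤ L) (s : ℝ) (ψ : H) :
    ∑ n ∈ range L, w n * ‖D.Q n (D.U M s ψ)‖ ^ 2 ≤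
      Real.exp (2 * D.κ * c * |s|) * ∑ n ∈ range L, w n * ‖D.Q n ψ‖ ^ 2 := by
  set F : ℝ → ℝ := fun s => ∑ n ∈ range L, w n * ‖D.Q n (D.U M s ψ)‖ ^ 2 with hF
  -- a step `m → m + 2` changes the sum by `w (m + 2) - w m` only; by `M + 2 ≤ L` both of its levels
  -- are in the range
  have hd : ∀ s, HasDerivAt F (∑ m ∈ range M, 2 * (w (m + 2) - w m) *
      (⟪D.U M s ψ, D.b m (D.U M s ψ)⟫_ℂ).re) s := by
    intro s
    set φ := D.U M s ψ
    have h1 : ∀ n, HasDerivAt (fun s => ‖D.Q n (D.U M s ψ)‖ ^ 2)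
        (2 * (⟪D.Q n φ, D.B M φ⟫_ℂ).re) s := by
      intro n
      have h0 : HasDerivAt (fun s => D.Q n (D.U M s ψ)) (D.Q n (D.B M φ)) s :=
        ((D.Q n).restrictScalars ℝ).hasFDerivAt.comp_hasDerivAt s (D.hasDerivAt_U M s ψ)
      convert! hasDerivAt_norm_sq h0 using 1
      change _ = 2 * (⟪D.Q n φ, D.Q n (D.B M φ)⟫_ℂ).re
      rw [← inner_Q, Q_Q, if_pos rfl]
    have h2 := HasDerivAt.fun_sum fun n (_ : n ∈ range L) => (h1 n).const_mul (w n)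
    convert! h2 using 1
    simp only [B_apply, inner_sum, Complex.re_sum, inner_Q_step]
    simp only [Finset.mul_sum]
    rw [Finset.sum_comm]
    refine Finset.sum_congr rfl fun m hmM => ?_
    have hm1 : m + 2 ∈ range L := by rw [Finset.mem_range] at hmM ⊢; omega
    have hm2 : m ∈ range L := by rw [Finset.mem_range] at hmM ⊢; omega
    simp only [mul_sub, Finset.sum_sub_distrib, mul_ite, mul_zero]
    rw [Finset.sum_ite_eq' (range L) (m + 2), Finset.sum_ite_eq' (range L) m, if_pos hm1,
      if_pos hm2]
    ring
  have hb : ∀ s, |∑ m ∈ range M, 2 * (w (m + 2) - w m) *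
      (⟪D.U M s ψ, D.b m (D.U M s ψ)⟫_ℂ).re| ≤ 2 * D.κ * c * F s := by
    intro s
    set φ := D.U M s ψ
    have h1 : ∑ m ∈ range M, w m * ‖D.Q m φ‖ ^ 2 ≤ F s :=
      Finset.sum_le_sum_of_subset_of_nonneg (Finset.range_mono (by omega))
        fun n _ _ => mul_nonneg (hw n) (by positivity)
    have h2 : ∑ m ∈ range M, w (m + 2) * ‖D.Q (m + 2) φ‖ ^ 2 ≤ F s := by
      rw [← Finset.sum_image (s := range M) (g := fun m => m + 2)
        (f := fun n => w n * ‖D.Q n φ‖ ^ 2) (by intro a _ b _ h; simpa using h)]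
      refine Finset.sum_le_sum_of_subset_of_nonneg ?_
        fun n _ _ => mul_nonneg (hw n) (by positivity)
      intro n hn
      simp only [Finset.mem_image, Finset.mem_range] at hn ⊢
      omega
    have hκ := D.κ_nonneg
    calc _ ≤ ∑ m ∈ range M, D.κ * c * (w (m + 2) * ‖D.Q (m + 2) φ‖ ^ 2 +
          w m * ‖D.Q m φ‖ ^ 2) := by
          refine (Finset.abs_sum_le_sum_abs _ _).trans (Finset.sum_le_sum fun m _ => ?_)
          have e0 : 0 ≤ w (m + 2) - w m := sub_nonneg.2 (hm m)
          rw [abs_mul, abs_of_nonneg (by positivity)]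
          calc _ ≤ 2 * (w (m + 2) - w m) *
                (D.κ * (m + 1) * ((‖D.Q (m + 2) φ‖ ^ 2 + ‖D.Q m φ‖ ^ 2) / 2)) := by
                gcongr
                exact D.abs_re_inner_b_le m φ
            _ = D.κ * ((w (m + 2) - w m) * (m + 1)) * (‖D.Q (m + 2) φ‖ ^ 2 + ‖D.Q m φ‖ ^ 2) := by
                ring
            _ ≤ D.κ * (c * w m) * (‖D.Q (m + 2) φ‖ ^ 2 + ‖D.Q m φ‖ ^ 2) :=
                mul_le_mul_of_nonneg_right (mul_le_mul_of_nonneg_left (hc m) hκ) (by positivity)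
            _ = D.κ * c * (w m * ‖D.Q (m + 2) φ‖ ^ 2 + w m * ‖D.Q m φ‖ ^ 2) := by ring
            _ ≤ _ := by
                gcongr
                exact hm m
      _ = D.κ * c * (∑ m ∈ range M, w (m + 2) * ‖D.Q (m + 2) φ‖ ^ 2 +
          ∑ m ∈ range M, w m * ‖D.Q m φ‖ ^ 2) := by
          rw [← Finset.mul_sum, Finset.sum_add_distrib]
      _ ≤ D.κ * c * (F s + F s) := by gcongr
      _ = _ := by ring
  have := le_exp_mul_of_abs_deriv_le hd hb s
  simpa only [hF, U_zero, one_apply_eq_self] using this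

/-- Moments are propagated by `e^{s B_M}`, uniformly in `M`. -/
theorem moment_le {w : ℕ → ℝ} (hw : ∀ n, 0 ≤ w n) (hm : ∀ n, w n ≤ w (n + 2)) {c : ℝ}
    (hc0 : 0 ≤ c) (hc : ∀ n : ℕ, (w (n + 2) - w n) * (n + 1) ≤ c * w n) {ψ : H}
    (hψ : Summable fun n => w n * ‖D.Q n ψ‖ ^ 2) (M L : ℕ) (s : ℝ) :
    ∑ n ∈ range L, w n * ‖D.Q n (D.U M s ψ)‖ ^ 2 ≤
      Real.exp (2 * D.κ * c * |s|) * ∑' n, w n * ‖D.Q n ψ‖ ^ 2 := by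
  have hp : ∀ (φ : H) n, 0 ≤ w n * ‖D.Q n φ‖ ^ 2 := fun φ n => mul_nonneg (hw n) (by positivity)
  calc _ ≤ ∑ n ∈ range (max L (M + 2)), w n * ‖D.Q n (D.U M s ψ)‖ ^ 2 :=
        Finset.sum_le_sum_of_subset_of_nonneg (Finset.range_mono (le_max_left _ _))
          fun n _ _ => hp _ n
    _ ≤ _ := D.sum_moment_le hw hm hc0 hc (le_max_right _ _) s ψ
    _ ≤ _ := by
        gcongr
        exact hψ.sum_le_tsum _ fun n _ => hp _ n

/-- The discrete derivative of the weight `(n + 1)ᵐ`, multiplied by the growth `n + 1` of `‖b n‖`,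
is bounded by the weight. -/
theorem exists_weight_const (m : ℕ) : ∃ c : ℝ, 0 ≤ c ∧
    ∀ n : ℕ, ((((n + 2 : ℕ) : ℝ) + 1) ^ m - ((n : ℝ) + 1) ^ m) * (n + 1) ≤ c * ((n : ℝ) + 1) ^ m := by
  induction m with
  | zero => exact ⟨0, le_rfl, fun n => by simp⟩
  | succ m ih =>
    obtain ⟨c, hc, h⟩ := ih
    refine ⟨3 * c + 2, by positivity, fun n => ?_⟩
    have h1 := h n
    have e1 : (((n + 2 : ℕ) : ℝ) + 1) = n + 3 := by push_cast; ring
    rw [e1] at h1 ⊢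
    have h0 : (0 : ℝ) ≤ n := n.cast_nonneg
    have hx : (0 : ℝ) ≤ ((n : ℝ) + 1) ^ m := by positivity
    calc (((n : ℝ) + 3) ^ (m + 1) - ((n : ℝ) + 1) ^ (m + 1)) * (n + 1)
        = (n + 3) * (((n + 3 : ℝ) ^ m - ((n : ℝ) + 1) ^ m) * (n + 1)) +
          2 * ((n : ℝ) + 1) ^ m * (n + 1) := by ring
      _ ≤ (n + 3) * (c * ((n : ℝ) + 1) ^ m) + 2 * ((n : ℝ) + 1) ^ m * (n + 1) := by gcongr
      _ ≤ (3 * (n + 1)) * (c * ((n : ℝ) + 1) ^ m) + 2 * ((n : ℝ) + 1) ^ m * (n + 1) := by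
          gcongr
          linarith
      _ = _ := by ring

/-- The vectors with finitely many nonzero components. -/
def IsFin (ψ : H) : Prop := ∃ L, ∀ n, L ≤ n → D.Q n ψ = 0

/-- Every component of `e^{s B_M} ψ` decays faster than any power of the level, uniformly in `M`
and locally uniformly in `s`, if `ψ` has finitely many components. -/
theorem exists_decay {ψ : H} (hψ : D.IsFin ψ) (p : ℕ) (R : ℝ) :
    ∃ C : ℝ, 0 ≤ C ∧ ∀ M s, |s| ≤ R → ∀ n : ℕ, ‖D.Q n (D.U M s ψ)‖ ≤ C / ((n : ℝ) + 1) ^ p := by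
  obtain ⟨L, hL⟩ := hψ
  -- a single level is bounded by the moment of order `2 * p`
  obtain ⟨c, hc0, hc⟩ := exists_weight_const (2 * p)
  have hs : Summable fun n : ℕ => ((n : ℝ) + 1) ^ (2 * p) * ‖D.Q n ψ‖ ^ 2 :=
    summable_of_ne_finset_zero (s := range L) fun n hn => by
      rw [hL n (by simpa using hn)]
      simp
  set K := Real.exp (2 * D.κ * c * R) * ∑' n : ℕ, ((n : ℝ) + 1) ^ (2 * p) * ‖D.Q n ψ‖ ^ 2
  refine ⟨√K, Real.sqrt_nonneg _, fun M s hsR n => ?_⟩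
  rw [le_div_iff₀ (by positivity)]
  refine Real.le_sqrt_of_sq_le ?_
  have h := D.moment_le (w := fun n => ((n : ℝ) + 1) ^ (2 * p)) (fun n => by positivity)
    (fun n => by push_cast; gcongr; linarith) hc0 hc hs M (n + 1) s
  have hκ := D.κ_nonneg
  calc (‖D.Q n (D.U M s ψ)‖ * ((n : ℝ) + 1) ^ p) ^ 2
      = ((n : ℝ) + 1) ^ (2 * p) * ‖D.Q n (D.U M s ψ)‖ ^ 2 := by ring
    _ ≤ ∑ n ∈ range (n + 1), ((n : ℝ) + 1) ^ (2 * p) * ‖D.Q n (D.U M s ψ)‖ ^ 2 :=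
        Finset.single_le_sum (f := fun n : ℕ => ((n : ℝ) + 1) ^ (2 * p) * ‖D.Q n (D.U M s ψ)‖ ^ 2)
          (fun n _ => by positivity) (by simp)
    _ ≤ _ := h
    _ ≤ K := by
        refine mul_le_mul_of_nonneg_right ?_ (tsum_nonneg fun n => by positivity)
        gcongr

end LadderSystem

/-! ### The unitary group generated by a ladder system -/

theorem norm_sub_le_of_deriv_le {E : Type*} [NormedAddCommGroup E] [NormedSpace ℝ E] {f f' : ℝ → E}
    {C s : ℝ} (hf : ∀ r, HasDerivAt f (f' r) r) (hb : ∀ r, |r| ≤ |s| → ‖f' r‖ ≤ C) :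
    ‖f s - f 0‖ ≤ |s| * C := by
  have h := Convex.norm_image_sub_le_of_norm_hasDerivWithin_le (s := Set.Icc (-|s|) |s|)
    (fun r _ => (hf r).hasDerivWithinAt) (fun r hr => hb r (abs_le.2 hr)) (convex_Icc _ _)
    (x := 0) (y := s) ⟨by simp, abs_nonneg _⟩ ⟨neg_abs_le s, le_abs_self s⟩
  rwa [sub_zero, Real.norm_eq_abs, mul_comm] at h

namespace LadderSystem

open Filter Topology Finset

variable {H : Type*} [NormedAddCommGroup H] [InnerProductSpace ℂ H] [CompleteSpace H]
  (D : LadderSystem H)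

theorem norm_step_apply_le (n : ℕ) (φ : H) :
    ‖D.b n φ - star (D.b n) φ‖ ≤ D.κ * (n + 1) * (‖D.Q n φ‖ + ‖D.Q (n + 2) φ‖) := by
  rw [mul_add]
  exact (norm_sub_le _ _).trans (add_le_add (D.norm_b_apply_le n φ) (D.norm_starb_apply_le n φ))

theorem B_sub_apply {M M' : ℕ} (h : M ≤ M') (φ : H) :
    (D.B M' - D.B M) φ = ∑ n ∈ Ico M M', (D.b n φ - star (D.b n) φ) := by
  rw [sub_apply, B_apply, B_apply, Finset.sum_Ico_eq_sub _ h]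

/-- Duhamel's formula, as an estimate. -/
theorem norm_U_sub_U_le {M M' : ℕ} {s C : ℝ} {ψ : H}
    (h : ∀ r, |r| ≤ |s| → ‖(D.B M' - D.B M) (D.U M r ψ)‖ ≤ C) :
    ‖D.U M' s ψ - D.U M s ψ‖ ≤ |s| * C := by
  have hd : ∀ r, HasDerivAt (fun r => D.U M' (-r) * D.U M r)
      (D.U M' (-r) * ((D.B M - D.B M') * D.U M r)) r := by
    intro r
    have h1 : HasDerivAt (fun r => D.U M' (-r)) (-(D.U M' (-r) * D.B M')) r := by
      have := (D.hasDerivAt_U_op M' (-r)).scomp r (hasDerivAt_neg r)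
      rwa [neg_one_smul] at this
    convert! h1.mul (D.hasDerivAt_U_op M r) using 1
    rw [D.commute_U_B M r]
    noncomm_ring
  have hd2 : ∀ r, HasDerivAt (fun r => D.U M' (-r) (D.U M r ψ))
      (-(D.U M' (-r) ((D.B M' - D.B M) (D.U M r ψ)))) r := by
    intro r
    have := ((ContinuousLinearMap.apply ℂ H ψ).restrictScalars ℝ).hasFDerivAt.comp_hasDerivAt r
      (hd r)
    convert! this using 1
    change _ = D.U M' (-r) ((D.B M - D.B M') (D.U M r ψ))
    rw [← map_neg, sub_apply, sub_apply, neg_sub]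
  have h1 := norm_sub_le_of_deriv_le (s := s) hd2 fun r hr => by
    rw [norm_neg, norm_U]
    exact h r hr
  simp only [neg_zero, U_zero, one_apply_eq_self] at h1
  rw [← D.norm_U M' s, map_sub] at h1
  have h2 : D.U M' s (D.U M' (-s) (D.U M s ψ)) = D.U M s ψ := by
    conv_lhs => rw [← neg_neg s, neg_neg (-s)]
    have := D.U_neg_U M' (-s) (D.U M s ψ)
    rwa [neg_neg] at this ⊢
  rw [h2, norm_sub_rev] at h1
  exact h1

/-- The projection onto the levels below `L`. -/
def P (L : ℕ) : H →L[ℂ] H := ∑ n ∈ range L, D.Q n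

theorem P_apply (L : ℕ) (ψ : H) : D.P L ψ = ∑ n ∈ range L, D.Q n ψ := by
  rw [P, _root_.sum_apply]

theorem tendsto_P (ψ : H) : Tendsto (fun L => D.P L ψ) atTop (𝓝 ψ) := by
  simp only [P_apply]
  exact (D.hasSum_Q ψ).tendsto_sum_nat

theorem Q_P {L n : ℕ} (h : L ≤ n) (ψ : H) : D.Q n (D.P L ψ) = 0 := by
  rw [P_apply, map_sum]
  refine Finset.sum_eq_zero fun m hm => ?_
  rw [Q_Q, if_neg]
  rw [Finset.mem_range] at hm
  omega

theorem isFin_P (L : ℕ) (ψ : H) : D.IsFin (D.P L ψ) := ⟨L, fun _ h => D.Q_P h ψ⟩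

theorem summable_inv_sq : Summable fun n : ℕ => 1 / ((n : ℝ) + 1) ^ 2 := by
  have := (summable_nat_add_iff 1).2 (Real.summable_one_div_nat_pow.2 one_lt_two)
  simpa using this

/-- By Duhamel's formula two truncations differ by the action of `B M' - B M` on the orbit, which
only sees the levels from `M` on; there the orbit is small by `exists_decay`. -/
theorem cauchySeq_U_of_isFin {ψ : H} (hψ : D.IsFin ψ) (s : ℝ) :
    CauchySeq fun M => D.U M s ψ := by
  -- decay of order 3 beats the linear growth of the steps and leaves a summable `1 / (n + 1) ^ 2`
  obtain ⟨C, hC0, hC⟩ := D.exists_decay hψ 3 |s|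
  have hκ := D.κ_nonneg
  set a : ℕ → ℝ := fun n => 2 * D.κ * C * (1 / ((n : ℝ) + 1) ^ 2) with ha
  have ha0 : ∀ n, 0 ≤ a n := fun n => by positivity
  have has : Summable a := summable_inv_sq.mul_left _
  refine cauchySeq_of_le_tendsto_0' (fun M => |s| * ∑' n, a (n + M)) (fun M M' h => ?_) ?_
  · rw [dist_comm, dist_eq_norm]
    refine D.norm_U_sub_U_le fun r hr => ?_
    rw [D.B_sub_apply h]
    calc _ ≤ ∑ n ∈ Ico M M', a n := by
          refine norm_sum_le_of_le _ fun n _ => (D.norm_step_apply_le n _).trans ?_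
          have h1 := hC M r hr n
          have h2 := hC M r hr (n + 2)
          have h3 : C / (((n + 2 : ℕ) : ℝ) + 1) ^ 3 ≤ C / ((n : ℝ) + 1) ^ 3 := by
            gcongr
            linarith
          calc _ ≤ D.κ * (n + 1) * (C / ((n : ℝ) + 1) ^ 3 + C / ((n : ℝ) + 1) ^ 3) := by
                gcongr
                exact h2.trans h3
            _ = a n := by
                simp only [ha]
                field_simp
                ring
      _ = ∑ i ∈ range (M' - M), a (i + M) := by
          rw [Finset.sum_Ico_eq_sum_range]
          exact Finset.sum_congr rfl fun i _ => by rw [add_comm]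
      _ ≤ ∑' n, a (n + M) := ((summable_nat_add_iff M).2 has).sum_le_tsum _ fun n _ => ha0 _
  · have := (tendsto_sum_nat_add a).const_mul |s|
    rwa [mul_zero] at this

theorem cauchySeq_U (s : ℝ) (ψ : H) : CauchySeq fun M => D.U M s ψ := by
  rw [Metric.cauchySeq_iff]
  intro ε hε
  obtain ⟨L, hL⟩ := ((Metric.tendsto_nhds.1 (D.tendsto_P ψ)) (ε / 3) (by positivity)).exists
  obtain ⟨N, hN⟩ := Metric.cauchySeq_iff.1 (D.cauchySeq_U_of_isFin (D.isFin_P L ψ) s) (ε / 3)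
    (by positivity)
  refine ⟨N, fun m hm n hn => ?_⟩
  have h1 : ∀ M, dist (D.U M s ψ) (D.U M s (D.P L ψ)) < ε / 3 := fun M => by
    rwa [dist_eq_norm, ← map_sub, norm_U, ← dist_eq_norm, dist_comm]
  have h2 := dist_triangle4 (D.U m s ψ) (D.U m s (D.P L ψ)) (D.U n s (D.P L ψ)) (D.U n s ψ)
  have h3 := h1 n
  rw [dist_comm] at h3
  linarith [h1 m, hN m hm n hn]

/-- The strong limit of the groups generated by the truncations. -/
def expB (s : ℝ) : H →L[ℂ] H :=
  continuousLinearMapOfTendsto (fun M => D.U M s) (f := fun ψ =>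
    (cauchySeq_tendsto_of_complete (D.cauchySeq_U s ψ)).choose)
    (tendsto_pi_nhds.2 fun ψ => (cauchySeq_tendsto_of_complete (D.cauchySeq_U s ψ)).choose_spec)

theorem tendsto_U (s : ℝ) (ψ : H) : Tendsto (fun M => D.U M s ψ) atTop (𝓝 (D.expB s ψ)) :=
  (cauchySeq_tendsto_of_complete (D.cauchySeq_U s ψ)).choose_spec

theorem norm_expB (s : ℝ) (ψ : H) : ‖D.expB s ψ‖ = ‖ψ‖ := by
  refine tendsto_nhds_unique (D.tendsto_U s ψ).norm ?_
  simp only [norm_U]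
  exact tendsto_const_nhds

theorem expB_zero : D.expB 0 = 1 := by
  ext1 ψ
  refine tendsto_nhds_unique (D.tendsto_U 0 ψ) ?_
  simp only [U_zero]
  exact tendsto_const_nhds

theorem tendsto_U_comp {s : ℝ} {φ : ℕ → H} {φ₀ : H} (h : Tendsto φ atTop (𝓝 φ₀)) :
    Tendsto (fun M => D.U M s (φ M)) atTop (𝓝 (D.expB s φ₀)) := by
  have h1 : Tendsto (fun M => D.U M s (φ M) - D.U M s φ₀) atTop (𝓝 0) := by
    rw [tendsto_zero_iff_norm_tendsto_zero]
    simp only [← map_sub, norm_U]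
    exact tendsto_iff_norm_sub_tendsto_zero.1 h
  have := h1.add (D.tendsto_U s φ₀)
  simpa using this

theorem expB_add (s t : ℝ) : D.expB (s + t) = D.expB s * D.expB t := by
  ext1 ψ
  refine tendsto_nhds_unique (D.tendsto_U (s + t) ψ) ?_
  simp only [U_add]
  exact D.tendsto_U_comp (D.tendsto_U t ψ)

theorem star_expB (s : ℝ) : star (D.expB s) = D.expB (-s) := by
  ext1 ψ
  refine ext_inner_left ℂ fun φ => ?_
  rw [ContinuousLinearMap.star_eq_adjoint, ContinuousLinearMap.adjoint_inner_right]
  have h1 := (D.tendsto_U s φ).inner (𝕜 := ℂ) (tendsto_const_nhds (x := ψ))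
  simp only [inner_U] at h1
  exact tendsto_nhds_unique h1 (tendsto_const_nhds.inner (D.tendsto_U (-s) ψ))

/-- The graph of `∑ n, (b n - (b n)*)` on the vectors with finitely many nonzero components. -/
def graphB : Set (H × H) := {q | D.IsFin q.1 ∧ ∀ᶠ M in atTop, D.B M q.1 = q.2}

theorem B_eq_of_le {L M : ℕ} (hM : L ≤ M) {ψ : H} (h : ∀ n, L ≤ n → D.Q n ψ = 0) :
    D.B M ψ = D.B L ψ := by
  rw [← sub_eq_zero, ← sub_apply, D.B_sub_apply hM]
  refine Finset.sum_eq_zero fun n hn => ?_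
  rw [Finset.mem_Ico] at hn
  rw [← b_Q, ← starb_Q, h n hn.1, h (n + 2) (by omega), map_zero, map_zero, sub_zero]

theorem mem_graphB {L : ℕ} {ψ : H} (h : ∀ n, L ≤ n → D.Q n ψ = 0) : (ψ, D.B L ψ) ∈ D.graphB :=
  ⟨⟨L, h⟩, (eventually_ge_atTop L).mono fun _ hM => D.B_eq_of_le hM h⟩

theorem exists_mem_graphB {ψ : H} (h : D.IsFin ψ) : ∃ φ, (ψ, φ) ∈ D.graphB := by
  obtain ⟨L, hL⟩ := h
  exact ⟨_, D.mem_graphB hL⟩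

theorem isFin_B (M : ℕ) (ψ : H) : D.IsFin (D.B M ψ) := by
  refine ⟨M + 2, fun n hn => ?_⟩
  rw [B_apply, map_sum]
  refine Finset.sum_eq_zero fun m hm => ?_
  rw [Finset.mem_range] at hm
  rw [map_sub, ← Q_b, ← Q_starb, Q_Q, Q_Q, if_neg (by omega), if_neg (by omega), sub_zero]

theorem isFin_add {ψ φ : H} (h : D.IsFin ψ) (h' : D.IsFin φ) : D.IsFin (ψ + φ) := by
  obtain ⟨L, hL⟩ := h
  obtain ⟨L', hL'⟩ := h'
  refine ⟨max L L', fun n hn => ?_⟩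
  rw [map_add, hL n (le_trans (le_max_left _ _) hn), hL' n (le_trans (le_max_right _ _) hn),
    add_zero]

theorem graphB_add {q q' : H × H} (h : q ∈ D.graphB) (h' : q' ∈ D.graphB) : q + q' ∈ D.graphB := by
  refine ⟨D.isFin_add h.1 h'.1, ?_⟩
  filter_upwards [h.2, h'.2] with M h1 h2
  rw [Prod.fst_add, map_add, h1, h2, Prod.snd_add]

theorem graphB_smul (c : ℂ) {q : H × H} (h : q ∈ D.graphB) : c • q ∈ D.graphB := by
  obtain ⟨L, hL⟩ := h.1
  refine ⟨⟨L, fun n hn => by rw [Prod.smul_fst, map_smul, hL n hn, smul_zero]⟩, ?_⟩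
  filter_upwards [h.2] with M h1
  rw [Prod.smul_fst, map_smul, h1, Prod.smul_snd]

theorem norm_U_sub_le (M : ℕ) (s : ℝ) (ψ : H) : ‖D.U M s ψ - ψ‖ ≤ |s| * ‖D.B M ψ‖ := by
  have := norm_sub_le_of_deriv_le (s := s) (fun r => D.hasDerivAt_U M r ψ) fun r _ => by
    rw [← mul_apply_eq_comp, ← commute_U_B, mul_apply_eq_comp, norm_U]
  simpa only [U_zero, one_apply_eq_self] using this

theorem norm_U_sub_sub_le (M : ℕ) (s : ℝ) (ψ : H) :
    ‖D.U M s ψ - ψ - s • D.B M ψ‖ ≤ |s| * (|s| * ‖D.B M (D.B M ψ)‖) := by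
  have hd : ∀ r, HasDerivAt (fun r : ℝ => D.U M r ψ - r • D.B M ψ)
      (D.U M r (D.B M ψ) - D.B M ψ) r := by
    intro r
    have h1 := D.hasDerivAt_U M r ψ
    rw [← mul_apply_eq_comp, ← commute_U_B, mul_apply_eq_comp] at h1
    convert! h1.sub ((hasDerivAt_id r).smul_const (D.B M ψ)) using 1
    rw [one_smul]
  have := norm_sub_le_of_deriv_le (s := s) (C := |s| * ‖D.B M (D.B M ψ)‖) hd fun r hr => by
    refine (D.norm_U_sub_le M r _).trans ?_
    gcongr
  simp only [U_zero, one_apply_eq_self, zero_smul, sub_zero] at this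
  rwa [sub_right_comm]

theorem norm_expB_sub_le {ψ φ : H} (h : (ψ, φ) ∈ D.graphB) (s : ℝ) :
    ‖D.expB s ψ - ψ‖ ≤ |s| * ‖φ‖ := by
  refine le_of_tendsto ((D.tendsto_U s ψ).sub_const ψ).norm ?_
  filter_upwards [h.2] with M hM
  rw [← hM]
  exact D.norm_U_sub_le M s ψ

theorem hasDerivAt_expB_zero {ψ φ : H} (h : (ψ, φ) ∈ D.graphB) :
    HasDerivAt (fun s => D.expB s ψ) φ 0 := by
  obtain ⟨M₀, hM₀⟩ := h.2.exists
  have hφ : D.IsFin φ := by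
    have := D.isFin_B M₀ ψ
    rwa [hM₀] at this
  obtain ⟨χ, hχ⟩ := D.exists_mem_graphB hφ
  have hb : ∀ s : ℝ, ‖D.expB s ψ - ψ - s • φ‖ ≤ ‖χ‖ * ‖s ^ 2‖ := by
    intro s
    refine le_of_tendsto (((D.tendsto_U s ψ).sub_const ψ).sub_const (s • φ)).norm ?_
    filter_upwards [h.2, hχ.2] with M h1 h2
    have := D.norm_U_sub_sub_le M s ψ
    change D.B M ψ = φ at h1
    change D.B M φ = χ at h2
    rw [h1, h2] at this
    refine this.trans_eq ?_
    rw [norm_pow, Real.norm_eq_abs]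
    ring
  rw [hasDerivAt_iff_isLittleO_nhds_zero]
  simp only [zero_add, expB_zero, one_apply_eq_self]
  exact (Asymptotics.IsBigO.of_bound ‖χ‖ (Eventually.of_forall hb)).trans_isLittleO
    (Asymptotics.isLittleO_pow_id one_lt_two)

theorem continuous_expB (ψ : H) : Continuous fun s => D.expB s ψ := by
  have hfin : ∀ ψ, D.IsFin ψ → Continuous fun s => D.expB s ψ := by
    intro ψ hψ
    obtain ⟨φ, hφ⟩ := D.exists_mem_graphB hψ
    refine (LipschitzWith.of_dist_le_mul (K := ‖φ‖₊) fun s t => ?_).continuous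
    have h1 : D.expB s ψ = D.expB t (D.expB (s - t) ψ) := by
      rw [← mul_apply_eq_comp, ← expB_add, add_sub_cancel]
    rw [dist_eq_norm, h1, ← map_sub, norm_expB, Real.dist_eq, mul_comm]
    exact D.norm_expB_sub_le hφ _
  refine continuous_of_uniform_approx_of_continuous fun u hu => ?_
  obtain ⟨ε, hε, hu⟩ := Metric.mem_uniformity_dist.1 hu
  obtain ⟨L, hL⟩ := ((Metric.tendsto_nhds.1 (D.tendsto_P ψ)) ε hε).exists
  refine ⟨_, hfin _ (D.isFin_P L ψ), fun s => hu ?_⟩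
  rwa [dist_eq_norm, ← map_sub, norm_expB, ← dist_eq_norm, dist_comm]

/-! ### The generator -/

/-- The graph of the generator of a one-parameter group. -/
def genGraph (V : ℝ → H →L[ℂ] H) : Set (H × H) := {q | HasDerivAt (fun s => V s q.1) q.2 0}

theorem hasDerivAt_of_mem_genGraph {V : ℝ → H →L[ℂ] H} (hadd : ∀ s t, V (s + t) = V s * V t)
    {v w : H} (h : (v, w) ∈ genGraph V) (s : ℝ) : HasDerivAt (fun s => V s v) (V s w) s := by
  have h1 : HasDerivAt (fun r => V (r - s) v) w s := by
    have h0 : HasDerivAt (fun s => V s v) w ((fun r => r - s) s) := by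
      simpa only [sub_self] using! h
    have := HasDerivAt.scomp (h := fun r => r - s) s h0 ((hasDerivAt_id s).sub_const s)
    rwa [one_smul] at this
  have h2 := ((V s).restrictScalars ℝ).hasFDerivAt.comp_hasDerivAt s h1
  convert! h2 using 1
  funext r
  change V r v = V s (V (r - s) v)
  rw [← mul_apply_eq_comp, ← hadd, add_sub_cancel]

theorem apply_mem_genGraph {V : ℝ → H →L[ℂ] H} (hadd : ∀ s t, V (s + t) = V s * V t)
    {v w : H} (h : (v, w) ∈ genGraph V) (s : ℝ) : (V s v, V s w) ∈ genGraph V := by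
  have h2 := ((V s).restrictScalars ℝ).hasFDerivAt.comp_hasDerivAt 0 h
  change HasDerivAt _ _ _
  convert! h2 using 1
  funext r
  change V r (V s v) = V s (V r v)
  rw [← mul_apply_eq_comp, ← hadd, add_comm, hadd, mul_apply_eq_comp]

theorem genGraph_sub {V : ℝ → H →L[ℂ] H} {v w v' w' : H} (h : (v, w) ∈ genGraph V)
    (h' : (v', w') ∈ genGraph V) : (v - v', w - w') ∈ genGraph V := by
  have := HasDerivAt.sub h h'
  change HasDerivAt _ _ _
  convert! this using 1
  funext s
  exact map_sub _ _ _

/-- The generator of the limit group is skew-symmetric. -/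
theorem re_inner_of_mem_genGraph {v w : H} (h : (v, w) ∈ genGraph D.expB) :
    (⟪v, w⟫_ℂ).re = 0 := by
  have h1 := hasDerivAt_norm_sq h
  simp only [norm_expB, expB_zero, one_apply_eq_self] at h1
  have := h1.unique (hasDerivAt_const (0 : ℝ) (‖v‖ ^ 2))
  linarith

theorem isClosed_genGraph : IsClosed (genGraph D.expB) := by
  have key : ∀ {v w : H} {ε δ : ℝ}, (v, w) ∈ genGraph D.expB →
      (∀ r, |r| ≤ δ → ‖D.expB r w - w‖ ≤ ε) →
      ∀ s : ℝ, |s| ≤ δ → ‖D.expB s v - v - s • w‖ ≤ |s| * ε := by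
    intro v w ε δ h hw s hs
    have hd : ∀ r, HasDerivAt (fun r : ℝ => D.expB r v - r • w) (D.expB r w - w) r := by
      intro r
      convert! (hasDerivAt_of_mem_genGraph D.expB_add h r).sub
        ((hasDerivAt_id r).smul_const w) using 1
      rw [one_smul]
    have := norm_sub_le_of_deriv_le (s := s) hd fun r hr => hw r (hr.trans hs)
    simp only [expB_zero, one_apply_eq_self, zero_smul, sub_zero] at this
    rwa [sub_right_comm]
  refine isClosed_of_closure_subset fun q hq => ?_
  obtain ⟨u, hu, hlim⟩ := mem_closure_iff_seq_limit.1 hq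
  change HasDerivAt _ _ _
  rw [hasDerivAt_iff_isLittleO_nhds_zero]
  simp only [zero_add, expB_zero, one_apply_eq_self]
  refine Asymptotics.IsLittleO.of_bound fun ε hε => ?_
  obtain ⟨δ, hδ, hcont⟩ := Metric.continuousAt_iff.1
    ((D.continuous_expB q.2).continuousAt (x := (0 : ℝ))) (ε / 2) (by positivity)
  have hnear : ∀ r, |r| ≤ δ / 2 → ‖D.expB r q.2 - q.2‖ ≤ ε / 2 := by
    intro r hr
    have := hcont (x := r) (by rw [Real.dist_eq, sub_zero]; linarith)
    rw [expB_zero, one_apply_eq_self, dist_eq_norm] at this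
    exact this.le
  have hev : ∀ᶠ s : ℝ in 𝓝 0, |s| < δ / 2 := by
    have := Metric.ball_mem_nhds (0 : ℝ) (half_pos hδ)
    filter_upwards [this] with s hs
    simpa using hs
  filter_upwards [hev] with s hs
  have h1 := (hlim.fst_nhds)
  have h2 := (hlim.snd_nhds)
  rw [Real.norm_eq_abs, mul_comm]
  have hL : Tendsto (fun n => ‖D.expB s (u n).1 - (u n).1 - s • (u n).2‖) atTop
      (𝓝 ‖D.expB s q.1 - q.1 - s • q.2‖) :=
    (((((D.expB s).continuous.tendsto _).comp h1).sub h1).sub (h2.const_smul s)).norm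
  refine le_of_tendsto hL ?_
  filter_upwards [Metric.tendsto_nhds.1 h2 (ε / 4) (by positivity)] with n hn
  refine key (hu n) (δ := δ / 2) (fun r hr => ?_) s hs.le
  rw [dist_eq_norm] at hn
  have e : D.expB r (u n).2 - (u n).2 =
      D.expB r ((u n).2 - q.2) + (D.expB r q.2 - q.2) - ((u n).2 - q.2) := by
    rw [map_sub]; abel
  rw [e]
  have e1 := norm_sub_le (D.expB r ((u n).2 - q.2) + (D.expB r q.2 - q.2)) ((u n).2 - q.2)
  have e2 := norm_add_le (D.expB r ((u n).2 - q.2)) (D.expB r q.2 - q.2)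
  rw [norm_expB] at e2
  linarith [hnear r hr]

theorem closure_graphB_subset : closure D.graphB ⊆ genGraph D.expB :=
  closure_minimal (fun _ h => D.hasDerivAt_expB_zero h) D.isClosed_genGraph

theorem norm_B_Q_le (M n : ℕ) (φ : H) : ‖D.B M (D.Q n φ)‖ ≤ 2 * D.κ * (n + 1) * ‖D.Q n φ‖ := by
  have hκ := D.κ_nonneg
  set x := ‖D.Q n φ‖ with hx
  have hx0 : 0 ≤ x := norm_nonneg _
  have h1 : ∑ m ∈ range M, D.κ * (m + 1) * (if m = n then x else 0) ≤ D.κ * (n + 1) * x := by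
    simp only [mul_ite, mul_zero, Finset.sum_ite_eq']
    split_ifs
    · exact le_rfl
    · positivity
  have h2 : ∑ m ∈ range M, D.κ * (m + 1) * (if m + 2 = n then x else 0) ≤ D.κ * (n + 1) * x := by
    match n with
    | 0 => simp; positivity
    | 1 => simp; positivity
    | k + 2 =>
      simp only [mul_ite, mul_zero, Nat.add_right_cancel_iff, Finset.sum_ite_eq']
      split_ifs
      · gcongr
        linarith
      · positivity
  rw [B_apply]
  calc _ ≤ ∑ m ∈ range M, (D.κ * (m + 1) * (if m = n then x else 0) +
        D.κ * (m + 1) * (if m + 2 = n then x else 0)) := by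
        refine norm_sum_le_of_le _ fun m _ => (D.norm_step_apply_le m _).trans_eq ?_
        rw [Q_Q, Q_Q, mul_add]
        congr 2 <;> split_ifs <;> simp [hx]
    _ ≤ _ := by
        rw [Finset.sum_add_distrib]
        linarith

/-- A vector whose components decay fast lies in the domain of the closure of `B`. -/
theorem exists_mem_closure_graphB {φ : H} {C : ℝ}
    (hC : ∀ n : ℕ, ‖D.Q n φ‖ ≤ C / ((n : ℝ) + 1) ^ 3) : ∃ φ', (φ, φ') ∈ closure D.graphB := by
  have hκ := D.κ_nonneg
  have hs : Summable fun n => D.B (n + 1) (D.Q n φ) := by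
    refine Summable.of_norm_bounded (g := fun n : ℕ => 2 * D.κ * C * (1 / ((n : ℝ) + 1) ^ 2))
      (summable_inv_sq.mul_left _) fun n => (D.norm_B_Q_le _ n φ).trans ?_
    calc _ ≤ 2 * D.κ * (n + 1) * (C / ((n : ℝ) + 1) ^ 3) := by
          gcongr
          exact hC n
      _ = _ := by field_simp
  refine ⟨_, mem_closure_of_tendsto ((D.tendsto_P φ).prodMk_nhds hs.hasSum.tendsto_sum_nat)
    (Eventually.of_forall fun L => ?_)⟩
  have h : ∑ n ∈ range L, D.B (n + 1) (D.Q n φ) = D.B L (D.P L φ) := by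
    rw [P_apply, map_sum]
    refine Finset.sum_congr rfl fun n hn => ?_
    rw [Finset.mem_range] at hn
    refine (D.B_eq_of_le (Nat.succ_le_of_lt hn) fun m hm => ?_).symm
    rw [Q_Q, if_neg (by omega)]
  simp only [h]
  exact D.mem_graphB fun n hn => D.Q_P hn φ

/-- The orbit of a vector with finitely many components stays in the domain of the closure. -/
theorem expB_mem_closure_graphB {χ χ' : H} (h : (χ, χ') ∈ D.graphB) (s : ℝ) :
    (D.expB s χ, D.expB s χ') ∈ closure D.graphB := by
  obtain ⟨C, -, hC⟩ := D.exists_decay h.1 3 |s|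
  have hd : ∀ n : ℕ, ‖D.Q n (D.expB s χ)‖ ≤ C / ((n : ℝ) + 1) ^ 3 := fun n =>
    le_of_tendsto (((D.Q n).continuous.tendsto _).comp (D.tendsto_U s χ)).norm
      (Eventually.of_forall fun M => hC M s le_rfl n)
  obtain ⟨φ', hφ'⟩ := D.exists_mem_closure_graphB hd
  have h1 : HasDerivAt _ _ _ := D.closure_graphB_subset hφ'
  have h2 : HasDerivAt _ _ _ := apply_mem_genGraph D.expB_add (D.hasDerivAt_expB_zero h) s
  have h3 : φ' = D.expB s χ' := h1.unique h2
  rwa [h3] at hφ'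

/-- The range of `1 - B` is dense: if `η` is orthogonal to it, then `s ↦ ⟪η, e^{sB} χ⟫` solves
`g' = g` and is bounded, hence is zero. -/
theorem dense_range_one_sub {η : H} (h : ∀ q ∈ D.graphB, ⟪η, q.1 - q.2⟫_ℂ = 0) : η = 0 := by
  have hcl : ∀ q ∈ closure D.graphB, ⟪η, q.1⟫_ℂ = ⟪η, q.2⟫_ℂ := by
    intro q hq
    have : closure D.graphB ⊆ {q | ⟪η, q.1 - q.2⟫_ℂ = 0} :=
      closure_minimal h (isClosed_eq (by fun_prop) continuous_const)
    have := this hq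
    rwa [Set.mem_ofPred_eq, inner_sub_right, sub_eq_zero] at this
  have hfin : ∀ χ, D.IsFin χ → ⟪η, χ⟫_ℂ = 0 := by
    intro χ hχ
    obtain ⟨χ', hχ'⟩ := D.exists_mem_graphB hχ
    set g : ℝ → ℂ := fun s => ⟪η, D.expB s χ⟫_ℂ with hg
    have hd : ∀ s, HasDerivAt g (g s) s := by
      intro s
      have h1 := hasDerivAt_of_mem_genGraph D.expB_add (D.hasDerivAt_expB_zero hχ') s
      have h2 := ((innerSL ℂ η).restrictScalars ℝ).hasFDerivAt.comp_hasDerivAt s h1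
      have h3 := hcl _ (D.expB_mem_closure_graphB hχ' s)
      simp only at h3
      convert! h2 using 1
    have hc : ∀ s, (Real.exp (-s) : ℝ) • g s = g 0 := by
      intro s
      have hd2 : ∀ s, HasDerivAt (fun s : ℝ => (Real.exp (-s) : ℝ) • g s) 0 s := by
        intro s
        convert! (hasDerivAt_neg s).exp.smul (hd s) using 1
        rw [← add_smul]
        simp
      have := is_const_of_deriv_eq_zero (fun s => (hd2 s).differentiableAt)
        (fun s => (hd2 s).deriv) s 0
      simpa using this
    have hle : ∀ s, ‖g 0‖ ≤ Real.exp (-s) * (‖η‖ * ‖χ‖) := by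
      intro s
      rw [← hc s, norm_smul, Real.norm_eq_abs, abs_of_pos (Real.exp_pos _)]
      gcongr
      refine (norm_inner_le_norm _ _).trans_eq ?_
      rw [norm_expB]
    have hlim : Tendsto (fun s => Real.exp (-s) * (‖η‖ * ‖χ‖)) atTop (𝓝 0) := by
      have := Real.tendsto_exp_neg_atTop_nhds_zero.mul_const (‖η‖ * ‖χ‖)
      rwa [zero_mul] at this
    have h0 := ge_of_tendsto' hlim hle
    have : g 0 = 0 := norm_le_zero_iff.1 h0
    simpa [hg, expB_zero] using this
  have h1 := tendsto_const_nhds (x := η) |>.inner (𝕜 := ℂ) (D.tendsto_P η)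
  have h2 : ∀ L, ⟪η, D.P L η⟫_ℂ = 0 := fun L => hfin _ (D.isFin_P L η)
  simp only [h2] at h1
  exact inner_self_eq_zero.1 (tendsto_nhds_unique h1 tendsto_const_nhds)

/-- The generator of the limit group is the closure of `B`. The range of `1 - B` is dense and
`‖(1 - A) v‖² = ‖v‖² + ‖A v‖²` for a skew-symmetric extension `A`, so the closure of `B` has no
proper skew-symmetric extension that generates a group. -/
theorem genGraph_expB : genGraph D.expB = closure D.graphB := by
  refine Set.Subset.antisymm (fun q hq => ?_) D.closure_graphB_subset
  let K : Submodule ℂ H :=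
    { carrier := {x | ∃ q ∈ D.graphB, q.1 - q.2 = x}
      add_mem' := by
        rintro _ _ ⟨q, hq, rfl⟩ ⟨q', hq', rfl⟩
        refine ⟨_, D.graphB_add hq hq', ?_⟩
        rw [Prod.fst_add, Prod.snd_add]
        abel
      zero_mem' := ⟨0, ⟨⟨0, fun n _ => map_zero _⟩, Eventually.of_forall fun M => map_zero _⟩,
        sub_zero _⟩
      smul_mem' := by
        rintro c _ ⟨q, hq, rfl⟩
        exact ⟨_, D.graphB_smul c hq, (smul_sub c _ _).symm⟩ }
  have hK : K.topologicalClosure = ⊤ := by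
    rw [Submodule.topologicalClosure_eq_top_iff, Submodule.eq_bot_iff]
    intro η hη
    refine D.dense_range_one_sub fun q hq => ?_
    rw [Submodule.mem_orthogonal'] at hη
    exact hη _ ⟨q, hq, rfl⟩
  have hmem : q.1 - q.2 ∈ closure (K : Set H) := by
    rw [← Submodule.topologicalClosure_coe, hK]
    trivial
  rw [Metric.mem_closure_iff] at hmem ⊢
  intro ε hε
  obtain ⟨_, ⟨p, hp, rfl⟩, hd⟩ := hmem ε hε
  refine ⟨p, hp, lt_of_le_of_lt ?_ hd⟩
  have h1 : (q.1 - p.1, q.2 - p.2) ∈ genGraph D.expB :=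
    genGraph_sub hq (D.hasDerivAt_expB_zero hp)
  have h2 := D.re_inner_of_mem_genGraph h1
  -- the cross term vanishes since the generator is skew-symmetric
  have h3 : ‖(q.1 - q.2) - (p.1 - p.2)‖ ^ 2 = ‖q.1 - p.1‖ ^ 2 + ‖q.2 - p.2‖ ^ 2 := by
    rw [show (q.1 - q.2) - (p.1 - p.2) = (q.1 - p.1) - (q.2 - p.2) by abel,
      norm_sub_sq (𝕜 := ℂ)]
    change _ - 2 * (⟪_, _⟫_ℂ).re + _ = _
    rw [h2]
    ring
  rw [Prod.dist_eq, dist_eq_norm, dist_eq_norm, dist_eq_norm]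
  refine max_le ?_ ?_ <;> refine abs_le_of_sq_le_sq' ?_ (norm_nonneg _) |>.2 <;> rw [h3]
  · linarith [sq_nonneg ‖q.2 - p.2‖]
  · linarith [sq_nonneg ‖q.1 - p.1‖]

/-- A group is determined by its generator: the difference of two orbits is an orbit of a
skew-symmetric operator, so that its norm is constant. -/
theorem eq_expB {V : ℝ → H →L[ℂ] H} (h0 : V 0 = 1) (hadd : ∀ s t, V (s + t) = V s * V t)
    (hV : genGraph V = closure D.graphB) : V = D.expB := by
  have hfin : ∀ s χ, D.IsFin χ → V s χ = D.expB s χ := by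
    intro s χ hχ
    obtain ⟨χ', hχ'⟩ := D.exists_mem_graphB hχ
    have m1 : (χ, χ') ∈ genGraph V := by rw [hV]; exact subset_closure hχ'
    have m2 : (χ, χ') ∈ genGraph D.expB := D.hasDerivAt_expB_zero hχ'
    have hd : ∀ s, HasDerivAt (fun s => ‖V s χ - D.expB s χ‖ ^ 2) 0 s := by
      intro s
      convert! hasDerivAt_norm_sq ((hasDerivAt_of_mem_genGraph hadd m1 s).sub
        (hasDerivAt_of_mem_genGraph D.expB_add m2 s)) using 1
      have h1 := apply_mem_genGraph hadd m1 s
      rw [hV, ← D.genGraph_expB] at h1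
      have := D.re_inner_of_mem_genGraph (genGraph_sub h1 (apply_mem_genGraph D.expB_add m2 s))
      change 0 = 2 * (⟪V s χ - D.expB s χ, V s χ' - D.expB s χ'⟫_ℂ).re
      rw [this, mul_zero]
    have := is_const_of_deriv_eq_zero (fun s => (hd s).differentiableAt) (fun s => (hd s).deriv) s 0
    simp only [h0, expB_zero, sub_self, norm_zero] at this
    rw [← sub_eq_zero, ← norm_eq_zero]
    exact pow_eq_zero_iff two_ne_zero |>.1 (by simpa using this)
  funext s
  ext1 ψ
  refine tendsto_nhds_unique (((V s).continuous.tendsto _).comp (D.tendsto_P ψ)) ?_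
  refine (((D.expB s).continuous.tendsto _).comp (D.tendsto_P ψ)).congr fun L => ?_
  exact (hfin s _ (D.isFin_P L ψ)).symm

end LadderSystem

/-! ### Field operators and their conjugation by the group -/

/-- A ladder system together with creation operators `c n f` from level `n` to level `n + 1` that
commute with the pair creation operators `b n`, and whose adjoints satisfy
`[a(f), b] = c(k f̄)`. -/
structure FieldSystem (H : Type*) [NormedAddCommGroup H] [InnerProductSpace ℂ H]
    [CompleteSpace H] (k : Kernel) extends LadderSystem H where
  /-- the creation operator from level `n` to level `n + 1` -/
  c : ℕ → L2 →L[ℂ] H →L[ℂ] H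
  Q_mul_c : ∀ n f, Q (n + 1) * c n f = c n f
  c_mul_Q : ∀ n f, c n f * Q n = c n f
  norm_c_le : ∀ n f, ‖c n f‖ ≤ √(n + 1) * ‖f‖
  c_mul_b : ∀ n f, c (n + 2) f * b n = b (n + 1) * c n f
  starc_mul_b_zero : ∀ f, star (c 1 f) * b 0 = c 0 (kop k (star f))
  starc_mul_b_succ : ∀ n f, star (c (n + 2) f) * b (n + 1) =
    b n * star (c n f) + c (n + 1) (kop k (star f))

namespace LadderSystem

open Filter Topology Finset

variable {H : Type*} [NormedAddCommGroup H] [InnerProductSpace ℂ H] [CompleteSpace H]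
  (D : LadderSystem H)

/-- On level `n + d`, only one term of `∑ X m` contributes if `X m` acts on level `m + d`. -/
theorem sum_eval {d : ℕ} {X : ℕ → H →L[ℂ] H} (hX : ∀ m φ, X m (D.Q (m + d) φ) = X m φ)
    {n M : ℕ} (hn : n < M) {φ : H} (hφ : D.Q (n + d) φ = φ) :
    ∑ m ∈ range M, X m φ = X n φ := by
  refine Finset.sum_eq_single n (fun m _ hm => ?_) fun h => absurd (Finset.mem_range.2 hn) h
  rw [← hX, ← hφ, Q_Q, if_neg (by omega), map_zero]

theorem sum_eval_eq_zero {d : ℕ} {X : ℕ → H →L[ℂ] H} (hX : ∀ m φ, X m (D.Q (m + d) φ) = X m φ)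
    {j M : ℕ} (hj : j < d) {φ : H} (hφ : D.Q j φ = φ) : ∑ m ∈ range M, X m φ = 0 := by
  refine Finset.sum_eq_zero fun m _ => ?_
  rw [← hX, ← hφ, Q_Q, if_neg (by omega), map_zero]

/-- Components in distinct levels with square-summable norms add up to a vector. -/
theorem summable_of_level {x : ℕ → H} (d : ℕ) (hx : ∀ n, D.Q (n + d) (x n) = x n)
    (hs : Summable fun n => ‖x n‖ ^ 2) : Summable x := by
  let G : ℕ → Submodule ℂ H := fun n => LinearMap.range (D.Q (n + d)).toLinearMap
  have hG : OrthogonalFamily ℂ (fun n => G n) fun n => (G n).subtypeₗᵢ := by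
    rintro i j hij ⟨_, v, rfl⟩ ⟨_, w, rfl⟩
    change ⟪D.Q (i + d) v, D.Q (j + d) w⟫_ℂ = 0
    rw [inner_Q, Q_Q, if_neg (by omega), inner_zero_right]
  exact (hG.summable_iff_norm_sq_summable fun n => ⟨x n, x n, hx n⟩).2 hs

theorem Q_tsum {x : ℕ → H} {d : ℕ} (hx : ∀ n, D.Q (n + d) (x n) = x n) (hs : Summable x) (n : ℕ) :
    D.Q (n + d) (∑' m, x m) = x n := by
  rw [(D.Q (n + d)).map_tsum hs, tsum_eq_single n, hx]
  intro m hm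
  rw [← hx, Q_Q, if_neg (by omega)]

theorem Q_tsum_eq_zero {x : ℕ → H} {d : ℕ} (hx : ∀ n, D.Q (n + d) (x n) = x n) (hs : Summable x)
    {j : ℕ} (hj : j < d) : D.Q j (∑' m, x m) = 0 := by
  rw [(D.Q j).map_tsum hs]
  refine (tsum_congr fun m => ?_).trans tsum_zero
  rw [← hx, Q_Q, if_neg (by omega)]

theorem ext_Q {ψ φ : H} (h : ∀ n, D.Q n ψ = D.Q n φ) : ψ = φ := by
  have h1 := D.hasSum_Q ψ
  simp only [h] at h1
  exact h1.unique (D.hasSum_Q φ)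

/-- The domain of the square root of the number operator is preserved. -/
theorem summable_expB {ψ : H} (hψ : Summable fun n : ℕ => ((n : ℝ) + 1) * ‖D.Q n ψ‖ ^ 2) (s : ℝ) :
    Summable fun n : ℕ => ((n : ℝ) + 1) * ‖D.Q n (D.expB s ψ)‖ ^ 2 := by
  obtain ⟨c, hc0, hc⟩ := exists_weight_const 1
  simp only [pow_one] at hc
  refine summable_of_sum_range_le (fun n => by positivity) fun L => le_of_tendsto
    (f := fun M => ∑ n ∈ range L, ((n : ℝ) + 1) * ‖D.Q n (D.U M s ψ)‖ ^ 2)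
    (tendsto_finsetSum _ fun n _ => ((((D.Q n).continuous.tendsto _).comp
      (D.tendsto_U s ψ)).norm.pow 2).const_mul _)
    (Eventually.of_forall fun M => D.moment_le (w := fun n => (n : ℝ) + 1)
      (fun n => by positivity) (fun n => by push_cast; linarith) hc0 hc hψ M L s)

theorem norm_B_le (M : ℕ) : ‖D.B M‖ ≤ 2 * D.κ * (M + 1) ^ 2 := by
  have hκ := D.κ_nonneg
  calc ‖D.B M‖ ≤ ∑ n ∈ range M, 2 * D.κ * (M + 1) := by
        refine norm_sum_le_of_le _ fun n hn => ?_
        have hn : (n : ℝ) + 1 ≤ M + 1 := by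
          have := (Finset.mem_range.1 hn).le
          gcongr
        have h1 := (D.norm_b_le n).trans (mul_le_mul_of_nonneg_left hn hκ)
        have h2 : ‖star (D.b n)‖ ≤ D.κ * (M + 1) := by
          rwa [ContinuousLinearMap.star_eq_adjoint, LinearIsometryEquiv.norm_map]
        linarith [norm_sub_le (D.b n) (star (D.b n))]
    _ = 2 * D.κ * (M * (M + 1)) := by
        rw [Finset.sum_const, Finset.card_range, nsmul_eq_mul]
        ring
    _ ≤ _ := by
        gcongr
        nlinarith [(Nat.cast_nonneg M : (0 : ℝ) ≤ M)]

end LadderSystem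

namespace FieldSystem

open Filter Topology Finset LadderSystem

variable {H : Type*} [NormedAddCommGroup H] [InnerProductSpace ℂ H] [CompleteSpace H]
  {k : Kernel} (D : FieldSystem H k)

theorem c_Q (n : ℕ) (f : L2) (ψ : H) : D.c n f (D.Q n ψ) = D.c n f ψ := by
  rw [← mul_apply_eq_comp, D.c_mul_Q]

theorem Q_c (n : ℕ) (f : L2) (ψ : H) : D.Q (n + 1) (D.c n f ψ) = D.c n f ψ := by
  rw [← mul_apply_eq_comp, D.Q_mul_c]

theorem starc_Q (n : ℕ) (f : L2) (ψ : H) :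
    star (D.c n f) (D.Q (n + 1) ψ) = star (D.c n f) ψ := by
  rw [← mul_apply_eq_comp]
  conv_lhs => rw [← D.star_Q, ← star_mul, D.Q_mul_c]

theorem Q_starc (n : ℕ) (f : L2) (ψ : H) : D.Q n (star (D.c n f) ψ) = star (D.c n f) ψ := by
  rw [← mul_apply_eq_comp]
  conv_lhs => rw [← D.star_Q, ← star_mul, D.c_mul_Q]

theorem norm_starc_le (n : ℕ) (f : L2) : ‖star (D.c n f)‖ ≤ √(n + 1) * ‖f‖ := by
  rw [ContinuousLinearMap.star_eq_adjoint, LinearIsometryEquiv.norm_map]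
  exact D.norm_c_le n f

/-- The truncated field operator `A(u)`. -/
def A (M : ℕ) (u : L2Sum) : H →L[ℂ] H :=
  ∑ m ∈ range M, (star (D.c m u.fst) + D.c m (star u.snd))

theorem A_apply (M : ℕ) (u : L2Sum) (φ : H) : D.A M u φ =
    ∑ m ∈ range M, star (D.c m u.fst) φ + ∑ m ∈ range M, D.c m (star u.snd) φ := by
  rw [A, _root_.sum_apply, ← Finset.sum_add_distrib]
  rfl

theorem B_apply' (M : ℕ) (φ : H) : D.B M φ =
    ∑ m ∈ range M, D.b m φ - ∑ m ∈ range M, star (D.b m) φ := by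
  rw [B_apply, Finset.sum_sub_distrib]

theorem norm_A_le (M : ℕ) (u : L2Sum) : ‖D.A M u‖ ≤ 2 * ‖u‖ * (M + 1) ^ 2 := by
  calc ‖D.A M u‖ ≤ ∑ n ∈ range M, 2 * ‖u‖ * (M + 1) := by
        refine norm_sum_le_of_le _ fun n hn => ?_
        have hn : √((n : ℝ) + 1) ≤ M + 1 := by
          have := (Finset.mem_range.1 hn).le
          refine (Real.sqrt_le_left (by positivity)).2 ?_
          have : (n : ℝ) ≤ M := by exact_mod_cast this
          nlinarith [(Nat.cast_nonneg n : (0 : ℝ) ≤ n)]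
        have h1 := (D.norm_starc_le n u.fst).trans
          (mul_le_mul hn (WithLp.norm_fst_le L2 u) (norm_nonneg _) (by positivity))
        have h2 := (D.norm_c_le n (star u.snd)).trans
          (mul_le_mul hn ((norm_star_Lp _).trans_le (WithLp.norm_snd_le L2 u)) (norm_nonneg _)
            (by positivity))
        linarith [norm_add_le (star (D.c n u.fst)) (D.c n (star u.snd))]
    _ = 2 * ‖u‖ * (M * (M + 1)) := by
        rw [Finset.sum_const, Finset.card_range, nsmul_eq_mul]
        ring
    _ ≤ _ := by
        gcongr
        nlinarith [(Nat.cast_nonneg M : (0 : ℝ) ≤ M)]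

theorem hasDerivAt_A (M : ℕ) {v : ℝ → L2Sum} {v' : L2Sum} {s : ℝ} (hv : HasDerivAt v v' s) :
    HasDerivAt (fun s => D.A M (v s)) (D.A M v') s := by
  have h1 : HasDerivAt (fun s => (v s).fst) v'.fst s :=
    (((ContinuousLinearMap.fst ℂ L2 L2).comp
      (WithLp.prodContinuousLinearEquiv 2 ℂ L2 L2 : L2Sum →L[ℂ] L2 × L2)).restrictScalars
      ℝ).hasFDerivAt.comp_hasDerivAt s hv
  have h2 : HasDerivAt (fun s => (v s).snd) v'.snd s :=
    (((ContinuousLinearMap.snd ℂ L2 L2).comp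
      (WithLp.prodContinuousLinearEquiv 2 ℂ L2 L2 : L2Sum →L[ℂ] L2 × L2)).restrictScalars
      ℝ).hasFDerivAt.comp_hasDerivAt s hv
  refine HasDerivAt.fun_sum fun m _ => HasDerivAt.add ?_ ?_
  · exact HasDerivAt.star (((D.c m).restrictScalars ℝ).hasFDerivAt.comp_hasDerivAt s h1)
  · exact ((D.c m).restrictScalars ℝ).hasFDerivAt.comp_hasDerivAt s (hasDerivAt_star h2)

/-- Below the truncation, `[A(u), B] = A((0, k; k̄, 0) u)`. -/
theorem commutator_apply {M n : ℕ} (hn : n + 4 ≤ M) (u : L2Sum) {φ : H} (hφ : D.Q n φ = φ) :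
    D.A M u (D.B M φ) - D.B M (D.A M u φ) = D.A M (genK k u) φ := by
  set f := u.fst
  set h := star u.snd with hh
  have e1 : (genK k u).fst = kop k (star h) := by
    rw [hh, star_star, genK, blockOp_apply]
    simp
  have e2 : star (genK k u).snd = kop k (star f) := by
    rw [← star_star (kop k (star f)), ← kop_star, star_star, genK, blockOp_apply]
    simp [f]
  have hb : ∀ m φ, D.b m (D.Q (m + 0) φ) = D.b m φ := D.b_Q
  have hb' := D.starb_Q
  have hc : ∀ g m φ, D.c m g (D.Q (m + 0) φ) = D.c m g φ := fun g m => D.c_Q m g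
  have hc' : ∀ g m φ, star (D.c m g) (D.Q (m + 1) φ) = star (D.c m g) φ :=
    fun g m => D.starc_Q m g
  have k1 : ∑ m ∈ range M, D.c m h (D.b n φ) = ∑ m ∈ range M, D.b m (D.c n h φ) := by
    rw [D.sum_eval (hc h) (n := n + 2) (by omega) (D.Q_b n φ),
      D.sum_eval hb (n := n + 1) (by omega) (D.Q_c n h φ), ← mul_apply_eq_comp, D.c_mul_b]
    rfl
  have k2 : ∑ m ∈ range M, star (D.c m f) (∑ m ∈ range M, star (D.b m) φ) =
      ∑ m ∈ range M, star (D.b m) (∑ m ∈ range M, star (D.c m f) φ) := by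
    match n, hφ with
    | 0, hφ =>
      rw [D.sum_eval_eq_zero hb' (j := 0) (by omega) hφ,
        D.sum_eval_eq_zero (hc' f) (j := 0) (by omega) hφ]
      simp
    | 1, hφ =>
      rw [D.sum_eval_eq_zero hb' (j := 1) (by omega) hφ, D.sum_eval (hc' f) (n := 0) (by omega) hφ,
        D.sum_eval_eq_zero hb' (j := 0) (by omega) (D.Q_starc 0 f φ)]
      simp
    | 2, hφ =>
      rw [D.sum_eval hb' (n := 0) (by omega) hφ,
        D.sum_eval_eq_zero (hc' f) (j := 0) (by omega) (D.Q_starb 0 φ),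
        D.sum_eval (hc' f) (n := 1) (by omega) hφ,
        D.sum_eval_eq_zero hb' (j := 1) (by omega) (D.Q_starc 1 f φ)]
    | n + 3, hφ =>
      rw [D.sum_eval hb' (n := n + 1) (by omega) hφ,
        D.sum_eval (hc' f) (n := n) (by omega) (D.Q_starb (n + 1) φ),
        D.sum_eval (hc' f) (n := n + 2) (by omega) hφ,
        D.sum_eval hb' (n := n) (by omega) (D.Q_starc (n + 2) f φ), ← mul_apply_eq_comp,
        ← mul_apply_eq_comp, ← star_mul, ← star_mul, D.c_mul_b]
  have k3 : ∑ m ∈ range M, star (D.c m f) (D.b n φ) =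
      ∑ m ∈ range M, D.b m (∑ m ∈ range M, star (D.c m f) φ) + D.c n (kop k (star f)) φ := by
    match n, hφ with
    | 0, hφ =>
      rw [D.sum_eval_eq_zero (hc' f) (j := 0) (by omega) hφ,
        D.sum_eval (hc' f) (n := 1) (by omega) (D.Q_b 0 φ), ← mul_apply_eq_comp,
        D.starc_mul_b_zero]
      simp
    | n + 1, hφ =>
      rw [D.sum_eval (hc' f) (n := n + 2) (by omega) (D.Q_b (n + 1) φ),
        D.sum_eval (hc' f) (n := n) (by omega) hφ,
        D.sum_eval hb (n := n) (by omega) (D.Q_starc n f φ), ← mul_apply_eq_comp,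
        D.starc_mul_b_succ]
      rfl
  have k4 : ∑ m ∈ range M, star (D.b m) (D.c n h φ) =
      ∑ m ∈ range M, D.c m h (∑ m ∈ range M, star (D.b m) φ) +
        ∑ m ∈ range M, star (D.c m (kop k (star h))) φ := by
    match n, hφ with
    | 0, hφ =>
      rw [D.sum_eval_eq_zero hb' (j := 1) (by omega) (D.Q_c 0 h φ),
        D.sum_eval_eq_zero hb' (j := 0) (by omega) hφ,
        D.sum_eval_eq_zero (hc' _) (j := 0) (by omega) hφ]
      simp
    | 1, hφ =>
      rw [D.sum_eval hb' (n := 0) (by omega) (D.Q_c 1 h φ),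
        D.sum_eval_eq_zero hb' (j := 1) (by omega) hφ,
        D.sum_eval (hc' _) (n := 0) (by omega) hφ, ← D.starc_mul_b_zero, star_mul, star_star]
      simp
    | n + 2, hφ =>
      rw [D.sum_eval hb' (n := n + 1) (by omega) (D.Q_c (n + 2) h φ),
        D.sum_eval hb' (n := n) (by omega) hφ,
        D.sum_eval (hc h) (n := n) (by omega) (D.Q_starb n φ),
        D.sum_eval (hc' _) (n := n + 1) (by omega) hφ, ← mul_apply_eq_comp]
      have := congrArg star (D.starc_mul_b_succ n h)
      rw [star_mul, star_star, star_add, star_mul, star_star] at this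
      rw [this]
      rfl
  have r1 := D.sum_eval hb (n := n) (M := M) (by omega) hφ
  have r2 := D.sum_eval (hc h) (n := n) (M := M) (by omega) hφ
  have r3 := D.sum_eval (hc (kop k (star f))) (n := n) (M := M) (by omega) hφ
  rw [D.A_apply M u (D.B M φ), D.B_apply' M (D.A M u φ), D.A_apply M u φ, D.B_apply' M φ,
    D.A_apply, e1, e2, r1, r3, ← hh, r2]
  simp only [map_sub, map_add, Finset.sum_sub_distrib, Finset.sum_add_distrib]
  change (∑ m ∈ range M, star (D.c m f) (D.b n φ) - _ + (_ - _)) - _ = _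
  rw [k1, k2, k3, k4]
  abel

/-- The defect of the commutation relation caused by the truncation. -/
def defect (M : ℕ) (u : L2Sum) : H →L[ℂ] H :=
  D.A M (genK k u) - (D.A M u * D.B M - D.B M * D.A M u)

theorem defect_Q {M n : ℕ} (hn : n + 4 ≤ M) (u : L2Sum) (φ : H) : D.defect M u (D.Q n φ) = 0 := by
  have := D.commutator_apply hn u (φ := D.Q n φ) (by rw [Q_Q, if_pos rfl])
  rw [defect, sub_apply, sub_apply, mul_apply_eq_comp, mul_apply_eq_comp, this, sub_self]

theorem norm_defect_le (M : ℕ) (u : L2Sum) :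
    ‖D.defect M u‖ ≤ (2 * ‖genK k‖ + 8 * D.κ) * ‖u‖ * (M + 1) ^ 4 := by
  have hκ := D.κ_nonneg
  have h1 : ‖D.A M (genK k u)‖ ≤ 2 * (‖genK k‖ * ‖u‖) * (M + 1) ^ 2 :=
    (D.norm_A_le M _).trans (by gcongr; exact (genK k).le_opNorm u)
  have h2 : ‖D.A M u * D.B M‖ ≤ (2 * ‖u‖ * (M + 1) ^ 2) * (2 * D.κ * (M + 1) ^ 2) :=
    (norm_mul_le _ _).trans (mul_le_mul (D.norm_A_le M u) (D.norm_B_le M) (norm_nonneg _)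
      (by positivity))
  have h3 : ‖D.B M * D.A M u‖ ≤ (2 * D.κ * (M + 1) ^ 2) * (2 * ‖u‖ * (M + 1) ^ 2) :=
    (norm_mul_le _ _).trans (mul_le_mul (D.norm_B_le M) (D.norm_A_le M u) (norm_nonneg _)
      (by positivity))
  have h4 : ((M : ℝ) + 1) ^ 2 ≤ ((M : ℝ) + 1) ^ 4 := by
    refine pow_le_pow_right₀ ?_ (by norm_num)
    linarith [(Nat.cast_nonneg M : (0 : ℝ) ≤ M)]
  have h5 : 2 * (‖genK k‖ * ‖u‖) * ((M : ℝ) + 1) ^ 2 ≤ 2 * (‖genK k‖ * ‖u‖) * ((M : ℝ) + 1) ^ 4 := by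
    gcongr
  have h6 := norm_sub_le (D.A M (genK k u)) (D.A M u * D.B M - D.B M * D.A M u)
  have h7 := norm_sub_le (D.A M u * D.B M) (D.B M * D.A M u)
  rw [defect]
  linarith

/-- The defect is negligible on vectors whose components decay fast. -/
theorem norm_defect_apply_le {C : ℝ} (hC0 : 0 ≤ C) {φ : H}
    (hC : ∀ n : ℕ, ‖D.Q n φ‖ ≤ C / ((n : ℝ) + 1) ^ 7) (M : ℕ) (u : L2Sum) :
    ‖D.defect M u φ‖ ≤ (2 * ‖genK k‖ + 8 * D.κ) * ‖u‖ * (1024 * C) *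
      (∑' n : ℕ, 1 / ((n : ℝ) + 1) ^ 2) / (M + 1) := by
  have hκ := D.κ_nonneg
  have h := (D.hasSum_Q φ).mapL (D.defect M u)
  rw [← h.tsum_eq, mul_div_right_comm]
  refine tsum_of_norm_bounded (summable_inv_sq.hasSum.mul_left _) fun n => ?_
  by_cases hn : n + 4 ≤ M
  · rw [defect_Q D hn, norm_zero]
    positivity
  · have h1 : (M : ℝ) + 1 ≤ 4 * (n + 1) := by
      have : M + 1 ≤ n + 4 := by omega
      have : (M : ℝ) + 1 ≤ n + 4 := by exact_mod_cast this
      linarith [(Nat.cast_nonneg n : (0 : ℝ) ≤ n)]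
    have hM : (0 : ℝ) < M + 1 := by positivity
    have hx : (0 : ℝ) < n + 1 := by positivity
    set x : ℝ := (n : ℝ) + 1
    set y : ℝ := (M : ℝ) + 1
    -- `y ≤ 4 * x` on the levels that the defect sees: of the seven powers of `x`, five absorb `y ^ 5`
    -- and gain the factor `1 / y`, and two are left for the summation
    have h2 : y ^ 4 * (C / x ^ 7) ≤ 1024 * C / y * (1 / x ^ 2) := by
      rw [div_mul_div_comm, mul_one, ← mul_div_assoc, div_le_div_iff₀ (by positivity) (by positivity)]
      have h3 : y ^ 5 ≤ (4 * x) ^ 5 := by gcongr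
      calc y ^ 4 * C * (y * x ^ 2) = C * x ^ 2 * y ^ 5 := by ring
        _ ≤ C * x ^ 2 * (4 * x) ^ 5 := by gcongr
        _ = _ := by ring
    calc _ ≤ ((2 * ‖genK k‖ + 8 * D.κ) * ‖u‖ * y ^ 4) * (C / x ^ 7) :=
          ((D.defect M u).le_of_opNorm_le (D.norm_defect_le M u) _).trans
            (mul_le_mul_of_nonneg_left (hC n) (by positivity))
      _ = (2 * ‖genK k‖ + 8 * D.κ) * ‖u‖ * (y ^ 4 * (C / x ^ 7)) := by ring
      _ ≤ (2 * ‖genK k‖ + 8 * D.κ) * ‖u‖ * (1024 * C / y * (1 / x ^ 2)) := by gcongr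
      _ = _ := by ring

/-- If `v` solves `v' = (0, k; k̄, 0) v`, then `e^{sB} A(v s) e^{-sB}` is constant up to the
defect. -/
theorem hasDerivAt_conj_A (M : ℕ) {v : ℝ → L2Sum} (hv : ∀ s, HasDerivAt v (genK k (v s)) s)
    (ψ : H) (s : ℝ) : HasDerivAt (fun s => D.U M s (D.A M (v s) (D.U M (-s) ψ)))
      (D.U M s (D.defect M (v s) (D.U M (-s) ψ))) s := by
  have h1 : HasDerivAt (fun r => D.U M (-r)) (-(D.U M (-s) * D.B M)) s := by
    have := (D.hasDerivAt_U_op M (-s)).scomp s (hasDerivAt_neg s)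
    rwa [neg_one_smul] at this
  have h2 := ((D.hasDerivAt_U_op M s).mul (D.hasDerivAt_A M (hv s))).mul h1
  have h3 := ((ContinuousLinearMap.apply ℂ H ψ).restrictScalars ℝ).hasFDerivAt.comp_hasDerivAt s h2
  convert! h3 using 1
  have : D.U M s * (D.defect M (v s) * D.U M (-s)) =
      (D.U M s * D.B M * D.A M (v s) + D.U M s * D.A M (genK k (v s))) * D.U M (-s) +
        D.U M s * D.A M (v s) * -(D.U M (-s) * D.B M) := by
    rw [D.commute_U_B M (-s), defect]
    noncomm_ring
  exact congrArg (fun X : H →L[ℂ] H => X ψ) this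

theorem tendsto_conj_A {v : ℝ → L2Sum} (hv : ∀ s, HasDerivAt v (genK k (v s)) s) {ψ : H}
    (hψ : D.IsFin ψ) (s : ℝ) :
    Tendsto (fun M => D.U M s (D.A M (v s) (D.U M (-s) ψ)) - D.A M (v 0) ψ) atTop (𝓝 0) := by
  -- order 7 is what `norm_defect_apply_le` asks for: 4 for the growth of the defect, 1 for the limit,
  -- 2 for the summation
  obtain ⟨C, hC0, hC⟩ := D.exists_decay hψ 7 |s|
  have hκ := D.κ_nonneg
  have hcv : Continuous v := continuous_iff_continuousAt.2 fun s => (hv s).continuousAt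
  obtain ⟨R, hR⟩ := (isCompact_Icc (a := -|s|) (b := |s|)).exists_bound_of_continuousOn
    hcv.continuousOn
  have hb : ∀ M, ‖D.U M s (D.A M (v s) (D.U M (-s) ψ)) - D.A M (v 0) ψ‖ ≤
      |s| * ((2 * ‖genK k‖ + 8 * D.κ) * R * (1024 * C) *
        (∑' n : ℕ, 1 / ((n : ℝ) + 1) ^ 2) / (M + 1)) := by
    intro M
    have := norm_sub_le_of_deriv_le (s := s) (C := (2 * ‖genK k‖ + 8 * D.κ) * R * (1024 * C) *
        (∑' n : ℕ, 1 / ((n : ℝ) + 1) ^ 2) / (M + 1)) (D.hasDerivAt_conj_A M hv ψ) fun r hr => by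
      rw [norm_U]
      refine (D.norm_defect_apply_le hC0 (hC M (-r) (by rwa [abs_neg])) M (v r)).trans ?_
      have h0 : 0 ≤ ∑' n : ℕ, 1 / ((n : ℝ) + 1) ^ 2 := tsum_nonneg fun n => by positivity
      have h1 := hR r (abs_le.1 hr)
      gcongr
    simpa only [neg_zero, U_zero, one_apply_eq_self] using this
  refine squeeze_zero_norm hb ?_
  have h1 : Tendsto (fun M : ℕ => (M : ℝ) + 1) atTop atTop :=
    tendsto_atTop_add_const_right _ _ tendsto_natCast_atTop_atTop
  have := (h1.const_div_atTop ((2 * ‖genK k‖ + 8 * D.κ) * R * (1024 * C) *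
        (∑' n : ℕ, 1 / ((n : ℝ) + 1) ^ 2))).const_mul |s|
  rwa [mul_zero] at this

/-- The annihilation operator. -/
def ann (f : L2) (ψ : H) : H := ∑' n, star (D.c n f) ψ

/-- The creation operator. -/
def cre (f : L2) (ψ : H) : H := ∑' n, D.c n f ψ

variable {ψ : H}

theorem summable_ann (hψ : Summable fun n : ℕ => ((n : ℝ) + 1) * ‖D.Q n ψ‖ ^ 2) (f : L2) :
    Summable fun n => star (D.c n f) ψ := by
  refine D.summable_of_level 0 (fun n => D.Q_starc n f ψ) ?_
  refine Summable.of_nonneg_of_le (fun n => by positivity) (fun n => ?_)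
    (((summable_nat_add_iff 1).2 hψ).mul_left (‖f‖ ^ 2))
  have h1 : ‖star (D.c n f) ψ‖ ≤ √(n + 1) * ‖f‖ * ‖D.Q (n + 1) ψ‖ := by
    rw [← starc_Q]
    exact ContinuousLinearMap.le_of_opNorm_le _ (D.norm_starc_le n f) _
  calc _ ≤ (√(n + 1) * ‖f‖ * ‖D.Q (n + 1) ψ‖) ^ 2 := by gcongr
    _ = ‖f‖ ^ 2 * (((n : ℝ) + 1) * ‖D.Q (n + 1) ψ‖ ^ 2) := by
        rw [mul_pow, mul_pow, Real.sq_sqrt (by positivity)]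
        ring
    _ ≤ _ := by
        gcongr
        linarith

theorem summable_cre (hψ : Summable fun n : ℕ => ((n : ℝ) + 1) * ‖D.Q n ψ‖ ^ 2) (f : L2) :
    Summable fun n => D.c n f ψ := by
  refine D.summable_of_level 1 (fun n => D.Q_c n f ψ) (Summable.of_nonneg_of_le
    (fun n => by positivity) (fun n => ?_) (hψ.mul_left (‖f‖ ^ 2)))
  have h1 : ‖D.c n f ψ‖ ≤ √(n + 1) * ‖f‖ * ‖D.Q n ψ‖ := by
    rw [← c_Q]
    exact ContinuousLinearMap.le_of_opNorm_le _ (D.norm_c_le n f) _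
  calc _ ≤ (√(n + 1) * ‖f‖ * ‖D.Q n ψ‖) ^ 2 := by gcongr
    _ = ‖f‖ ^ 2 * (((n : ℝ) + 1) * ‖D.Q n ψ‖ ^ 2) := by
        rw [mul_pow, mul_pow, Real.sq_sqrt (by positivity)]
        ring

theorem Q_ann (hψ : Summable fun n : ℕ => ((n : ℝ) + 1) * ‖D.Q n ψ‖ ^ 2) (f : L2) (n : ℕ) :
    D.Q n (D.ann f ψ) = star (D.c n f) ψ :=
  D.Q_tsum (d := 0) (fun n => D.Q_starc n f ψ) (D.summable_ann hψ f) n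

theorem Q_succ_cre (hψ : Summable fun n : ℕ => ((n : ℝ) + 1) * ‖D.Q n ψ‖ ^ 2) (f : L2) (n : ℕ) :
    D.Q (n + 1) (D.cre f ψ) = D.c n f ψ :=
  D.Q_tsum (d := 1) (fun n => D.Q_c n f ψ) (D.summable_cre hψ f) n

theorem Q_zero_cre (hψ : Summable fun n : ℕ => ((n : ℝ) + 1) * ‖D.Q n ψ‖ ^ 2) (f : L2) :
    D.Q 0 (D.cre f ψ) = 0 :=
  D.Q_tsum_eq_zero (d := 1) (fun n => D.Q_c n f ψ) (D.summable_cre hψ f) one_pos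

/-- The component of level `n` of `A(u)`, as a bounded operator. -/
def levelA (u : L2Sum) : ℕ → H →L[ℂ] H
  | 0 => star (D.c 0 u.fst)
  | n + 1 => star (D.c (n + 1) u.fst) + D.c n (star u.snd)

theorem Q_A {M n : ℕ} (hn : n < M) (u : L2Sum) (φ : H) :
    D.Q n (D.A M u φ) = D.levelA u n φ := by
  have h1 : D.Q n (∑ m ∈ range M, star (D.c m u.fst) φ) = star (D.c n u.fst) φ := by
    rw [map_sum, Finset.sum_eq_single n (fun m _ hm => ?_) fun h => absurd (mem_range.2 hn) h,
      Q_starc]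
    rw [← Q_starc, Q_Q, if_neg hm.symm]
  rw [A_apply, map_add, h1, map_sum]
  match n with
  | 0 =>
    rw [Finset.sum_eq_zero fun m _ => ?_, add_zero]
    · rfl
    · rw [← Q_c, Q_Q, if_neg (by omega)]
  | n + 1 =>
    rw [Finset.sum_eq_single n (fun m _ hm => ?_) fun h => absurd (mem_range.2 (by omega)) h, Q_c]
    · rfl
    · rw [← Q_c, Q_Q, if_neg (by omega)]

theorem Q_ann_add_cre (hψ : Summable fun n : ℕ => ((n : ℝ) + 1) * ‖D.Q n ψ‖ ^ 2) (u : L2Sum)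
    (n : ℕ) : D.Q n (D.ann u.fst ψ + D.cre (star u.snd) ψ) = D.levelA u n ψ := by
  rw [map_add, Q_ann D hψ]
  match n with
  | 0 => rw [Q_zero_cre D hψ, add_zero]; rfl
  | n + 1 => rw [Q_succ_cre D hψ]; rfl

theorem Q_P_apply (L n : ℕ) (φ : H) : D.Q n (D.P L φ) = if n < L then D.Q n φ else 0 := by
  split_ifs with h
  · rw [P_apply, map_sum, Finset.sum_eq_single n (fun m _ hm => ?_)
      fun h' => absurd (mem_range.2 h) h', Q_Q, if_pos rfl]
    rw [Q_Q, if_neg hm.symm]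
  · exact D.Q_P (not_lt.1 h) φ

/-- `A(u)` on the truncated vector is a truncation of the series for `A(u)`. -/
theorem A_P {L M : ℕ} (hM : L + 1 ≤ M) (u : L2Sum) (φ : H) : D.A M u (D.P (L + 1) φ) =
    ∑ m ∈ range L, star (D.c m u.fst) φ + ∑ m ∈ range (L + 1), D.c m (star u.snd) φ := by
  rw [A_apply]
  congr 1
  · rw [← Finset.sum_subset (Finset.range_mono (show L ≤ M by omega)) fun m _ hm => ?_]
    · refine Finset.sum_congr rfl fun m hm => ?_
      rw [Finset.mem_range] at hm
      rw [← starc_Q, Q_P_apply, if_pos (by omega), starc_Q]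
    · rw [Finset.mem_range] at hm
      rw [← starc_Q, Q_P_apply, if_neg (by omega), map_zero]
  · rw [← Finset.sum_subset (Finset.range_mono hM) fun m _ hm => ?_]
    · refine Finset.sum_congr rfl fun m hm => ?_
      rw [Finset.mem_range] at hm
      rw [← c_Q, Q_P_apply, if_pos (by omega), c_Q]
    · rw [Finset.mem_range] at hm
      rw [← c_Q, Q_P_apply, if_neg (by omega), map_zero]

theorem hasDerivAt_exp_genK (u : L2Sum) (s : ℝ) :
    HasDerivAt (fun s : ℝ => NormedSpace.exp ((1 + s) • genK k) u)
      (genK k (NormedSpace.exp ((1 + s) • genK k) u)) s := by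
  have h : ∀ (H : Type) [NormedAddCommGroup H] [InnerProductSpace ℂ H] [CompleteSpace H]
      (K : H →L[ℂ] H) (u : H), HasDerivAt (fun s : ℝ => NormedSpace.exp ((1 + s) • K) u)
      (K (NormedSpace.exp ((1 + s) • K) u)) s := by
    intro H _ _ _ K u
    let _ : NormedAlgebra ℚ (H →L[ℂ] H) := NormedAlgebra.restrictScalars ℚ ℂ _
    have h1 := hasDerivAt_exp_smul_const (𝕂 := ℝ) K (1 + s)
    have h2 := HasDerivAt.scomp (h := fun s : ℝ => 1 + s) s h1 ((hasDerivAt_id s).const_add 1)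
    rw [one_smul, ((Commute.refl K).smul_left (1 + s)).exp_left.eq] at h2
    exact ((ContinuousLinearMap.apply ℂ H u).restrictScalars ℝ).hasFDerivAt.comp_hasDerivAt s h2
  exact h _ _ _

/-- Conjugation by the group acts on the field operators as the Bogoliubov transformation
`exp (0, k; k̄, 0)`. -/
theorem expB_ann_add_cre (hψ : Summable fun n : ℕ => ((n : ℝ) + 1) * ‖D.Q n ψ‖ ^ 2)
    (u : L2Sum) : D.expB 1 (D.ann (theta k u).fst ψ + D.cre (star (theta k u).snd) ψ) =
      D.ann u.fst (D.expB 1 ψ) + D.cre (star u.snd) (D.expB 1 ψ) := by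
  set w := theta k u with hw
  have hv := hasDerivAt_exp_genK (k := k) u
  have hfin : ∀ {χ χ' : H}, D.IsFin χ → (∀ᶠ M in atTop, D.A M w χ = χ') →
      ∀ n, D.Q n (D.expB 1 χ') = D.levelA u n (D.expB 1 χ) := by
    intro χ χ' hχ hA n
    have h1 := D.tendsto_conj_A hv hχ (-1)
    have h0 : ∀ (H : Type) [NormedAddCommGroup H] [InnerProductSpace ℂ H] (K : H →L[ℂ] H) (u : H),
        NormedSpace.exp ((0 : ℝ) • K) u = u := by
      intro H _ _ K u
      rw [zero_smul, NormedSpace.exp_zero, one_apply_eq_self]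
    have h00 : NormedSpace.exp ((0 : ℝ) • genK k) u = u := h0 _ _ _
    simp only [add_neg_cancel, add_zero, one_smul, neg_neg] at h1
    rw [h00, ← theta_eq_exp, ← hw] at h1
    have h2 : Tendsto (fun M => D.U M (-1) (D.A M u (D.U M 1 χ))) atTop (𝓝 χ') := by
      have := h1.add (tendsto_const_nhds.congr' (hA.mono fun M h => h.symm))
      simpa using this
    have h3 := D.tendsto_U_comp (s := 1) h2
    have h4 : ∀ M (x : H), D.U M 1 (D.U M (-1) x) = x := fun M x => by
      simpa using D.U_neg_U M (-1) x
    simp only [h4] at h3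
    refine tendsto_nhds_unique (((D.Q n).continuous.tendsto _).comp h3) ?_
    refine (((D.levelA u n).continuous.tendsto _).comp (D.tendsto_U 1 χ)).congr' ?_
    filter_upwards [eventually_gt_atTop n] with M hM
    exact (D.Q_A hM u _).symm
  refine D.ext_Q fun n => ?_
  rw [Q_ann_add_cre D (D.summable_expB hψ 1)]
  have hP := (D.tendsto_P ψ).comp (tendsto_add_atTop_nat 1)
  have hl : Tendsto (fun L => ∑ m ∈ range L, star (D.c m w.fst) ψ +
      ∑ m ∈ range (L + 1), D.c m (star w.snd) ψ) atTop
      (𝓝 (D.ann w.fst ψ + D.cre (star w.snd) ψ)) :=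
    (D.summable_ann hψ _).hasSum.tendsto_sum_nat.add
      ((D.summable_cre hψ _).hasSum.tendsto_sum_nat.comp (tendsto_add_atTop_nat 1))
  have r1 := (((D.Q n * D.expB 1).continuous.tendsto _).comp hl)
  have r2 := (((D.levelA u n * D.expB 1).continuous.tendsto _).comp hP)
  refine tendsto_nhds_unique r1 (r2.congr fun L => ?_)
  refine (hfin (D.isFin_P (L + 1) ψ) ?_ n).symm
  filter_upwards [eventually_ge_atTop (L + 1)] with M hM
  exact D.A_P hM w ψ

end FieldSystem

/-! ### Creation operators on `n`-particle wave functions -/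

/-- The `n`-particle wave functions, not necessarily symmetric. -/
abbrev LN (n : ℕ) : Type := Lp ℂ 2 (volume : Measure (Fin n → E3))

theorem measurePreserving_extract {n : ℕ} (j : Fin (n + 1)) :
    MeasurePreserving (fun x : Fin (n + 1) → E3 => (x j, j.removeNth x)) volume volume :=
  volume_preserving_piFinSuccAbove (fun _ : Fin (n + 1) => E3) j

theorem measurePreserving_extract₂ {n : ℕ} (i : Fin (n + 2)) (j : Fin (n + 1)) :
    MeasurePreserving (fun x : Fin (n + 2) → E3 =>
      ((x i, x (i.succAbove j)), j.removeNth (i.removeNth x))) volume volume :=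
  ((volume_preserving_prodAssoc (α₁ := E3) (β₁ := E3) (γ₁ := Fin n → E3)).symm).comp
    (((MeasurePreserving.id (volume : Measure E3)).prod (measurePreserving_extract j)).comp
      (measurePreserving_extract i))

/-- The permutation `σ` of the particles, `(R_σ ψ)(x) = ψ(x ∘ σ)`. -/
def permOp {n : ℕ} (σ : Equiv.Perm (Fin n)) : LN n →ₗᵢ[ℂ] LN n :=
  pull (fun x => x ∘ σ) (measurePreserving_perm σ)

theorem coeFn_permOp {n : ℕ} (σ : Equiv.Perm (Fin n)) (ψ : LN n) :
    permOp σ ψ =ᵐ[volume] fun x => ψ (x ∘ σ) := coeFn_pull _ _ ψ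

theorem mem_sector {n : ℕ} {ψ : LN n} : ψ ∈ sector n ↔ ∀ σ, permOp σ ψ = ψ := by
  rw [sector, Submodule.mem_iInf]
  rfl

theorem permOp_one {n : ℕ} (ψ : LN n) : permOp 1 ψ = ψ := by
  refine Lp.ext ?_
  filter_upwards [coeFn_permOp 1 ψ] with x hx
  rw [hx]
  rfl

theorem permOp_permOp {n : ℕ} (σ τ : Equiv.Perm (Fin n)) (ψ : LN n) :
    permOp σ (permOp τ ψ) = permOp (σ * τ) ψ := by
  refine Lp.ext ?_
  filter_upwards [coeFn_permOp σ (permOp τ ψ), coeFn_permOp (σ * τ) ψ,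
    (measurePreserving_perm σ).quasiMeasurePreserving.ae (coeFn_permOp τ ψ)] with x h1 h2 h3
  rw [h1, h2, h3]
  rfl

theorem inner_permOp_left {n : ℕ} {φ : LN n} (hφ : φ ∈ sector n) (σ : Equiv.Perm (Fin n))
    (ψ : LN n) : ⟪permOp σ ψ, φ⟫_ℂ = ⟪ψ, φ⟫_ℂ := by
  conv_lhs => rw [← mem_sector.1 hφ σ]
  exact (permOp σ).inner_map_map ψ φ

/-- A wave function is symmetric if its inner products do not see permutations of the other
factor. -/
theorem mem_sector_of_inner {n : ℕ} {a : LN n}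
    (h : ∀ σ ψ, ⟪permOp σ ψ, a⟫_ℂ = ⟪ψ, a⟫_ℂ) : a ∈ sector n := by
  refine mem_sector.2 fun σ => ext_inner_left ℂ fun ψ => ?_
  have h1 : permOp σ (permOp σ⁻¹ ψ) = ψ := by rw [permOp_permOp, mul_inv_cancel, permOp_one]
  have h2 := (permOp σ).inner_map_map (permOp σ⁻¹ ψ) a
  have h3 := h σ (permOp σ⁻¹ ψ)
  rw [h1] at h2 h3
  rw [h2, h3]

theorem eq_of_inner_sector {n : ℕ} {a b : LN n} (ha : a ∈ sector n) (hb : b ∈ sector n)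
    (h : ∀ φ ∈ sector n, ⟪a, φ⟫_ℂ = ⟪b, φ⟫_ℂ) : a = b := by
  have := h (a - b) ((sector n).sub_mem ha hb)
  rw [← sub_eq_zero, ← inner_sub_left] at this
  exact sub_eq_zero.1 (inner_self_eq_zero.1 this)

/-- Adding a particle with wave function `f` at position `j`. -/
def tau {n : ℕ} (j : Fin (n + 1)) : L2 →L[ℂ] LN n →L[ℂ] LN (n + 1) :=
  (ContinuousLinearMap.compL ℂ (LN n) _ (LN (n + 1))
    (pull _ (measurePreserving_extract j)).toContinuousLinearMap).comp tens

theorem tau_apply {n : ℕ} (j : Fin (n + 1)) (f : L2) (ψ : LN n) :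
    tau j f ψ = pull _ (measurePreserving_extract j) (tens f ψ) := rfl

theorem coeFn_tau {n : ℕ} (j : Fin (n + 1)) (f : L2) (ψ : LN n) :
    tau j f ψ =ᵐ[volume] fun x => f (x j) * ψ (j.removeNth x) := by
  filter_upwards [coeFn_pull _ (measurePreserving_extract j) (tens f ψ),
    (measurePreserving_extract j).quasiMeasurePreserving.ae (coeFn_tens f ψ)] with x h1 h2
  rw [tau_apply, h1, h2]

theorem norm_tau {n : ℕ} (j : Fin (n + 1)) (f : L2) (ψ : LN n) : ‖tau j f ψ‖ = ‖f‖ * ‖ψ‖ := by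
  rw [tau_apply, LinearIsometry.norm_map, norm_tens]

/-- `σ'` is the permutation induced by `σ` on the particles other than `j`. -/
theorem permOp_tau {n : ℕ} {σ : Equiv.Perm (Fin (n + 1))} {j : Fin (n + 1)}
    {σ' : Equiv.Perm (Fin n)} (h : ∀ i, σ (j.succAbove i) = (σ j).succAbove (σ' i)) (f : L2)
    (ψ : LN n) : permOp σ (tau j f ψ) = tau (σ j) f (permOp σ' ψ) := by
  refine Lp.ext ?_
  filter_upwards [coeFn_permOp σ (tau j f ψ), coeFn_tau (σ j) f (permOp σ' ψ),
    (measurePreserving_perm σ).quasiMeasurePreserving.ae (coeFn_tau j f ψ),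
    (quasiMeasurePreserving_removeNth (σ j)).ae (coeFn_permOp σ' ψ)] with x h1 h2 h3 h4
  rw [h1, h2, h3, h4]
  have : j.removeNth (x ∘ σ) = (σ j).removeNth x ∘ σ' := by
    funext i
    exact congrArg x (h i)
  rw [this]
  rfl

theorem exists_perm_removeNth {n : ℕ} (σ : Equiv.Perm (Fin (n + 1))) (j : Fin (n + 1)) :
    ∃ σ' : Equiv.Perm (Fin n), ∀ i, σ (j.succAbove i) = (σ j).succAbove (σ' i) := by
  have h : ∀ i, ∃ i', (σ j).succAbove i' = σ (j.succAbove i) := fun i =>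
    Fin.exists_succAbove_eq (σ.injective.ne (Fin.succAbove_ne j i))
  choose s hs using h
  have hinj : Function.Injective s := fun a b hab => by
    have : σ (j.succAbove a) = σ (j.succAbove b) := by rw [← hs, ← hs, hab]
    exact Fin.succAbove_right_injective (σ.injective this)
  exact ⟨Equiv.ofBijective s (Finite.injective_iff_bijective.1 hinj), fun i => (hs i).symm⟩

/-- Tested against a symmetric function, the position of the added particle does not matter. -/
theorem inner_tau_eq {n : ℕ} {φ : LN (n + 1)} (hφ : φ ∈ sector (n + 1)) (j : Fin (n + 1)) (f : L2)
    (ψ : LN n) : ⟪tau j f ψ, φ⟫_ℂ = ⟪tau 0 f ψ, φ⟫_ℂ := by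
  rw [← inner_permOp_left hφ (Fin.cycleRange j).symm (tau 0 f ψ),
    permOp_tau (σ' := 1) (fun i => ?_), permOp_one, Fin.cycleRange_symm_zero]
  rw [Fin.succAbove_zero, Fin.cycleRange_symm_succ, Fin.cycleRange_symm_zero]
  rfl

theorem adjoint_tau_mem_sector {n : ℕ} {φ : LN (n + 1)} (hφ : φ ∈ sector (n + 1)) (f : L2) :
    ContinuousLinearMap.adjoint (tau 0 f) φ ∈ sector n := by
  refine mem_sector_of_inner fun σ ψ => ?_
  rw [ContinuousLinearMap.adjoint_inner_right, ContinuousLinearMap.adjoint_inner_right,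
    ← inner_permOp_left hφ (Equiv.Perm.decomposeFin.symm (0, σ)) (tau 0 f ψ),
    permOp_tau (σ' := σ) (fun i => by simp)]
  simp

/-- If the isometry `R` inverts the isometry `P` on the left, then `(P S)* = S* R`. -/
theorem adjoint_comp_isometry {A B C : Type*} [NormedAddCommGroup A] [InnerProductSpace ℂ A]
    [CompleteSpace A] [NormedAddCommGroup B] [InnerProductSpace ℂ B] [CompleteSpace B]
    [NormedAddCommGroup C] [InnerProductSpace ℂ C] [CompleteSpace C] (P : A →ₗᵢ[ℂ] B)
    (R : B →ₗᵢ[ℂ] A) (h : ∀ a, R (P a) = a) (S : C →L[ℂ] A) (b : B) :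
    ContinuousLinearMap.adjoint (P.toContinuousLinearMap.comp S) b =
      ContinuousLinearMap.adjoint S (R b) := by
  refine ext_inner_left ℂ fun c => ?_
  rw [ContinuousLinearMap.adjoint_inner_right, ContinuousLinearMap.adjoint_inner_right,
    ← R.inner_map_map]
  change ⟪R (P (S c)), R b⟫_ℂ = _
  rw [h]

theorem coeFn_adjoint_tau {n : ℕ} (f : L2) (φ : LN (n + 1)) :
    ContinuousLinearMap.adjoint (tau 0 f) φ =ᵐ[volume]
      fun x => ∫ y, star (f y) * φ (Fin.cons y x) := by
  have hcons : ∀ G : Lp ℂ 2 (volume : Measure (E3 × (Fin n → E3))),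
      pull _ (measurePreserving_cons n) (pull _ (measurePreserving_extract 0) G) = G := by
    intro G
    refine Lp.ext ?_
    filter_upwards [coeFn_pull _ (measurePreserving_cons n)
      (pull _ (measurePreserving_extract 0) G), (measurePreserving_cons n).quasiMeasurePreserving.ae
      (coeFn_pull _ (measurePreserving_extract 0) G)] with q h1 h2
    rw [h1, h2]
    simp
  have h : ContinuousLinearMap.adjoint (tau 0 f) φ =
      ContinuousLinearMap.adjoint (tens f) (pull _ (measurePreserving_cons n) φ) :=
    adjoint_comp_isometry _ _ hcons (tens f) φ
  rw [h]
  have h3 : ∀ᵐ q : (Fin n → E3) × E3, pull _ (measurePreserving_cons n) φ q.swap =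
      φ (Fin.cons q.2 q.1) :=
    Measure.measurePreserving_swap.quasiMeasurePreserving.ae
      (coeFn_pull _ (measurePreserving_cons n) φ)
  filter_upwards [coeFn_adjoint_tens f (pull _ (measurePreserving_cons n) φ),
    Measure.ae_ae_of_ae_prod h3] with x h1 h2
  rw [h1]
  refine integral_congr_ae ?_
  filter_upwards [h2] with y hy
  simp only [Prod.swap_prod_mk] at hy
  rw [hy]

theorem adjoint_tau_tau_zero {n : ℕ} (f g : L2) (ψ : LN n) :
    ContinuousLinearMap.adjoint (tau 0 f) (tau 0 g ψ) = ⟪f, g⟫_ℂ • ψ := by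
  refine ext_inner_left ℂ fun χ => ?_
  rw [ContinuousLinearMap.adjoint_inner_right, tau_apply, tau_apply, LinearIsometry.inner_map_map,
    inner_tens_tens, inner_smul_right]

theorem succ_removeNth_cons {n : ℕ} (i : Fin (n + 1)) (y : E3) (x : Fin (n + 1) → E3) :
    i.succ.removeNth (Fin.cons y x : Fin (n + 2) → E3) =
      (Fin.cons y (i.removeNth x) : Fin (n + 1) → E3) := by
  funext l
  refine Fin.cases ?_ (fun l => ?_) l
  · simp [Fin.removeNth]
  · simp [Fin.removeNth]

theorem adjoint_tau_tau_succ {n : ℕ} (f g : L2) (i : Fin (n + 1)) (ψ : LN (n + 1)) :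
    ContinuousLinearMap.adjoint (tau 0 f) (tau i.succ g ψ) =
      tau i g (ContinuousLinearMap.adjoint (tau 0 f) ψ) := by
  refine Lp.ext ?_
  have h3 : ∀ᵐ q : (Fin (n + 1) → E3) × E3, tau i.succ g ψ (Fin.cons q.2 q.1) =
      g ((Fin.cons q.2 q.1 : Fin (n + 2) → E3) i.succ) *
        ψ (i.succ.removeNth (Fin.cons q.2 q.1 : Fin (n + 2) → E3)) :=
    ((measurePreserving_cons (n + 1)).comp
      Measure.measurePreserving_swap).quasiMeasurePreserving.ae (coeFn_tau i.succ g ψ)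
  filter_upwards [coeFn_adjoint_tau f (tau i.succ g ψ),
    coeFn_tau i g (ContinuousLinearMap.adjoint (tau 0 f) ψ),
    (quasiMeasurePreserving_removeNth i).ae (coeFn_adjoint_tau f ψ),
    Measure.ae_ae_of_ae_prod h3] with x h1 h2 h4 h5
  rw [h1, h2, h4, ← integral_const_mul]
  refine integral_congr_ae ?_
  filter_upwards [h5] with y hy
  rw [hy, succ_removeNth_cons, Fin.cons_succ]
  ring

theorem tau_zero_tau_zero {n : ℕ} (f g : L2) (ψ : LN n) :
    tau 0 f (tau 0 g ψ) = tau 1 g (tau 0 f ψ) := by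
  refine Lp.ext ?_
  filter_upwards [coeFn_tau 0 f (tau 0 g ψ), coeFn_tau 1 g (tau 0 f ψ),
    (quasiMeasurePreserving_removeNth 0).ae (coeFn_tau 0 g ψ),
    (quasiMeasurePreserving_removeNth 1).ae (coeFn_tau 0 f ψ)] with x h1 h2 h3 h4
  rw [h1, h2, h3, h4]
  have e : (0 : Fin (n + 1)).removeNth ((0 : Fin (n + 2)).removeNth x) =
      (0 : Fin (n + 1)).removeNth ((1 : Fin (n + 2)).removeNth x) := by
    funext l
    refine congrArg x ?_
    rw [Fin.succAbove_zero, Fin.succAbove_zero, ← Fin.succ_zero_eq_one, Fin.succ_succAbove_succ,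
      Fin.succAbove_zero]
  rw [e]
  have e1 : (0 : Fin (n + 2)).removeNth x 0 = x 1 := rfl
  have e2 : (1 : Fin (n + 2)).removeNth x 0 = x 0 := by
    refine congrArg x ?_
    rw [← Fin.succ_zero_eq_one, Fin.succ_succAbove_zero]
  rw [e1, e2]
  ring

/-- The creation operator `a*(f)` from `n` to `n + 1` particles, extended to all wave
functions. -/
def cL (n : ℕ) : L2 →L[ℂ] LN n →L[ℂ] LN (n + 1) :=
  (Real.sqrt (n + 1) : ℂ)⁻¹ • ∑ j : Fin (n + 1), tau j

theorem cL_apply (n : ℕ) (f : L2) (ψ : LN n) :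
    cL n f ψ = (Real.sqrt (n + 1) : ℂ)⁻¹ • ∑ j : Fin (n + 1), tau j f ψ := by
  rw [cL, smul_apply, smul_apply, _root_.sum_apply, _root_.sum_apply]

theorem cL_mem_sector {n : ℕ} {ψ : LN n} (hψ : ψ ∈ sector n) (f : L2) :
    cL n f ψ ∈ sector (n + 1) := by
  refine mem_sector.2 fun σ => ?_
  rw [cL_apply, map_smul, map_sum]
  congr 1
  rw [← Equiv.sum_comp σ fun j => tau j f ψ]
  refine Finset.sum_congr rfl fun j _ => ?_
  obtain ⟨σ', h⟩ := exists_perm_removeNth σ j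
  rw [permOp_tau h, mem_sector.1 hψ]

theorem sqrt_mul_inv_sqrt_mul (n : ℕ) (z : ℂ) :
    (Real.sqrt (n + 1) : ℂ)⁻¹ * ((n + 1 : ℕ) * z) = (Real.sqrt (n + 1) : ℂ) * z := by
  have h : (Real.sqrt (n + 1) : ℂ) ≠ 0 := by
    rw [Ne, Complex.ofReal_eq_zero]
    positivity
  have h2 : ((n + 1 : ℕ) : ℂ) = (Real.sqrt (n + 1) : ℂ) * (Real.sqrt (n + 1) : ℂ) := by
    rw [← Complex.ofReal_mul, Real.mul_self_sqrt (by positivity)]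
    push_cast
    rfl
  rw [h2]
  field_simp

/-- On symmetric wave functions the adjoint of `a*(f)` is the annihilation operator. -/
theorem adjoint_cL {n : ℕ} {φ : LN (n + 1)} (hφ : φ ∈ sector (n + 1)) (f : L2) :
    ContinuousLinearMap.adjoint (cL n f) φ =
      (Real.sqrt (n + 1) : ℂ) • ContinuousLinearMap.adjoint (tau 0 f) φ := by
  refine ext_inner_left ℂ fun ψ => ?_
  rw [ContinuousLinearMap.adjoint_inner_right, inner_smul_right,
    ContinuousLinearMap.adjoint_inner_right, cL_apply, inner_smul_left, sum_inner]
  simp only [inner_tau_eq hφ]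
  rw [Finset.sum_const, Finset.card_univ, Fintype.card_fin, nsmul_eq_mul, map_inv₀,
    Complex.conj_ofReal, sqrt_mul_inv_sqrt_mul]

theorem inner_cL {n : ℕ} {φ : LN (n + 1)} (hφ : φ ∈ sector (n + 1)) (f : L2) (ψ : LN n) :
    ⟪cL n f ψ, φ⟫_ℂ = (Real.sqrt (n + 1) : ℂ) * ⟪tau 0 f ψ, φ⟫_ℂ := by
  rw [← ContinuousLinearMap.adjoint_inner_right, adjoint_cL hφ, inner_smul_right,
    ContinuousLinearMap.adjoint_inner_right]

theorem adjoint_cL_mem_sector {n : ℕ} {φ : LN (n + 1)} (hφ : φ ∈ sector (n + 1)) (f : L2) :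
    ContinuousLinearMap.adjoint (cL n f) φ ∈ sector n := by
  rw [adjoint_cL hφ]
  exact (sector n).smul_mem _ (adjoint_tau_mem_sector hφ f)

theorem norm_cL_le (n : ℕ) (f : L2) : ‖cL n f‖ ≤ √(n + 1) * ‖f‖ := by
  refine ContinuousLinearMap.opNorm_le_bound _ (by positivity) fun ψ => ?_
  have h : (0 : ℝ) < √(n + 1) := by positivity
  rw [cL_apply, norm_smul, norm_inv, Complex.norm_real, Real.norm_of_nonneg h.le]
  have h1 : ‖∑ j : Fin (n + 1), tau j f ψ‖ ≤ (n + 1) * (‖f‖ * ‖ψ‖) := by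
    refine (norm_sum_le _ _).trans_eq ?_
    simp only [norm_tau]
    rw [Finset.sum_const, Finset.card_univ, Fintype.card_fin, nsmul_eq_mul]
    push_cast
    rfl
  calc _ ≤ (√(n + 1))⁻¹ * ((n + 1) * (‖f‖ * ‖ψ‖)) := by gcongr
    _ = (√(n + 1))⁻¹ * ((√(n + 1) * √(n + 1)) * (‖f‖ * ‖ψ‖)) := by
        rw [Real.mul_self_sqrt (by positivity)]
    _ = _ := by field_simp

/-- Creation operators commute. -/
theorem cL_cL_comm {n : ℕ} {ψ : LN n} (hψ : ψ ∈ sector n) (f g : L2) :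
    cL (n + 1) f (cL n g ψ) = cL (n + 1) g (cL n f ψ) := by
  -- on symmetric vectors both sides add two particles at position `0`, in an order that symmetry
  -- makes irrelevant
  have h : ∀ f g, ∀ φ ∈ sector (n + 2), ⟪cL (n + 1) f (cL n g ψ), φ⟫_ℂ =
      (Real.sqrt ((n + 1 : ℕ) + 1) : ℂ) * ((Real.sqrt (n + 1) : ℂ) *
        ⟪tau 0 f (tau 0 g ψ), φ⟫_ℂ) := by
    intro f g φ hφ
    rw [inner_cL hφ, ← ContinuousLinearMap.adjoint_inner_right,
      inner_cL (adjoint_tau_mem_sector hφ f), ContinuousLinearMap.adjoint_inner_right]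
  refine eq_of_inner_sector (cL_mem_sector (cL_mem_sector hψ g) f)
    (cL_mem_sector (cL_mem_sector hψ f) g) fun φ hφ => ?_
  rw [h f g φ hφ, h g f φ hφ, tau_zero_tau_zero, inner_tau_eq hφ]

/-- The canonical commutation relation on the vacuum. -/
theorem adjoint_cL_cL_zero {ψ : LN 0} (hψ : ψ ∈ sector 0) (f g : L2) :
    ContinuousLinearMap.adjoint (cL 0 f) (cL 0 g ψ) = ⟪f, g⟫_ℂ • ψ := by
  rw [adjoint_cL (cL_mem_sector hψ g), cL_apply, map_smul, Fin.sum_univ_succ]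
  simp [adjoint_tau_tau_zero]

/-- The canonical commutation relation. -/
theorem adjoint_cL_cL_succ {n : ℕ} {ψ : LN (n + 1)} (hψ : ψ ∈ sector (n + 1)) (f g : L2) :
    ContinuousLinearMap.adjoint (cL (n + 1) f) (cL (n + 1) g ψ) =
      ⟪f, g⟫_ℂ • ψ + cL n g (ContinuousLinearMap.adjoint (cL n f) ψ) := by
  have h : (Real.sqrt ((n + 1 : ℕ) + 1) : ℂ) ≠ 0 := by
    rw [Ne, Complex.ofReal_eq_zero]
    positivity
  have h' : (Real.sqrt (n + 1) : ℂ) ≠ 0 := by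
    rw [Ne, Complex.ofReal_eq_zero]
    positivity
  rw [adjoint_cL (cL_mem_sector hψ g), cL_apply, map_smul, Fin.sum_univ_succ, map_add, map_sum,
    adjoint_tau_tau_zero, smul_smul, mul_inv_cancel₀ h, one_smul, adjoint_cL hψ, map_smul, cL_apply,
    smul_smul, mul_inv_cancel₀ h', one_smul]
  simp only [adjoint_tau_tau_succ]

/-! ### Pair creation -/

/-- Adding two particles with joint wave function `k` at positions `i` and `i.succAbove j`. -/
def tau₂ {n : ℕ} (i : Fin (n + 2)) (j : Fin (n + 1)) : Kernel →L[ℂ] LN n →L[ℂ] LN (n + 2) :=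
  (ContinuousLinearMap.compL ℂ (LN n) _ (LN (n + 2))
    (pull _ (measurePreserving_extract₂ i j)).toContinuousLinearMap).comp tens

theorem tau₂_apply {n : ℕ} (i : Fin (n + 2)) (j : Fin (n + 1)) (k : Kernel) (ψ : LN n) :
    tau₂ i j k ψ = pull _ (measurePreserving_extract₂ i j) (tens k ψ) := rfl

theorem coeFn_tau₂ {n : ℕ} (i : Fin (n + 2)) (j : Fin (n + 1)) (k : Kernel) (ψ : LN n) :
    tau₂ i j k ψ =ᵐ[volume]
      fun x => k (x i, x (i.succAbove j)) * ψ (j.removeNth (i.removeNth x)) := by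
  filter_upwards [coeFn_pull _ (measurePreserving_extract₂ i j) (tens k ψ),
    (measurePreserving_extract₂ i j).quasiMeasurePreserving.ae (coeFn_tens k ψ)] with x h1 h2
  rw [tau₂_apply, h1, h2]

theorem norm_tau₂ {n : ℕ} (i : Fin (n + 2)) (j : Fin (n + 1)) (k : Kernel) (ψ : LN n) :
    ‖tau₂ i j k ψ‖ = ‖k‖ * ‖ψ‖ := by
  rw [tau₂_apply, LinearIsometry.norm_map, norm_tens]

theorem tau₂_tens {n : ℕ} (i : Fin (n + 2)) (j : Fin (n + 1)) (f g : L2) (ψ : LN n) :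
    tau₂ i j (tens f g) ψ = tau i f (tau j g ψ) := by
  refine Lp.ext ?_
  have h : Measure.QuasiMeasurePreserving (fun x : Fin (n + 2) → E3 => (x i, x (i.succAbove j)))
      volume volume :=
    Measure.quasiMeasurePreserving_fst.comp (measurePreserving_extract₂ i j).quasiMeasurePreserving
  filter_upwards [coeFn_tau₂ i j (tens f g) ψ, coeFn_tau i f (tau j g ψ),
    (quasiMeasurePreserving_removeNth i).ae (coeFn_tau j g ψ), h.ae (coeFn_tens f g)]
    with x h1 h2 h3 h4
  rw [h1, h2, h3, h4, mul_assoc]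
  rfl

/-- Continuous linear maps on kernels that agree on product kernels are equal. -/
theorem ext_tens {E : Type*} [NormedAddCommGroup E] [NormedSpace ℂ E] {F G : Kernel →L[ℂ] E}
    (h : ∀ f g : L2, F (tens f g) = G (tens f g)) (k : Kernel) : F k = G k := by
  have : F = G := ContinuousLinearMap.ext_on dense_span_tens (by
    rintro _ ⟨f, g, rfl⟩
    exact h f g)
  rw [this]

theorem inner_tau₂_eq {n : ℕ} {φ : LN (n + 2)} (hφ : φ ∈ sector (n + 2)) (i : Fin (n + 2))
    (j : Fin (n + 1)) (k : Kernel) (ψ : LN n) :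
    ⟪φ, tau₂ i j k ψ⟫_ℂ = ⟪φ, tau₂ 1 0 k ψ⟫_ℂ := by
  refine ext_tens (F := (innerSL ℂ φ).comp ((tau₂ i j).flip ψ))
    (G := (innerSL ℂ φ).comp ((tau₂ 1 0).flip ψ)) (fun f g => ?_) k
  have h : ∀ (i : Fin (n + 2)) (j : Fin (n + 1)),
      ⟪φ, tau i f (tau j g ψ)⟫_ℂ = ⟪φ, tau 0 f (tau 0 g ψ)⟫_ℂ := by
    intro i j
    rw [← inner_conj_symm, inner_tau_eq hφ, ← ContinuousLinearMap.adjoint_inner_right,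
      inner_tau_eq (adjoint_tau_mem_sector hφ f), ContinuousLinearMap.adjoint_inner_right,
      inner_conj_symm]
  change ⟪φ, tau₂ i j (tens f g) ψ⟫_ℂ = ⟪φ, tau₂ 1 0 (tens f g) ψ⟫_ℂ
  rw [tau₂_tens, tau₂_tens, h, h 1 0]

/-- The pair creation operator `½ ∫∫ k(x,y) a*_x a*_y` from `n` to `n + 2` particles, extended to
all wave functions. -/
def bL (n : ℕ) : Kernel →L[ℂ] LN n →L[ℂ] LN (n + 2) :=
  ((1 / 2 : ℂ) * ((Real.sqrt (n + 1) : ℂ) * (Real.sqrt (n + 2) : ℂ))⁻¹) •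
    ∑ i : Fin (n + 2), ∑ j : Fin (n + 1), tau₂ i j

theorem bL_apply (n : ℕ) (k : Kernel) (ψ : LN n) : bL n k ψ =
    ((1 / 2 : ℂ) * ((Real.sqrt (n + 1) : ℂ) * (Real.sqrt (n + 2) : ℂ))⁻¹) •
      ∑ i : Fin (n + 2), ∑ j : Fin (n + 1), tau₂ i j k ψ := by
  simp only [bL, smul_apply, _root_.sum_apply]

theorem bL_tens {n : ℕ} (f g : L2) (ψ : LN n) :
    bL n (tens f g) ψ = (1 / 2 : ℂ) • cL (n + 1) f (cL n g ψ) := by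
  have h : ((n + 1 : ℕ) : ℝ) + 1 = n + 2 := by push_cast; ring
  rw [bL_apply, cL_apply, cL_apply, h, mul_smul]
  simp only [tau₂_tens, map_smul, map_sum]
  simp only [← Finset.smul_sum, mul_inv, mul_smul]
  rw [smul_comm (_⁻¹ : ℂ)]

theorem bL_mem_sector {n : ℕ} {ψ : LN n} (hψ : ψ ∈ sector n) (k : Kernel) :
    bL n k ψ ∈ sector (n + 2) := by
  refine mem_sector.2 fun σ => ?_
  refine ext_tens (F := (permOp σ).toContinuousLinearMap.comp ((bL n).flip ψ))
    (G := (bL n).flip ψ) (fun f g => ?_) k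
  change permOp σ (bL n (tens f g) ψ) = bL n (tens f g) ψ
  rw [bL_tens, map_smul, mem_sector.1 (cL_mem_sector (cL_mem_sector hψ g) f)]

/-- On symmetric wave functions the adjoint of pair creation is pair annihilation. -/
theorem adjoint_bL {n : ℕ} {φ : LN (n + 2)} (hφ : φ ∈ sector (n + 2)) (k : Kernel) :
    ContinuousLinearMap.adjoint (bL n k) φ =
      ((1 / 2 : ℂ) * ((Real.sqrt (n + 1) : ℂ) * (Real.sqrt (n + 2) : ℂ))) •
        ContinuousLinearMap.adjoint (tau₂ 1 0 k) φ := by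
  refine ext_inner_right ℂ fun ψ => ?_
  rw [ContinuousLinearMap.adjoint_inner_left, inner_smul_left,
    ContinuousLinearMap.adjoint_inner_left, bL_apply, inner_smul_right]
  simp only [inner_sum, inner_tau₂_eq hφ]
  have h : (Real.sqrt (n + 1) : ℂ) ≠ 0 := by
    rw [Ne, Complex.ofReal_eq_zero]
    positivity
  have h' : (Real.sqrt (n + 2) : ℂ) ≠ 0 := by
    rw [Ne, Complex.ofReal_eq_zero]
    positivity
  have h2 : ((n + 1 : ℕ) : ℂ) = (Real.sqrt (n + 1) : ℂ) * (Real.sqrt (n + 1) : ℂ) := by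
    rw [← Complex.ofReal_mul, Real.mul_self_sqrt (by positivity)]
    push_cast
    rfl
  have h3 : ((n + 2 : ℕ) : ℂ) = (Real.sqrt (n + 2) : ℂ) * (Real.sqrt (n + 2) : ℂ) := by
    rw [← Complex.ofReal_mul, Real.mul_self_sqrt (by positivity)]
    push_cast
    rfl
  simp only [Finset.sum_const, Finset.card_univ, Fintype.card_fin, nsmul_eq_mul, map_mul,
    Complex.conj_ofReal, h2, h3, map_div₀, map_one, Complex.conj_ofNat]
  field_simp

theorem adjoint_bL_mem_sector {n : ℕ} {φ : LN (n + 2)} (hφ : φ ∈ sector (n + 2)) (k : Kernel) :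
    ContinuousLinearMap.adjoint (bL n k) φ ∈ sector n := by
  refine mem_sector_of_inner fun σ ψ => ?_
  rw [ContinuousLinearMap.adjoint_inner_right, ContinuousLinearMap.adjoint_inner_right,
    ← inner_conj_symm, ← inner_conj_symm (bL n k ψ)]
  congr 1
  refine ext_tens (F := (innerSL ℂ φ).comp ((bL n).flip (permOp σ ψ)))
    (G := (innerSL ℂ φ).comp ((bL n).flip ψ)) (fun f g => ?_) k
  change ⟪φ, bL n (tens f g) (permOp σ ψ)⟫_ℂ = ⟪φ, bL n (tens f g) ψ⟫_ℂ
  rw [bL_tens, bL_tens, inner_smul_right, inner_smul_right, ← inner_conj_symm,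
    ← inner_conj_symm φ (cL (n + 1) f _), ← ContinuousLinearMap.adjoint_inner_right (cL (n + 1) f),
    ← ContinuousLinearMap.adjoint_inner_right (cL (n + 1) f),
    ← ContinuousLinearMap.adjoint_inner_right (cL n g),
    ← ContinuousLinearMap.adjoint_inner_right (cL n g),
    inner_permOp_left (adjoint_cL_mem_sector (adjoint_cL_mem_sector hφ f) g)]

theorem coeFn_adjoint_tau₂ {n : ℕ} (k : Kernel) (φ : LN (n + 2)) :
    ContinuousLinearMap.adjoint (tau₂ (n := n) 1 0 k) φ =ᵐ[volume] fun x =>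
      ∫ q : E3 × E3, star (k q) * φ (Fin.cons q.2 (Fin.cons q.1 x : Fin (n + 1) → E3)) := by
  have hcons : ∀ G : Lp ℂ 2 (volume : Measure ((E3 × E3) × (Fin n → E3))),
      pull _ (measurePreserving_cons_cons n) (pull _ (measurePreserving_extract₂ 1 0) G) = G := by
    intro G
    refine Lp.ext ?_
    filter_upwards [coeFn_pull _ (measurePreserving_cons_cons n)
      (pull _ (measurePreserving_extract₂ 1 0) G),
      (measurePreserving_cons_cons n).quasiMeasurePreserving.ae
      (coeFn_pull _ (measurePreserving_extract₂ 1 0) G)] with q h1 h2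
    rw [h1, h2, ← Fin.succ_zero_eq_one, Fin.succ_succAbove_zero, succ_removeNth_cons]
    simp
  have h : ContinuousLinearMap.adjoint (tau₂ 1 0 k) φ =
      ContinuousLinearMap.adjoint (tens k) (pull _ (measurePreserving_cons_cons n) φ) :=
    adjoint_comp_isometry _ _ hcons (tens k) φ
  rw [h]
  have h3 : ∀ᵐ q : (Fin n → E3) × (E3 × E3), pull _ (measurePreserving_cons_cons n) φ q.swap =
      φ (Fin.cons q.2.2 (Fin.cons q.2.1 q.1 : Fin (n + 1) → E3)) :=
    Measure.measurePreserving_swap.quasiMeasurePreserving.ae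
      (coeFn_pull _ (measurePreserving_cons_cons n) φ)
  filter_upwards [coeFn_adjoint_tens k (pull _ (measurePreserving_cons_cons n) φ),
    Measure.ae_ae_of_ae_prod h3] with x h1 h2
  rw [h1]
  refine integral_congr_ae ?_
  filter_upwards [h2] with y hy
  simp only [Prod.swap_prod_mk] at hy
  rw [hy]

theorem norm_bL_le (n : ℕ) (k : Kernel) : ‖bL n k‖ ≤ ‖k‖ * (n + 1) := by
  refine ContinuousLinearMap.opNorm_le_bound _ (by positivity) fun ψ => ?_
  have h : (0 : ℝ) < √(n + 1) := by positivity
  have h' : (0 : ℝ) < √(n + 2) := by positivity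
  have h1 : ‖∑ i : Fin (n + 2), ∑ j : Fin (n + 1), tau₂ i j k ψ‖ ≤
      (n + 2) * ((n + 1) * (‖k‖ * ‖ψ‖)) := by
    refine (norm_sum_le _ _).trans ((Finset.sum_le_sum fun i _ => norm_sum_le _ _).trans_eq ?_)
    simp only [norm_tau₂]
    simp only [Finset.sum_const, Finset.card_univ, Fintype.card_fin, nsmul_eq_mul]
    push_cast
    rfl
  have e1 : √((n : ℝ) + 1) * √((n : ℝ) + 1) = n + 1 := Real.mul_self_sqrt (by positivity)
  have e2 : √((n : ℝ) + 2) * √((n : ℝ) + 2) = n + 2 := Real.mul_self_sqrt (by positivity)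
  have e3 : √((n : ℝ) + 1) * √((n : ℝ) + 2) ≤ 2 * (n + 1) := by
    have : √((n : ℝ) + 2) ≤ 2 * √((n : ℝ) + 1) := by
      refine abs_le_of_sq_le_sq' ?_ (by positivity) |>.2
      rw [mul_pow, Real.sq_sqrt (by positivity), Real.sq_sqrt (by positivity)]
      linarith [(Nat.cast_nonneg n : (0 : ℝ) ≤ n)]
    nlinarith
  rw [bL_apply, norm_smul]
  have e4 : ‖(1 / 2 : ℂ) * ((Real.sqrt (n + 1) : ℂ) * (Real.sqrt (n + 2) : ℂ))⁻¹‖ =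
      1 / 2 * (√(n + 1) * √(n + 2))⁻¹ := by
    rw [norm_mul, norm_inv, norm_mul, Complex.norm_real, Complex.norm_real,
      Real.norm_of_nonneg h.le, Real.norm_of_nonneg h'.le]
    norm_num
  rw [e4]
  calc _ ≤ 1 / 2 * (√(n + 1) * √(n + 2))⁻¹ * ((n + 2) * ((n + 1) * (‖k‖ * ‖ψ‖))) := by gcongr
    _ = 1 / 2 * (√(n + 1) * √(n + 2))⁻¹ * ((√(n + 2) * √(n + 2)) * ((√(n + 1) * √(n + 1)) *
        (‖k‖ * ‖ψ‖))) := by rw [e1, e2]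
    _ = 1 / 2 * (√(n + 1) * √(n + 2)) * (‖k‖ * ‖ψ‖) := by field_simp
    _ ≤ 1 / 2 * (2 * (n + 1)) * (‖k‖ * ‖ψ‖) := by gcongr
    _ = _ := by ring

/-- Pair creation commutes with creation. -/
theorem cL_bL {n : ℕ} {ψ : LN n} (hψ : ψ ∈ sector n) (f : L2) (k : Kernel) :
    cL (n + 2) f (bL n k ψ) = bL (n + 1) k (cL n f ψ) := by
  refine ext_tens (F := (cL (n + 2) f).comp ((bL n).flip ψ)) (G := (bL (n + 1)).flip (cL n f ψ))
    (fun g h => ?_) k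
  change cL (n + 2) f (bL n (tens g h) ψ) = bL (n + 1) (tens g h) (cL n f ψ)
  rw [bL_tens, bL_tens, map_smul, cL_cL_comm (cL_mem_sector hψ h), cL_cL_comm hψ]

theorem kop_tens_star (f g h : L2) : kop (tens g h) (star f) = ⟪f, h⟫_ℂ • g := by
  rw [kop_tens, inner_star_star, ← inner_conj_symm f h]
  rfl

/-- The map `k ↦ ½ (k + kᵗ) f̄`. -/
def symApply (f : L2) : Kernel →L[ℂ] L2 :=
  (1 / 2 : ℂ) • (kopL.flip (star f) + (kopL.flip (star f)).comp transp.toContinuousLinearMap)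

theorem symApply_tens (f g h : L2) :
    symApply f (tens g h) = (1 / 2 : ℂ) • (⟪f, h⟫_ℂ • g + ⟪f, g⟫_ℂ • h) := by
  change (1 / 2 : ℂ) • (kop (tens g h) (star f) + kop (transp (tens g h)) (star f)) = _
  rw [transp_tens, kop_tens_star, kop_tens_star]

theorem symApply_of_isSymm (f : L2) {k : Kernel} (hk : IsSymm k) :
    symApply f k = kop k (star f) := by
  change (1 / 2 : ℂ) • (kop k (star f) + kop (transp k) (star f)) = _
  rw [(isSymm_iff k).1 hk, ← two_smul ℂ, smul_smul]
  norm_num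

/-- On the vacuum sector, `[a(f), b] = a*(k f̄)` without the second term. -/
theorem adjoint_cL_bL_zero {ψ : LN 0} (hψ : ψ ∈ sector 0) (f : L2) (k : Kernel) :
    ContinuousLinearMap.adjoint (cL 1 f) (bL 0 k ψ) = cL 0 (symApply f k) ψ := by
  refine ext_tens (F := (ContinuousLinearMap.adjoint (cL 1 f)).comp ((bL 0).flip ψ))
    (G := ((cL 0).flip ψ).comp (symApply f)) (fun g h => ?_) k
  change ContinuousLinearMap.adjoint (cL 1 f) (bL 0 (tens g h) ψ) = cL 0 (symApply f (tens g h)) ψ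
  rw [bL_tens, map_smul, adjoint_cL_cL_succ (cL_mem_sector hψ h), adjoint_cL_cL_zero hψ,
    symApply_tens]
  simp only [map_smul, map_add, smul_apply, add_apply]
  rw [add_comm]

/-- The commutation relation `[a(f), b] = a*(k f̄)` of annihilation and pair creation, for symmetric
`k`. Both sides are linear in `k`, so that it suffices to check it for `k = g ⊗ h`. -/
theorem adjoint_cL_bL_succ {n : ℕ} {ψ : LN (n + 1)} (hψ : ψ ∈ sector (n + 1)) (f : L2)
    (k : Kernel) : ContinuousLinearMap.adjoint (cL (n + 2) f) (bL (n + 1) k ψ) =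
      bL n k (ContinuousLinearMap.adjoint (cL n f) ψ) + cL (n + 1) (symApply f k) ψ := by
  refine ext_tens (F := (ContinuousLinearMap.adjoint (cL (n + 2) f)).comp ((bL (n + 1)).flip ψ))
    (G := (bL n).flip (ContinuousLinearMap.adjoint (cL n f) ψ) +
      ((cL (n + 1)).flip ψ).comp (symApply f)) (fun g h => ?_) k
  change ContinuousLinearMap.adjoint (cL (n + 2) f) (bL (n + 1) (tens g h) ψ) =
    bL n (tens g h) (ContinuousLinearMap.adjoint (cL n f) ψ) +
      cL (n + 1) (symApply f (tens g h)) ψ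
  rw [bL_tens, bL_tens, map_smul, adjoint_cL_cL_succ (cL_mem_sector hψ h),
    adjoint_cL_cL_succ hψ, symApply_tens]
  simp only [map_smul, map_add, smul_apply, add_apply, smul_add]
  abel

/-! ### Fock space as a graded Hilbert space -/

/-- The wave function of the `n`-particle component, as an element of `L²(ℝ³ⁿ)`. -/
def level (n : ℕ) : Fock →L[ℂ] LN n :=
  (sector n).subtypeL.comp (lp.evalCLM ℂ (fun n : ℕ => sector n) 2 n)

theorem level_apply (n : ℕ) (ψ : Fock) : level n ψ = (ψ n : LN n) := rfl

theorem norm_level (n : ℕ) (ψ : Fock) : ‖level n ψ‖ = ‖ψ n‖ := rfl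

theorem level_mem_sector (n : ℕ) (ψ : Fock) : level n ψ ∈ sector n := (ψ n).2

theorem norm_level_le (n : ℕ) : ‖level n‖ ≤ 1 :=
  ContinuousLinearMap.opNorm_le_bound _ zero_le_one fun ψ => by
    rw [one_mul, norm_level]
    exact lp.norm_apply_le_norm two_ne_zero ψ n

/-- The vector of Fock space whose only nonzero component is the symmetrization of a given
`n`-particle wave function. -/
def ofLevel (n : ℕ) : LN n →L[ℂ] Fock := ContinuousLinearMap.adjoint (level n)

theorem ofLevel_of_mem {n : ℕ} {φ : LN n} (hφ : φ ∈ sector n) :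
    ofLevel n φ = lp.single 2 n (⟨φ, hφ⟩ : sector n) := by
  refine ext_inner_right ℂ fun ψ => ?_
  rw [ofLevel, ContinuousLinearMap.adjoint_inner_left, lp.inner_single_left]
  rfl

theorem level_ofLevel {n : ℕ} {φ : LN n} (hφ : φ ∈ sector n) : level n (ofLevel n φ) = φ := by
  rw [ofLevel_of_mem hφ, level_apply, lp.single_apply_self]

theorem level_ofLevel_ne {n m : ℕ} (h : m ≠ n) {φ : LN n} (hφ : φ ∈ sector n) :
    level m (ofLevel n φ) = 0 := by
  rw [ofLevel_of_mem hφ, level_apply, lp.single_apply_ne _ _ _ h]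
  rfl

theorem norm_ofLevel_le (n : ℕ) : ‖ofLevel n‖ ≤ 1 := by
  rw [ofLevel, LinearIsometryEquiv.norm_map]
  exact norm_level_le n

theorem star_comp_comp {H A B : Type*} [NormedAddCommGroup A] [InnerProductSpace ℂ A]
    [CompleteSpace A] [NormedAddCommGroup B] [InnerProductSpace ℂ B] [CompleteSpace B]
    [NormedAddCommGroup H] [InnerProductSpace ℂ H] [CompleteSpace H] (i : H →L[ℂ] A)
    (j : H →L[ℂ] B) (X : A →L[ℂ] B) :
    star ((ContinuousLinearMap.adjoint j).comp (X.comp i)) =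
      (ContinuousLinearMap.adjoint i).comp ((ContinuousLinearMap.adjoint X).comp j) := by
  rw [ContinuousLinearMap.star_eq_adjoint, ContinuousLinearMap.adjoint_comp,
    ContinuousLinearMap.adjoint_comp, ContinuousLinearMap.adjoint_adjoint]
  rfl

/-- The operator on Fock space that acts as `X` from the `n`-particle to the `m`-particle sector,
and as zero on the other sectors. -/
def lift {n m : ℕ} (X : LN n →L[ℂ] LN m) : Fock →L[ℂ] Fock :=
  (ofLevel m).comp (X.comp (level n))

theorem lift_apply {n m : ℕ} (X : LN n →L[ℂ] LN m) (ψ : Fock) :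
    lift X ψ = ofLevel m (X (level n ψ)) := rfl

theorem star_lift {n m : ℕ} (X : LN n →L[ℂ] LN m) :
    star (lift X) = lift (ContinuousLinearMap.adjoint X) :=
  star_comp_comp (level n) (level m) X

theorem norm_lift_le {n m : ℕ} (X : LN n →L[ℂ] LN m) : ‖lift X‖ ≤ ‖X‖ := by
  refine ContinuousLinearMap.opNorm_le_bound _ (norm_nonneg X) fun ψ => ?_
  calc ‖ofLevel m (X (level n ψ))‖ ≤ 1 * (‖X‖ * (1 * ‖ψ‖)) :=
        (ofLevel m).le_of_opNorm_le_of_le (norm_ofLevel_le m)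
          (X.le_opNorm_of_le ((level n).le_of_opNorm_le (norm_level_le n) ψ))
    _ = ‖X‖ * ‖ψ‖ := by rw [one_mul, one_mul]

theorem lift_add {n m : ℕ} (X Y : LN n →L[ℂ] LN m) : lift (X + Y) = lift X + lift Y := by
  ext1 ψ
  exact (ofLevel m).map_add (X (level n ψ)) (Y (level n ψ))

theorem lift_congr {n m : ℕ} {X Y : LN n →L[ℂ] LN m} (h : ∀ φ ∈ sector n, X φ = Y φ) :
    lift X = lift Y := by
  ext1 ψ
  exact congrArg (ofLevel m) (h _ (level_mem_sector n ψ))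

theorem lift_mul_lift {n m p : ℕ} (X : LN m →L[ℂ] LN p) {Y : LN n →L[ℂ] LN m}
    (hY : ∀ φ ∈ sector n, Y φ ∈ sector m) : lift X * lift Y = lift (X.comp Y) := by
  ext1 ψ
  exact congrArg (fun φ => ofLevel p (X φ)) (level_ofLevel (hY _ (level_mem_sector n ψ)))

theorem lift_mul_lift_ne {n m m' p : ℕ} (h : m' ≠ m) (X : LN m' →L[ℂ] LN p) {Y : LN n →L[ℂ] LN m}
    (hY : ∀ φ ∈ sector n, Y φ ∈ sector m) : lift X * lift Y = 0 := by
  ext1 ψ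
  refine (congrArg (fun φ => ofLevel p (X φ))
    (level_ofLevel_ne h (hY _ (level_mem_sector n ψ)))).trans ?_
  exact (congrArg (ofLevel p) X.map_zero).trans (ofLevel p).map_zero

/-- The pair creation operators on Fock space, and the projections onto its sectors. -/
def fockLadder (k : Kernel) : LadderSystem Fock where
  Q n := lift (1 : LN n →L[ℂ] LN n)
  b n := lift (bL n k)
  κ := ‖k‖
  κ_nonneg := norm_nonneg k
  star_Q n := by rw [star_lift, ← ContinuousLinearMap.star_eq_adjoint, star_one]
  Q_mul_Q n m := by
    split_ifs with h
    · subst h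
      exact lift_mul_lift _ fun φ hφ => hφ
    · exact lift_mul_lift_ne h _ fun φ hφ => hφ
  hasSum_Q ψ := by
    have h := lp.hasSum_single (E := fun n : ℕ => sector n) ENNReal.ofNat_ne_top ψ
    refine h.congr_fun fun n => ?_
    exact ofLevel_of_mem (level_mem_sector n ψ)
  Q_mul_b n := lift_mul_lift 1 fun φ hφ => bL_mem_sector hφ k
  b_mul_Q n := lift_mul_lift (bL n k) fun φ hφ => hφ
  norm_b_le n := (norm_lift_le _).trans (norm_bL_le n k)

/-- The map `X ↦ j X i` between spaces of bounded operators. -/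
def sandwich {A B H H' : Type*} [NormedAddCommGroup A] [NormedSpace ℂ A] [NormedAddCommGroup B]
    [NormedSpace ℂ B] [NormedAddCommGroup H] [NormedSpace ℂ H] [NormedAddCommGroup H']
    [NormedSpace ℂ H'] (j : B →L[ℂ] H') (i : H →L[ℂ] A) : (A →L[ℂ] B) →L[ℂ] H →L[ℂ] H' :=
  (ContinuousLinearMap.compL ℂ H B H' j).comp ((ContinuousLinearMap.compL ℂ H A B).flip i)

/-- The creation operator `a*(f)` from the `n`-particle to the `n + 1`-particle sector. -/
def fockC (n : ℕ) : L2 →L[ℂ] Fock →L[ℂ] Fock :=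
  (sandwich (ofLevel (n + 1)) (level n)).comp (cL n)

theorem star_fockC (n : ℕ) (f : L2) :
    star (fockC n f) = lift (ContinuousLinearMap.adjoint (cL n f)) := star_lift (cL n f)

theorem lift_one_mul_fockC (n : ℕ) (f : L2) :
    lift (1 : LN (n + 1) →L[ℂ] LN (n + 1)) * fockC n f = fockC n f :=
  lift_mul_lift 1 fun _ hφ => cL_mem_sector hφ f

theorem fockC_mul_lift_one (n : ℕ) (f : L2) :
    fockC n f * lift (1 : LN n →L[ℂ] LN n) = fockC n f :=
  lift_mul_lift (cL n f) fun _ hφ => hφ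

theorem fockC_mul_lift_bL (n : ℕ) (f : L2) (k : Kernel) :
    fockC (n + 2) f * lift (bL n k) = lift (bL (n + 1) k) * fockC n f := by
  have h1 : lift (cL (n + 2) f) * lift (bL n k) = lift ((cL (n + 2) f).comp (bL n k)) :=
    lift_mul_lift _ fun φ hφ => bL_mem_sector hφ k
  have h2 : lift (bL (n + 1) k) * lift (cL n f) = lift ((bL (n + 1) k).comp (cL n f)) :=
    lift_mul_lift _ fun φ hφ => cL_mem_sector hφ f
  exact h1.trans ((lift_congr fun φ hφ => cL_bL hφ f k).trans h2.symm)

theorem star_fockC_mul_lift_bL_zero (f : L2) (k : Kernel) :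
    star (fockC 1 f) * lift (bL 0 k) = fockC 0 (symApply f k) := by
  have h1 : lift (ContinuousLinearMap.adjoint (cL 1 f)) * lift (bL 0 k) =
      lift ((ContinuousLinearMap.adjoint (cL 1 f)).comp (bL 0 k)) :=
    lift_mul_lift _ fun φ hφ => bL_mem_sector hφ k
  exact (congrArg (· * lift (bL 0 k)) (star_fockC 1 f)).trans
    (h1.trans (lift_congr fun φ hφ => adjoint_cL_bL_zero hφ f k))

theorem star_fockC_mul_lift_bL_succ (n : ℕ) (f : L2) (k : Kernel) :
    star (fockC (n + 2) f) * lift (bL (n + 1) k) =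
      lift (bL n k) * star (fockC n f) + fockC (n + 1) (symApply f k) := by
  have h1 : lift (ContinuousLinearMap.adjoint (cL (n + 2) f)) * lift (bL (n + 1) k) =
      lift ((ContinuousLinearMap.adjoint (cL (n + 2) f)).comp (bL (n + 1) k)) :=
    lift_mul_lift _ fun φ hφ => bL_mem_sector hφ k
  have h2 : lift (bL n k) * lift (ContinuousLinearMap.adjoint (cL n f)) =
      lift ((bL n k).comp (ContinuousLinearMap.adjoint (cL n f))) :=
    lift_mul_lift _ fun φ hφ => adjoint_cL_mem_sector hφ f
  have h3 : lift ((ContinuousLinearMap.adjoint (cL (n + 2) f)).comp (bL (n + 1) k)) =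
      lift ((bL n k).comp (ContinuousLinearMap.adjoint (cL n f)) + cL (n + 1) (symApply f k)) := by
    refine lift_congr fun φ hφ => ?_
    rw [add_apply, ContinuousLinearMap.comp_apply, ContinuousLinearMap.comp_apply]
    exact adjoint_cL_bL_succ hφ f k
  calc _ = lift (ContinuousLinearMap.adjoint (cL (n + 2) f)) * lift (bL (n + 1) k) :=
        congrArg (· * lift (bL (n + 1) k)) (star_fockC (n + 2) f)
    _ = lift (bL n k) * lift (ContinuousLinearMap.adjoint (cL n f)) +
        lift (cL (n + 1) (symApply f k)) := h1.trans (h3.trans ((lift_add _ _).trans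
          (congrArg (· + lift (cL (n + 1) (symApply f k))) h2.symm)))
    _ = _ := congrArg (fun S => lift (bL n k) * S + lift (cL (n + 1) (symApply f k)))
        (star_fockC n f).symm

/-- The creation and pair creation operators on Fock space. -/
def fockField (k : Kernel) (hk : IsSymm k) : FieldSystem Fock k where
  toLadderSystem := fockLadder k
  c := fockC
  Q_mul_c := lift_one_mul_fockC
  c_mul_Q := fockC_mul_lift_one
  norm_c_le n f := (norm_lift_le (cL n f)).trans (norm_cL_le n f)
  c_mul_b n f := fockC_mul_lift_bL n f k
  starc_mul_b_zero f :=
    (star_fockC_mul_lift_bL_zero f k).trans (congrArg (fockC 0) (symApply_of_isSymm f hk))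
  starc_mul_b_succ n f :=
    (star_fockC_mul_lift_bL_succ n f k).trans (congrArg
      (fun g => lift (bL n k) * star (fockC n f) + fockC (n + 1) g) (symApply_of_isSymm f hk))

/-! ### The operators given by the sector formulas -/

theorem Lp_coeFn_sum {X ι : Type*} [MeasurableSpace X] {μ : Measure X} (s : Finset ι)
    (F : ι → Lp ℂ 2 μ) : (↑(∑ i ∈ s, F i) : X → ℂ) =ᵐ[μ] fun x => ∑ i ∈ s, F i x := by
  classical
  induction s using Finset.induction_on with
  | empty =>
    filter_upwards [Lp.coeFn_zero ℂ 2 μ] with x hx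
    simpa using hx
  | insert i s hi ih =>
    rw [Finset.sum_insert hi]
    filter_upwards [ih, Lp.coeFn_add (F i) (∑ i ∈ s, F i)] with x h1 h2
    rw [h2, Pi.add_apply, h1, Finset.sum_insert hi]

theorem coeFn_cL {n : ℕ} (f : L2) (φ : LN n) : cL n f φ =ᵐ[volume] fun x =>
    (Real.sqrt (n + 1) : ℂ)⁻¹ * ∑ j : Fin (n + 1), f (x j) * φ (j.removeNth x) := by
  rw [cL_apply]
  filter_upwards [Lp.coeFn_smul (Real.sqrt (n + 1) : ℂ)⁻¹ (∑ j : Fin (n + 1), tau j f φ),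
    Lp_coeFn_sum Finset.univ fun j : Fin (n + 1) => tau j f φ,
    ae_all_iff.2 fun j : Fin (n + 1) => coeFn_tau j f φ] with x h1 h2 h3
  rw [h1, Pi.smul_apply, h2, smul_eq_mul]
  simp only [h3]

theorem coeFn_bL {n : ℕ} (k : Kernel) (φ : LN n) : (2 : ℂ) • bL n k φ =ᵐ[volume] fun x =>
    ((Real.sqrt (n + 1) : ℂ) * (Real.sqrt (n + 2) : ℂ))⁻¹ *
      ∑ i : Fin (n + 2), ∑ j : Fin (n + 1),
        k (x i, x (i.succAbove j)) * φ (j.removeNth (i.removeNth x)) := by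
  rw [bL_apply, smul_smul, ← mul_assoc, mul_one_div_cancel two_ne_zero, one_mul]
  filter_upwards [Lp.coeFn_smul ((Real.sqrt (n + 1) : ℂ) * (Real.sqrt (n + 2) : ℂ))⁻¹
      (∑ i : Fin (n + 2), ∑ j : Fin (n + 1), tau₂ i j k φ),
    Lp_coeFn_sum Finset.univ fun i : Fin (n + 2) => ∑ j : Fin (n + 1), tau₂ i j k φ,
    ae_all_iff.2 fun i : Fin (n + 2) =>
      Lp_coeFn_sum Finset.univ fun j : Fin (n + 1) => tau₂ i j k φ,
    ae_all_iff.2 fun i : Fin (n + 2) => ae_all_iff.2 fun j : Fin (n + 1) =>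
      coeFn_tau₂ i j k φ] with x h1 h2 h3 h4
  rw [h1, Pi.smul_apply, h2, smul_eq_mul]
  simp only [h3, h4]

theorem SectorFormula.maps_iff (Φ : SectorFormula) (ψ φ : Fock) :
    Φ.Maps ψ φ ↔ ∀ n, level n φ =ᵐ[volume] Φ.toFun ψ n := Iff.rfl

theorem pairCreation_maps (k : Kernel) {ψ φ : Fock} (h0 : level 0 φ = 0) (h1 : level 1 φ = 0)
    (h2 : ∀ n, level (n + 2) φ = (2 : ℂ) • bL n k (level n ψ)) :
    (pairCreationFormula k).Maps ψ φ := by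
  refine ((pairCreationFormula k).maps_iff ψ φ).2 fun n => ?_
  match n with
  | 0 =>
    rw [h0]
    exact Lp.coeFn_zero _ _ _
  | 1 =>
    rw [h1]
    exact Lp.coeFn_zero _ _ _
  | n + 2 =>
    rw [h2]
    exact coeFn_bL k (level n ψ)

theorem pairAnnihilation_maps (k : Kernel) {ψ φ : Fock}
    (h : ∀ n, level n φ = (2 : ℂ) • ContinuousLinearMap.adjoint (bL n k) (level (n + 2) ψ)) :
    (pairAnnihilationFormula k).Maps ψ φ := by
  refine ((pairAnnihilationFormula k).maps_iff ψ φ).2 fun n => ?_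
  rw [h, adjoint_bL (level_mem_sector _ _), smul_smul, ← mul_assoc,
    mul_one_div_cancel two_ne_zero, one_mul]
  filter_upwards [Lp.coeFn_smul ((Real.sqrt (n + 1) : ℂ) * (Real.sqrt (n + 2) : ℂ))
      (ContinuousLinearMap.adjoint (tau₂ 1 0 k) (level (n + 2) ψ)),
    coeFn_adjoint_tau₂ k (level (n + 2) ψ)] with x h1 h2
  rw [h1, Pi.smul_apply, h2]
  rfl

theorem creation_maps (f : L2) {ψ φ : Fock} (h0 : level 0 φ = 0)
    (h : ∀ n, level (n + 1) φ = cL n f (level n ψ)) : (creationFormula f).Maps ψ φ := by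
  refine ((creationFormula f).maps_iff ψ φ).2 fun n => ?_
  match n with
  | 0 =>
    rw [h0]
    exact Lp.coeFn_zero _ _ _
  | n + 1 =>
    rw [h]
    exact coeFn_cL f (level n ψ)

theorem annihilation_maps (f : L2) {ψ φ : Fock}
    (h : ∀ n, level n φ = ContinuousLinearMap.adjoint (cL n f) (level (n + 1) ψ)) :
    (annihilationFormula f).Maps ψ φ := by
  refine ((annihilationFormula f).maps_iff ψ φ).2 fun n => ?_
  rw [h, adjoint_cL (level_mem_sector _ _)]
  filter_upwards [Lp.coeFn_smul (Real.sqrt (n + 1) : ℂ)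
      (ContinuousLinearMap.adjoint (tau 0 f) (level (n + 1) ψ)),
    coeFn_adjoint_tau f (level (n + 1) ψ)] with x h1 h2
  rw [h1, Pi.smul_apply, h2]
  rfl

theorem SectorFormula.mem_graph {Φ : SectorFormula} {D : Submodule ℂ Fock} {ψ φ : Fock}
    (hψ : ψ ∈ D) (h : Φ.Maps ψ φ) : (ψ, φ) ∈ (Φ.operator D).graph := by
  rw [LinearPMap.mem_graph_iff]
  refine ⟨⟨ψ, hψ, φ, h⟩, rfl, ?_⟩
  exact SectorFormula.Maps.unique (Exists.choose_spec _) h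

theorem add_mem_graph {R E F : Type*} [Ring R] [AddCommGroup E] [Module R E] [AddCommGroup F]
    [Module R F] {A B : E →ₗ.[R] F} {x : E} {y z : F} (hA : (x, y) ∈ A.graph)
    (hB : (x, z) ∈ B.graph) : (x, y + z) ∈ (A + B).graph := by
  rw [LinearPMap.mem_graph_iff] at hA hB ⊢
  obtain ⟨a, rfl, rfl⟩ := hA
  obtain ⟨b, hb, rfl⟩ := hB
  have hb' : (b : E) = a := hb
  refine ⟨⟨a, a.2, hb' ▸ b.2⟩, rfl, ?_⟩
  rw [LinearPMap.add_apply]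
  congr 2
  exact Subtype.ext hb.symm

theorem sub_mem_graph {R E F : Type*} [Ring R] [AddCommGroup E] [Module R E] [AddCommGroup F]
    [Module R F] {A B : E →ₗ.[R] F} {x : E} {y z : F} (hA : (x, y) ∈ A.graph)
    (hB : (x, z) ∈ B.graph) : (x, y - z) ∈ (A - B).graph := by
  rw [LinearPMap.mem_graph_iff] at hA hB ⊢
  obtain ⟨a, rfl, rfl⟩ := hA
  obtain ⟨b, hb, rfl⟩ := hB
  have hb' : (b : E) = a := hb
  refine ⟨⟨a, a.2, hb' ▸ b.2⟩, rfl, ?_⟩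
  rw [LinearPMap.sub_apply]
  congr 2
  exact Subtype.ext hb.symm

theorem smul_mem_graph {R E F : Type*} [CommRing R] [AddCommGroup E] [Module R E]
    [AddCommGroup F] [Module R F] {A : E →ₗ.[R] F} {x : E} {y : F} (hA : (x, y) ∈ A.graph)
    (c : R) : (x, c • y) ∈ (c • A).graph := by
  rw [LinearPMap.mem_graph_iff] at hA ⊢
  obtain ⟨a, rfl, rfl⟩ := hA
  exact ⟨a, rfl, rfl⟩

/-! ### The group generated by `B(k)` -/

theorem level_lift {n m : ℕ} {X : LN n →L[ℂ] LN m} (hX : ∀ φ ∈ sector n, X φ ∈ sector m)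
    (ψ : Fock) : level m (lift X ψ) = X (level n ψ) := by
  rw [lift_apply, level_ofLevel (hX _ (level_mem_sector n ψ))]

theorem level_lift_ne {n m j : ℕ} (hj : j ≠ m) {X : LN n →L[ℂ] LN m}
    (hX : ∀ φ ∈ sector n, X φ ∈ sector m) (ψ : Fock) : level j (lift X ψ) = 0 := by
  rw [lift_apply, level_ofLevel_ne hj (hX _ (level_mem_sector n ψ))]

theorem fockLadder_Q_apply (k : Kernel) (n : ℕ) (ψ : Fock) :
    (fockLadder k).Q n ψ = lp.single 2 n (ψ n) := ofLevel_of_mem (level_mem_sector n ψ)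

theorem norm_fockLadder_Q (k : Kernel) (n : ℕ) (ψ : Fock) : ‖(fockLadder k).Q n ψ‖ = ‖ψ n‖ := by
  rw [fockLadder_Q_apply, lp.norm_single (by norm_num)]

theorem level_fockLadder_Q (k : Kernel) (n : ℕ) (ψ : Fock) :
    level n ((fockLadder k).Q n ψ) = level n ψ := level_lift (fun _ h => h) ψ

theorem fockLadder_isFin_iff (k : Kernel) {ψ : Fock} :
    (fockLadder k).IsFin ψ ↔ ψ ∈ finiteVectors := by
  refine exists_congr fun L => forall₂_congr fun n _ => ?_
  rw [← norm_eq_zero, norm_fockLadder_Q, norm_eq_zero]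

/-- Of the operators `X m` with different target sectors `e' m`, only `X n` contributes to the
component in the sector `e' n`. -/
theorem level_sum_lift {e : ℕ → ℕ} {e' : ℕ → ℕ} (X : (m : ℕ) → LN (e m) →L[ℂ] LN (e' m))
    (hX : ∀ m, ∀ φ ∈ sector (e m), X m φ ∈ sector (e' m)) (he : Function.Injective e') {L n : ℕ}
    {ψ : Fock} (hψ : L ≤ n → level (e n) ψ = 0) :
    level (e' n) (∑ m ∈ Finset.range L, lift (X m) ψ) = X n (level (e n) ψ) := by
  rw [map_sum]
  have h0 : ∀ m, m ≠ n → level (e' n) (lift (X m) ψ) = 0 := fun m hm =>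
    level_lift_ne (fun h => hm (he h).symm) (hX m) ψ
  by_cases hn : n < L
  · rw [Finset.sum_eq_single n (fun m _ hm => h0 m hm)
      fun h' => absurd (Finset.mem_range.2 hn) h']
    exact level_lift (hX n) ψ
  · rw [hψ (not_lt.1 hn), map_zero]
    exact Finset.sum_eq_zero fun m hm => h0 m (by rw [Finset.mem_range] at hm; omega)

theorem pairCreation_maps_sum (k : Kernel) {ψ : Fock} {L : ℕ} (hψ : ∀ n, L ≤ n → level n ψ = 0) :
    (pairCreationFormula k).Maps ψ ((2 : ℂ) • ∑ m ∈ Finset.range L, lift (bL m k) ψ) := by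
  have hb : ∀ m, ∀ φ ∈ sector m, bL m k φ ∈ sector (m + 2) := fun m φ hφ => bL_mem_sector hφ k
  have h0 : ∀ j < 2, level j ((2 : ℂ) • ∑ m ∈ Finset.range L, lift (bL m k) ψ) = 0 := by
    intro j hj
    rw [map_smul, map_sum, Finset.sum_eq_zero fun m _ => level_lift_ne (by omega) (hb m) ψ,
      smul_zero]
  refine pairCreation_maps k (h0 0 two_pos) (h0 1 one_lt_two) fun n => ?_
  rw [map_smul]
  exact congrArg ((2 : ℂ) • ·) (level_sum_lift (e := fun m => m) (e' := fun m => m + 2)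
    (fun m => bL m k) hb (add_left_injective 2) (hψ n))

theorem pairAnnihilation_maps_sum (k : Kernel) {ψ : Fock} {L : ℕ}
    (hψ : ∀ n, L ≤ n → level n ψ = 0) : (pairAnnihilationFormula k).Maps ψ
      ((2 : ℂ) • ∑ m ∈ Finset.range L, lift (ContinuousLinearMap.adjoint (bL m k)) ψ) := by
  refine pairAnnihilation_maps k fun n => ?_
  rw [map_smul]
  exact congrArg ((2 : ℂ) • ·) (level_sum_lift (e := fun m => m + 2) (e' := fun m => m)
    (fun m => ContinuousLinearMap.adjoint (bL m k)) (fun m φ hφ => adjoint_bL_mem_sector hφ k)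
    Function.injective_id fun hn => hψ (n + 2) (by omega))

theorem fockLadder_B_apply (k : Kernel) (L : ℕ) (ψ : Fock) : (fockLadder k).B L ψ =
    (1 / 2 : ℂ) • ((2 : ℂ) • (∑ m ∈ Finset.range L, lift (bL m k) ψ) -
      (2 : ℂ) • ∑ m ∈ Finset.range L, lift (ContinuousLinearMap.adjoint (bL m k)) ψ) := by
  have h : ∀ x y : Fock, (1 / 2 : ℂ) • ((2 : ℂ) • x - (2 : ℂ) • y) = x - y := by
    intro x y
    module
  rw [h, LadderSystem.B_apply, ← Finset.sum_sub_distrib]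
  refine Finset.sum_congr rfl fun m _ => ?_
  exact congrArg (fun S : Fock →L[ℂ] Fock => lift (bL m k) ψ - S ψ) (star_lift (bL m k))

/-- On the vectors with finitely many particles, `B(k)` is the sum of the pair creation operators
minus their adjoints. -/
theorem mem_graph_quadB (k : Kernel) {ψ : Fock} {L : ℕ} (hψ : ∀ n, L ≤ n → level n ψ = 0) :
    (ψ, (fockLadder k).B L ψ) ∈ (quadB k).graph := by
  have hfin : ψ ∈ finiteVectors := ⟨L, fun n hn => Subtype.ext (hψ n hn)⟩
  rw [fockLadder_B_apply]
  exact smul_mem_graph (sub_mem_graph (SectorFormula.mem_graph hfin (pairCreation_maps_sum k hψ))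
    (SectorFormula.mem_graph hfin (pairAnnihilation_maps_sum k hψ))) _

/-- `B(k)` on the vectors with finitely many particles is the operator `∑ (b n - (b n)*)` of the
ladder system. -/
theorem graph_quadB (k : Kernel) : ((quadB k).graph : Set (Fock × Fock)) =
    (fockLadder k).graphB := by
  have hQ : ∀ {ψ : Fock} {L : ℕ}, (∀ n, L ≤ n → (fockLadder k).Q n ψ = 0) →
      (ψ, (fockLadder k).B L ψ) ∈ (quadB k).graph := fun h => mem_graph_quadB k fun n hn => by
    rw [← level_fockLadder_Q k, h n hn, map_zero]
  ext ⟨ψ, φ⟩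
  constructor
  · intro h
    obtain ⟨L, hL⟩ := (fockLadder_isFin_iff k).2
      (LinearPMap.mem_domain_of_mem_graph h).1.1
    rw [(quadB k).mem_graph_snd_inj h (hQ hL) rfl]
    exact (fockLadder k).mem_graphB hL
  · rintro ⟨⟨L, hL⟩, h⟩
    obtain ⟨M, h1, h2⟩ := (h.and (Filter.eventually_ge_atTop L)).exists
    have := hQ hL
    rwa [← (fockLadder k).B_eq_of_le h2 hL, h1] at this

theorem isGroupGeneratedBy_expB (k : Kernel) :
    IsGroupGeneratedBy (fockLadder k).expB (quadB k) where
  map_zero := (fockLadder k).expB_zero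
  map_add := (fockLadder k).expB_add
  continuous := (fockLadder k).continuous_expB
  generator := by
    rw [graph_quadB]
    exact (fockLadder k).genGraph_expB

theorem IsGroupGeneratedBy.eq_expB {k : Kernel} {V : ℝ → Fock →L[ℂ] Fock}
    (hV : IsGroupGeneratedBy V (quadB k)) : V = (fockLadder k).expB := by
  refine (fockLadder k).eq_expB hV.map_zero hV.map_add ?_
  rw [← graph_quadB]
  exact hV.generator

theorem T_eq_expB (k : Kernel) : T k = (fockLadder k).expB 1 := by
  have h : ∃ U, IsGroupGeneratedBy U (quadB k) := ⟨_, isGroupGeneratedBy_expB k⟩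
  rw [T, expOp, dif_pos h, h.choose_spec.eq_expB]

theorem fockLadder_neg_B (k : Kernel) (M : ℕ) : (fockLadder (-k)).B M = -(fockLadder k).B M := by
  have h : ∀ n, (fockLadder (-k)).b n = -(fockLadder k).b n := fun n => by
    ext1 ψ
    change ofLevel (n + 2) (bL n (-k) (level n ψ)) = -ofLevel (n + 2) (bL n k (level n ψ))
    exact (congrArg (fun X : LN n →L[ℂ] LN (n + 2) => ofLevel (n + 2) (X (level n ψ)))
      ((bL n).map_neg k)).trans ((ofLevel (n + 2)).map_neg _)
  simp only [LadderSystem.B, h, ← Finset.sum_neg_distrib, star_neg]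
  exact Finset.sum_congr rfl fun n _ => by abel

theorem LadderSystem.expB_of_B_eq_neg {H : Type*} [NormedAddCommGroup H]
    [InnerProductSpace ℂ H] [CompleteSpace H] {D D' : LadderSystem H}
    (h : ∀ M, D'.B M = -D.B M) (s : ℝ) : D'.expB s = D.expB (-s) := by
  ext1 ψ
  refine tendsto_nhds_unique (D'.tendsto_U s ψ) ?_
  convert! D.tendsto_U (-s) ψ using 2 with M
  rw [U, U, h, smul_neg, neg_smul]

theorem T_neg (k : Kernel) : T (-k) = star (T k) := by
  rw [T_eq_expB, T_eq_expB, LadderSystem.star_expB]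
  exact LadderSystem.expB_of_B_eq_neg (fockLadder_neg_B k) 1

theorem LadderSystem.star_expB_mul_expB {H : Type*} [NormedAddCommGroup H]
    [InnerProductSpace ℂ H] [CompleteSpace H] (D : LadderSystem H) (s : ℝ) :
    star (D.expB s) * D.expB s = 1 := by
  rw [star_expB, ← expB_add, neg_add_cancel, expB_zero]

theorem LadderSystem.expB_mul_star_expB {H : Type*} [NormedAddCommGroup H]
    [InnerProductSpace ℂ H] [CompleteSpace H] (D : LadderSystem H) (s : ℝ) :
    D.expB s * star (D.expB s) = 1 := by
  rw [star_expB, ← expB_add, add_neg_cancel, expB_zero]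

theorem star_T_mul_T (k : Kernel) : star (T k) * T k = 1 := by
  rw [T_eq_expB, LadderSystem.star_expB_mul_expB]

theorem T_mul_star_T (k : Kernel) : T k * star (T k) = 1 := by
  rw [T_eq_expB, LadderSystem.expB_mul_star_expB]

/-! ### The action of `T(k)` on the field operators -/

theorem mem_sqrtNumberDomain_iff (k : Kernel) (ψ : Fock) : ψ ∈ sqrtNumberDomain ↔
    Summable fun n : ℕ => ((n : ℝ) + 1) * ‖(fockLadder k).Q n ψ‖ ^ 2 := by
  have h := ((fockLadder k).hasSum_norm_sq ψ).summable
  simp only [norm_fockLadder_Q] at h ⊢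
  constructor
  · intro h1
    refine (Summable.add h1 h).congr fun n => ?_
    ring
  · intro h1
    refine (h1.sub h).congr fun n => ?_
    ring

/-- On the domain of the square root of the number operator, the fields `a(f)` and `a*(f)` are the
sums of their parts between neighbouring sectors. -/
theorem fieldA_mem_graph {k : Kernel} (hk : IsSymm k) {ψ : Fock} (hψ : ψ ∈ sqrtNumberDomain)
    (u : L2Sum) : (ψ, (fockField k hk).ann u.fst ψ + (fockField k hk).cre (star u.snd) ψ) ∈
      (fieldA u).graph := by
  have hs := (mem_sqrtNumberDomain_iff k ψ).1 hψ
  have hc : ∀ (f : L2) n, ∀ φ ∈ sector n, cL n f φ ∈ sector (n + 1) :=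
    fun f n φ hφ => cL_mem_sector hφ f
  have hc' : ∀ (f : L2) n, ∀ φ ∈ sector (n + 1),
      ContinuousLinearMap.adjoint (cL n f) φ ∈ sector n := fun f n φ hφ => adjoint_cL_mem_sector hφ f
  refine add_mem_graph (SectorFormula.mem_graph trivial (annihilation_maps _ fun n => ?_))
    (SectorFormula.mem_graph trivial (creation_maps _ ?_ fun n => ?_))
  · rw [← level_fockLadder_Q k]
    refine (congrArg (level n) ((fockField k hk).Q_ann hs u.fst n)).trans ?_
    refine (congrArg (fun S : Fock →L[ℂ] Fock => level n (S ψ)) (star_fockC n u.fst)).trans ?_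
    exact level_lift (hc' u.fst n) ψ
  · rw [← level_fockLadder_Q k]
    refine (congrArg (level 0) ((fockField k hk).Q_zero_cre hs (star u.snd))).trans ?_
    exact map_zero _
  · rw [← level_fockLadder_Q k]
    refine (congrArg (level (n + 1)) ((fockField k hk).Q_succ_cre hs (star u.snd) n)).trans ?_
    exact level_lift (hc (star u.snd) n) ψ

theorem T_mem_sqrtNumberDomain (k : Kernel) {ψ : Fock} (hψ : ψ ∈ sqrtNumberDomain) :
    T k ψ ∈ sqrtNumberDomain := by
  rw [mem_sqrtNumberDomain_iff k] at hψ ⊢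
  rw [T_eq_expB]
  exact (fockLadder k).summable_expB hψ 1

theorem star_T_fieldA_T {k : Kernel} (hk : IsSymm k) {ψ : Fock} (hψ : ψ ∈ sqrtNumberDomain)
    (u : L2Sum) : ∃ (h₁ : T k ψ ∈ (fieldA u).domain) (h₂ : ψ ∈ (fieldA (theta k u)).domain),
      star (T k) (fieldA u ⟨T k ψ, h₁⟩) = fieldA (theta k u) ⟨ψ, h₂⟩ := by
  have h1 := fieldA_mem_graph hk (T_mem_sqrtNumberDomain k hψ) u
  have h2 := fieldA_mem_graph hk hψ (theta k u)
  have d1 := LinearPMap.mem_domain_of_mem_graph h1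
  have d2 := LinearPMap.mem_domain_of_mem_graph h2
  refine ⟨d1, d2, ?_⟩
  have e1 := (fieldA u).mem_graph_snd_inj ((fieldA u).mem_graph ⟨T k ψ, d1⟩) h1 rfl
  have e2 := (fieldA (theta k u)).mem_graph_snd_inj
    ((fieldA (theta k u)).mem_graph ⟨ψ, d2⟩) h2 rfl
  have e3 := (fockField k hk).expB_ann_add_cre ((mem_sqrtNumberDomain_iff k ψ).1 hψ) u
  have hT : (fockField k hk).toLadderSystem.expB 1 = T k := (T_eq_expB k).symm
  rw [hT] at e3
  rw [e1, e2, ← e3, ← mul_apply_eq_comp, star_T_mul_T, one_apply_eq_self]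

end Bogoliubov

end

theorem lemmal :
    (∀ k : Kernel, IsSymm k →
      -- (i)
      ((∃ U, IsGroupGeneratedBy U (quadB k) ∧ U 1 = T k ∧
          ∀ V, IsGroupGeneratedBy V (quadB k) → V = U) ∧
        T k ∈ unitary (Fock →L[ℂ] Fock) ∧
        star (T k) = T (-k) ∧ T k * T (-k) = 1 ∧ T (-k) * T k = 1) ∧
      -- (ii)
      ((Summable fun n : ℕ =>
          ‖((Nat.factorial (2 * n) : ℂ)⁻¹) • (kop k * kop (star k)) ^ n‖) ∧
        (Summable fun n : ℕ =>
          ‖((Nat.factorial (2 * n + 1) : ℂ)⁻¹) • ((kop k * kop (star k)) ^ n * kop k)‖) ∧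
        IsBogoliubov (theta k) ∧
        ∀ ψ ∈ sqrtNumberDomain, T k ψ ∈ sqrtNumberDomain ∧
          ∀ f g : L2,
            ∃ (h₁ : T k ψ ∈ (fieldA (WithLp.toLp 2 (f, g))).domain)
              (h₂ : ψ ∈ (fieldA (theta k (WithLp.toLp 2 (f, g)))).domain),
              star (T k) (fieldA (WithLp.toLp 2 (f, g)) ⟨T k ψ, h₁⟩) =
                fieldA (theta k (WithLp.toLp 2 (f, g))) ⟨ψ, h₂⟩) ∧
      -- (iii)
      (IsHilbertSchmidt (pOp k) ∧ IsHilbertSchmidt (rOp k) ∧ IsHilbertSchmidt (sh k) ∧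
        ‖kernelOf (pOp k)‖ ≤ Real.exp ‖k‖ ∧
        ‖kernelOf (rOp k)‖ ≤ Real.exp ‖k‖ ∧
        ‖kernelOf (sh k)‖ ≤ Real.exp ‖k‖) ∧
      -- (iv)
      (gradNorm₁ k < ⊤ →
        gradNorm₂ k < ⊤ ∧
        (∀ G, MemLp G 2 → IsWeakGrad₁ k G → ∀ (f : L2) (j : Fin 3),
          IsWeakPartial j (kop k f) fun x => ∫ y, G (x, y) j * f y) ∧
        (∀ G, MemLp G 2 → IsWeakGrad₂ k G → ∀ f : E3 → ℂ, ContDiff ℝ ∞ f →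
          HasCompactSupport f → ∀ j : Fin 3, ∀ᵐ x : E3,
            ∫ y, G (x, y) j * f y = -∫ y, k (x, y) * fderiv ℝ f y (unitVec j)) ∧
        gradNorm₁ (kerComp k (star k)) < ⊤ ∧
        gradNorm₂ (kerComp (star k) k) < ⊤ ∧
        gradNorm₁ (kernelOf (pOp k)) ≤
          ENNReal.ofReal (Real.exp ‖k‖) * gradNorm₁ (kerComp k (star k)) ∧
        gradNorm₁ (kernelOf (rOp k)) ≤
          ENNReal.ofReal (Real.exp ‖k‖) * gradNorm₁ (kerComp k (star k)) ∧
        gradNorm₂ (kernelOf (pOp k)) ≤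
          ENNReal.ofReal (Real.exp ‖k‖) * gradNorm₂ (kerComp (star k) k) ∧
        gradNorm₂ (kernelOf (rOp k)) ≤
          ENNReal.ofReal (Real.exp ‖k‖) * gradNorm₂ (kerComp (star k) k))) ∧
    -- (v)
    (∃ C : ℝ, 0 < C ∧
      ∀ k : ℝ → Kernel, (∀ s, IsSymm (k s)) →
        ∀ (t : ℝ) (k' : Kernel), HasDerivAt k k' t →
          ∃ p' r' : Kernel,
            HasDerivAt (fun s => kernelOf (pOp (k s))) p' t ∧
            HasDerivAt (fun s => kernelOf (rOp (k s))) r' t ∧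
            ‖p'‖ ≤ ‖k'‖ * Real.exp ‖k t‖ ∧
            ‖r'‖ ≤ ‖k'‖ * Real.exp ‖k t‖ ∧
            (∀ D ∈ [p', r'],
              gradNorm₁ D ≤ ENNReal.ofReal (C * Real.exp ‖k t‖) *
                (ENNReal.ofReal ‖k'‖ * gradNorm₁ (kerComp (k t) (star (k t))) +
                  gradNorm₁ (kerComp k' (star (k t))) +
                  gradNorm₁ (kerComp (k t) (star k'))) ∧
              gradNorm₂ D ≤ ENNReal.ofReal (C * Real.exp ‖k t‖) *
                (ENNReal.ofReal ‖k'‖ * gradNorm₂ (kerComp (k t) (star (k t))) +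
                  gradNorm₂ (kerComp k' (star (k t))) +
                  gradNorm₂ (kerComp (k t) (star k'))))) := by
  refine ⟨fun k hk => ⟨⟨⟨_, isGroupGeneratedBy_expB k, (T_eq_expB k).symm, fun V hV => hV.eq_expB⟩,
      ⟨star_T_mul_T k, T_mul_star_T k⟩, (T_neg k).symm, ?_, ?_⟩,
    ⟨summable_norm_ch k, summable_norm_sh k, isBogoliubov_theta hk, fun ψ hψ =>
      ⟨T_mem_sqrtNumberDomain k hψ, fun f g => star_T_fieldA_T hk hψ _⟩⟩,
    ⟨isHilbertSchmidt_of_kop (kop_pKer k), isHilbertSchmidt_of_kop (kop_rKer k),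
      isHilbertSchmidt_of_kop (kop_shKer k), ?_, ?_, ?_⟩, fun h => ?_⟩,
    ⟨1, one_pos, fun k hs t k' hk => gradient_deriv_bounds hs hk⟩⟩
  · rw [T_neg, T_mul_star_T]
  · rw [T_neg, star_T_mul_T]
  · rw [kernelOf_eq (kop_pKer k)]
    exact norm_pKer_le k
  · rw [kernelOf_eq (kop_rKer k)]
    exact norm_rKer_le k
  · rw [kernelOf_eq (kop_shKer k)]
    exact norm_shKer_le k
  · obtain ⟨h1, h2, h3, h4⟩ := gradient_bounds hk h
    exact ⟨h1, fun G hG hw f j => isWeakPartial_kop k hG hw f j,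
      fun G hG hw f hf hc j => integral_grad₂_mul k hG hw hf hc j, h2, h3, h4⟩
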